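/- Let $FH$ be a finite Frobenius group with kernel $F$ and complement $H$, that is, $F$ is a nontrivial normal subgroup and $H$ a nontrivial subgroup of the finite group $FH$, $F\cap H=1$, and no nonidentity element of $H$ commutes with a nonidentity element of $F$. Let $FH$ act by automorphisms (not necessarily faithfully) on a finite $q$-group $Q$ for some prime $q$, and let $QFH=Q\rtimes FH$ be the corresponding semidirect product. Let $k$ be a field whose characteristic is coprime to $|QH|=|Q||H|$ (that is, the characteristic of $k$ is $0$ or a prime not dividing $|Q||H|$), and let $V$ be a $kQFH$-module. Put $C_Q(F)=\{x\in Q : x^f=x \text{ for all } f\in F\}$, $C_Q(H)=\{x\in Q : x^h=x\text{ for all }h\in H\}$ and $C_V(H)=\{v\in V : vh=v\text{ for all }h\in H\}$; the group $C_Q(H)$ acts on $C_V(H)$. If $C_Q(F)=1$, then $$\mathrm{Ker}(C_Q(H)\text{ on }C_V(H))=\mathrm{Ker}(C_Q(H)\text{ on }V),$$ where $\mathrm{Ker}(C_Q(H)\text{ on }X)$ is the set of elements of $C_Q(H)$ that act trivially on $X$. -/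

import Mathlib

/-- `A = FH` is a (finite) Frobenius group with kernel `F` and complement `H`: it is the internal
semidirect product of a nontrivial normal subgroup `F` and a nontrivial subgroup `H`, and no
nonidentity element of `H` centralizes a nonidentity element of `F`. -/
structure IsFrobeniusGroup {A : Type*} [Group A] (F H : Subgroup A) : Prop where
  finite : Finite A
  normal : F.Normal
  isComplement : F.IsComplement' H
  kernel_ne_bot : F ≠ ⊥
  complement_ne_bot : H ≠ ⊥
  fixedPointFree : ∀ h ∈ H, h ≠ 1 → ∀ f ∈ F, f ≠ 1 → h * f * h⁻¹ ≠ f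

/-- The external semidirect product `QA` of a group `Q` with a group `A` acting on `Q` by
automorphisms. -/
abbrev ActionProduct (Q A : Type*) [Group Q] [Group A] [MulDistribMulAction A Q] : Type _ :=
  Q ⋊[MulDistribMulAction.toMulAut A Q] A

section
variable {k Q A V : Type*} [Field k] [Group Q] [Group A] [MulDistribMulAction A Q]
  [AddCommGroup V] [Module k V]

/-- `C_V(H)`: the vectors of the `kQA`-module `V` that are fixed by the subgroup `H` of `A`. -/
def moduleCentralizer (ρ : Representation k (ActionProduct Q A) V) (H : Subgroup A) :
    Submodule k V where
  carrier := {v | ∀ h ∈ H, ρ (SemidirectProduct.inr h) v = v}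
  zero_mem' := fun _ _ => map_zero _
  add_mem' := fun hv hw h hh => by rw [map_add, hv h hh, hw h hh]
  smul_mem' := fun c _ hv h hh => by rw [map_smul, hv h hh]

/-- `Ker(C on W)`, for a subgroup `C` of `Q` and a subspace `W` of the `kQA`-module `V`: the
elements of `C` that fix every vector of `W`. -/
def kernelOn (ρ : Representation k (ActionProduct Q A) V) (C : Subgroup Q) (W : Submodule k V) :
    Subgroup Q where
  carrier := {x | x ∈ C ∧ ∀ w ∈ W, ρ (SemidirectProduct.inl x) w = w}
  one_mem' := ⟨C.one_mem, fun _ _ => by simp⟩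
  mul_mem' := fun hx hy => ⟨C.mul_mem hx.1 hy.1, fun w hw => by
    rw [map_mul, map_mul, Module.End.mul_apply, hy.2 w hw, hx.2 w hw]⟩
  inv_mem' := fun {x} hx => ⟨C.inv_mem hx.1, fun w hw => by
    have h := congrArg (ρ (SemidirectProduct.inl x⁻¹)) (hx.2 w hw)
    rw [← Module.End.mul_apply, ← map_mul, ← map_mul, inv_mul_cancel, map_one, map_one,
      Module.End.one_apply] at h
    exact h.symm⟩

/-- `C_Q(H)` acts on `C_V(H)`. -/
theorem apply_mem_moduleCentralizer (ρ : Representation k (ActionProduct Q A) V) (H : Subgroup A)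
    {x : Q} (hx : x ∈ FixedPoints.subgroup H Q) {v : V} (hv : v ∈ moduleCentralizer ρ H) :
    ρ (SemidirectProduct.inl x) v ∈ moduleCentralizer ρ H := by
  intro h hh
  have hc : (SemidirectProduct.inr h * SemidirectProduct.inl x : ActionProduct Q A)
      = SemidirectProduct.inl x * SemidirectProduct.inr h := by
    have e : h • x = x := hx ⟨h, hh⟩
    ext <;> simp [e]
  rw [← Module.End.mul_apply, ← map_mul, hc, map_mul, Module.End.mul_apply, hv h hh]

end

/-! All groups here are finite, so every vector of $V$ generates a finite-dimensional submodule. If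
$x$ is trivial on $C_V(H)$ then it fixes every sum $\sum_{h\in H} hv$, a condition that survives
extension to an algebraic closure. There $|Q|$ is invertible, so the module is the direct sum of its
homogeneous components for $Q$, obtained as joint eigenspaces of the class sums and permuted by
$FH$.

If a component has trivial stabilizer in $H$, its $H$-translates are independent and $x$-invariant.
Comparing coordinates in $x\sum hv=\sum hv$ then gives $xv=v$ (`apply_eq_of_trivial_stabilizer`).

For the other components let $T$ be the $q'$-part of the nilpotent group $F$. The condition
$C_Q(F)=1$ forces $C_Q(T)=1$, and by coprimeness $T$ has no nontrivial fixed points on quotients of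
$Q$ by $T$-invariant normal subgroups (`IsFrobeniusGroup.exists_coprime_kernel`). A count in $TH$
shows that a $T$-orbit of components has at most one member with nontrivial stabilizer in $H$
(`eq_of_smul_eq_of_mem_orbit`), so $x$ is trivial on all the others. If it were nontrivial on that
one, some $z\in Q$ trivial on the others and central modulo the kernel of the orbit would act on it
as a scalar $c\ne 1$. The product of the $T$-conjugates of $z$ is $T$-fixed modulo that kernel,
hence lies in it, and $c^m=1$ with $m$ the order of the stabilizer in $T$. Since $c$ has $q$-power
order and $m$ is prime to $q$, $c=1$ (`apply_eq_of_orbit`).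

Most of the text proves that $F$ is nilpotent, as a group with a fixed-point-free automorphism of
prime order (`isNilpotent_of_fixedPointFree`). The tool is Thompson's normal $p$-complement theorem
for odd $p$ (`isPNilpotent_of_thompson`): $p$-nilpotency of the normalizers of $J(P)$ and
$\Omega_1(Z(P))$ suffices. It rests on Frobenius' criterion (transfer and control of fusion), the
replacement theorem, and a lemma on quadratic action. -/

open Subgroup
open scoped commutatorElement IsMulCommutative Pointwise

/-! ### `p`-nilpotent groups and Sylow subgroups. -/

/-- A group is `p`-nilpotent if it has a normal subgroup consisting of elements of order coprime
to `p` whose quotient is a `p`-group. -/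
def IsPNilpotent (p : ℕ) (G : Type*) [Group G] : Prop :=
  ∃ N : Subgroup G, N.Normal ∧ (∀ x ∈ N, (orderOf x).Coprime p) ∧ ∀ x : G, ∃ k : ℕ, x ^ p ^ k ∈ N

theorem IsPNilpotent.of_injective {p : ℕ} {G G' : Type*} [Group G] [Group G']
    (hG : IsPNilpotent p G) (f : G' →* G) (hf : Function.Injective f) : IsPNilpotent p G' := by
  obtain ⟨N, hN, h1, h2⟩ := hG
  refine ⟨N.comap f, hN.comap f, fun x hx => ?_, fun x => ?_⟩
  · rw [← orderOf_injective f hf x]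
    exact h1 _ hx
  · obtain ⟨k, hk⟩ := h2 (f x)
    exact ⟨k, by simpa using hk⟩

theorem IsPNilpotent.of_surjective {p : ℕ} {G G' : Type*} [Group G] [Group G']
    (hG : IsPNilpotent p G) (f : G →* G') (hf : Function.Surjective f) : IsPNilpotent p G' := by
  obtain ⟨N, hN, h1, h2⟩ := hG
  refine ⟨N.map f, hN.map f hf, ?_, fun y => ?_⟩
  · rintro _ ⟨x, hx, rfl⟩
    exact (h1 x hx).coprime_dvd_left (orderOf_map_dvd f x)
  · obtain ⟨x, rfl⟩ := hf y
    obtain ⟨k, hk⟩ := h2 x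
    exact ⟨k, x ^ p ^ k, hk, map_pow f x _⟩

theorem IsPNilpotent.of_subgroup_eq_top {p : ℕ} {G : Type*} [Group G] {M : Subgroup G}
    (hM : IsPNilpotent p M) (h : M = ⊤) : IsPNilpotent p G := by
  subst h
  exact hM.of_injective (topEquiv.symm : G ≃* (⊤ : Subgroup G)).toMonoidHom
    (MulEquiv.injective _)

/-- A power of an element of finite order with exponent a power of `p` has order coprime to `p`. -/
theorem exists_orderOf_pow_coprime {p : ℕ} (hp : p.Prime) {G : Type*} [Group G] [Finite G]
    (x : G) : ∃ k : ℕ, (orderOf (x ^ p ^ k)).Coprime p := by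
  refine ⟨(orderOf x).factorization p, ?_⟩
  have hx : orderOf x ≠ 0 := (orderOf_pos x).ne'
  rw [orderOf_pow, Nat.gcd_eq_right (Nat.ordProj_dvd _ _)]
  exact (Nat.coprime_ordCompl hp hx).symm

theorem eq_one_of_coprime_of_pow_eq_one {p k : ℕ} {G : Type*} [Group G] {x : G}
    (h : (orderOf x).Coprime p) (hk : x ^ p ^ k = 1) : x = 1 := by
  have h1 : orderOf x ∣ p ^ k := orderOf_dvd_of_pow_eq_one hk
  exact orderOf_eq_one_iff.mp (Nat.Coprime.eq_one_of_dvd (h.pow_right k) h1)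

theorem IsPGroup.eq_one_of_coprime {p : ℕ} {G : Type*} [Group G] {P : Subgroup G}
    (hP : IsPGroup p P) {x : G} (hx : x ∈ P) (h : (orderOf x).Coprime p) : x = 1 := by
  obtain ⟨k, hk⟩ := hP ⟨x, hx⟩
  exact eq_one_of_coprime_of_pow_eq_one h (by simpa [Subtype.ext_iff] using hk)

theorem Sylow.exists_smul_eq {p : ℕ} [Fact p.Prime] {G : Type*} [Group G] [Finite G]
    (P Q : Sylow p G) : ∃ g : G, g • P = Q :=
  MulAction.exists_smul_eq G P Q

theorem Sylow.mem_smul_iff {p : ℕ} {G : Type*} [Group G] (P : Sylow p G) (g x : G) :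
    x ∈ g • P ↔ g⁻¹ * x * g ∈ P := by
  rw [← SetLike.mem_coe, Sylow.coe_smul, Set.mem_smul_set_iff_inv_smul_mem]
  simp

/-- The intersection of a Sylow subgroup with a normal subgroup is a Sylow subgroup of the
latter. -/
theorem Sylow.exists_eq_subgroupOf {p : ℕ} [Fact p.Prime] {G : Type*} [Group G] [Finite G]
    (P : Sylow p G) (N : Subgroup G) [hN : N.Normal] :
    ∃ Q : Sylow p N, (Q : Subgroup N) = (P : Subgroup G).subgroupOf N := by
  obtain ⟨Q⟩ := (inferInstance : Nonempty (Sylow p N))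
  obtain ⟨P', hP'⟩ := Sylow.exists_comap_subtype_eq Q
  obtain ⟨g, rfl⟩ := P.exists_smul_eq P'
  let e : N ≃* N := MulAut.conjNormal g⁻¹
  have hR : IsPGroup p ((P : Subgroup G).subgroupOf N) := P.2.comap_subtype
  obtain ⟨R, hR'⟩ := hR.exists_le_sylow
  refine ⟨R, le_antisymm ?_ hR'⟩
  have h1 : (R : Subgroup N).map (e.symm : N →* N) = Q := by
    refine Q.3 (R.2.map _) ?_
    rw [← hP']
    intro x hx
    refine ⟨e x, hR' ?_, by simp⟩
    have : (x : G) ∈ g • P := hx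
    rw [Sylow.mem_smul_iff] at this
    have h1 : ((e x : N) : G) = g⁻¹ * x * g := by simp [e]
    change ((e x : N) : G) ∈ P
    rwa [h1]
  intro x hx
  have h2 : e.symm x ∈ (Q : Subgroup N) := by
    rw [← h1]
    exact ⟨x, hx, rfl⟩
  rw [← hP'] at h2
  have h3 : ((e.symm x : N) : G) ∈ g • P := h2
  rw [Sylow.mem_smul_iff] at h3
  have h4 : ((e.symm x : N) : G) = g * x * g⁻¹ := by
    simp [e]
  rw [h4] at h3
  have h5 : g⁻¹ * (g * x * g⁻¹) * g = (x : G) := by group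
  rw [h5] at h3
  exact h3

/-! ### Transfer, fusion and Frobenius' criterion. -/

/-- Iterating the inclusion pushes $Q$ down the lower central series of $P$, which reaches the
trivial group. -/
theorem eq_bot_of_le_commutator {p : ℕ} [Fact p.Prime] {G : Type*} [Group G] [Finite G]
    {P Q : Subgroup G} (hP : IsPGroup p P) (hQP : Q ≤ P) (h : Q ≤ ⁅Q, P⁆) : Q = ⊥ := by
  have hn := hP.isNilpotent
  obtain ⟨n, hn⟩ := (Subgroup.isNilpotent_iff_lowerCentralSeries (S := P)).mp hn
  have : ∀ n, Q ≤ P.lowerCentralSeries n := by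
    intro n
    induction n with
    | zero => simpa using hQP
    | succ n ih => exact h.trans (commutator_mono ih le_rfl)
  exact le_bot_iff.mp (hn ▸ this n)

/-- The candidate for the $p$-complement is the subgroup $N$ generated by all $p'$-elements.
Transfer into the focal quotient of a Sylow subgroup $Q$ of $N$ has a $p$-group as target, so it
kills $N$, and $Q$ equals its focal subgroup in $N$. Control of fusion by a Sylow subgroup $P\ge Q$
of $G$ rewrites the focal generators as commutators with elements of $P$, whence $Q\le[Q,P]$ and
$Q=1$. -/
theorem isPNilpotent_of_controls_fusion {p : ℕ} [Fact p.Prime] {G : Type*} [Group G] [Finite G]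
    (h : ∀ P : Sylow p G, ∀ x ∈ P, ∀ g : G, g * x * g⁻¹ ∈ P →
      ∃ u ∈ P, g * x * g⁻¹ = u * x * u⁻¹) : IsPNilpotent p G := by
  have hp : p.Prime := Fact.out
  let S : Set G := {x | (orderOf x).Coprime p}
  let N : Subgroup G := closure S
  have hNn : N.Normal := by
    refine ⟨fun n hn g => ?_⟩
    have : N ≤ N.comap (MulAut.conj g).toMonoidHom := by
      refine (closure_le _).mpr fun x hx => subset_closure ?_
      change (orderOf (MulAut.conj g x)).Coprime p
      rw [MulEquiv.orderOf_eq]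
      exact hx
    simpa using this hn
  obtain ⟨Q⟩ := (inferInstance : Nonempty (Sylow p N))
  obtain ⟨P, hP⟩ := Sylow.exists_comap_subtype_eq Q
  have hker : ∀ x : N, Subgroup.transferFocal (Q : Subgroup N) x = 1 := by
    intro x
    have hx : ∀ y (hy : y ∈ N), Subgroup.transferFocal (Q : Subgroup N) ⟨y, hy⟩ = 1 := by
      intro y hy
      induction hy using closure_induction with
      | mem y hy =>
        have hcop : (orderOf (⟨y, subset_closure hy⟩ : N)).Coprime p := by
          rw [Subgroup.orderOf_mk]; exact hy
        obtain ⟨k, hk⟩ := (Q.2.to_quotient (Q : Subgroup N).focalSubgroupOf)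
          (Subgroup.transferFocal (Q : Subgroup N) ⟨y, subset_closure hy⟩)
        exact eq_one_of_coprime_of_pow_eq_one
          (hcop.coprime_dvd_left (orderOf_map_dvd _ _)) hk
      | one => exact map_one _
      | mul a b ha hb iha ihb =>
        have := map_mul (Subgroup.transferFocal (Q : Subgroup N)) ⟨a, ha⟩ ⟨b, hb⟩
        rw [iha, ihb, one_mul] at this
        exact this
      | inv a ha iha =>
        have := map_inv (Subgroup.transferFocal (Q : Subgroup N)) ⟨a, ha⟩
        rw [iha, inv_one] at this
        exact this
    exact hx x x.2
  have hfoc : (Q : Subgroup N) ≤ (Q : Subgroup N).focalSubgroup := by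
    rw [← Subgroup.ker_transferFocal_inf_eq_focalSubgroup]
    exact le_inf (fun x _ => hker x) le_rfl
  have hle : (Q : Subgroup N).map N.subtype ≤ ⁅(Q : Subgroup N).map N.subtype, (P : Subgroup G)⁆ := by
    refine (map_mono hfoc).trans ?_
    rw [map_le_iff_le_comap, Subgroup.focalSubgroup_def, closure_le]
    rintro g ⟨hg, x, hx, u, rfl⟩
    have hxP : (x : G) ∈ P := by rw [← hP] at hx; exact hx
    have hgP : ((⁅x, u⁆ : N) : G) ∈ P := by rw [← hP] at hg; exact hg
    rw [commutatorElement_def] at hgP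
    have h3 : (u : G) * (x : G)⁻¹ * (u : G)⁻¹ ∈ P := by
      have := mul_mem (inv_mem hxP) hgP
      simpa [mul_assoc] using this
    obtain ⟨v, hv, hv'⟩ := h P _ (inv_mem hxP) u h3
    change ((⁅x, u⁆ : N) : G) ∈ ⁅(Q : Subgroup N).map N.subtype, (P : Subgroup G)⁆
    have h4 : ((⁅x, u⁆ : N) : G) = ⁅(x : G), v⁆ := by
      simp only [commutatorElement_def, coe_mul, coe_inv]
      rw [mul_assoc (x : G), mul_assoc (x : G), mul_assoc (x : G), mul_assoc (x : G), hv']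
    rw [h4]
    exact commutator_mem_commutator ⟨x, hx, rfl⟩ hv
  have hQP : (Q : Subgroup N).map N.subtype ≤ P := by
    rw [← hP, map_le_iff_le_comap]
  have hbot := eq_bot_of_le_commutator P.2 hQP hle
  have hQbot : (Q : Subgroup N) = ⊥ :=
    (map_eq_bot_iff_of_injective _ N.subtype_injective).mp hbot
  refine ⟨N, hNn, fun x hx => ?_, fun x => ?_⟩
  · have hnd : ¬ p ∣ Nat.card N := fun hd => Q.ne_bot_of_dvd_card hd hQbot
    have h1 : (Nat.card N).Coprime p := ((Nat.Prime.coprime_iff_not_dvd hp).mpr hnd).symm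
    rw [← Subgroup.orderOf_mk x hx]
    exact h1.coprime_dvd_left (orderOf_dvd_natCard _)
  · obtain ⟨k, hk⟩ := exists_orderOf_pow_coprime hp x
    exact ⟨k, subset_closure hk⟩

/-- Factorization of a `p`-nilpotent group through a Sylow subgroup and the centralizer of a
normal `p`-subgroup. -/
theorem IsPNilpotent.exists_eq_mul {p : ℕ} [Fact p.Prime] {G : Type*} [Group G] [Finite G]
    (hG : IsPNilpotent p G) (S : Sylow p G) {D : Subgroup G} (hD : IsPGroup p D) [D.Normal]
    (g : G) : ∃ s ∈ S, ∃ k : G, (∀ d ∈ D, k * d = d * k) ∧ g = s * k := by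
  obtain ⟨N, hN, h1, h2⟩ := hG
  have hquot : IsPGroup p (G ⧸ N) := by
    intro x
    obtain ⟨x, rfl⟩ := QuotientGroup.mk_surjective x
    obtain ⟨k, hk⟩ := h2 x
    exact ⟨k, by rwa [← QuotientGroup.mk_pow, QuotientGroup.eq_one_iff]⟩
  have hsurj := QuotientGroup.mk'_surjective N
  have htop : (S : Subgroup G).map (QuotientGroup.mk' N) = ⊤ := by
    have := (S.mapSurjective hsurj).3 (Q := ⊤) (hquot.to_subgroup ⊤) le_top
    rw [Sylow.coe_mapSurjective] at this
    exact this.symm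
  obtain ⟨s, hs, hsg⟩ := (htop ▸ mem_top _ : QuotientGroup.mk' N g ∈ (S : Subgroup G).map _)
  have hk : s⁻¹ * g ∈ N := QuotientGroup.eq.mp hsg
  have hdisj : Disjoint N D := by
    rw [disjoint_def]
    exact fun {x} hx hx' => hD.eq_one_of_coprime hx' (h1 x hx)
  exact ⟨s, hs, s⁻¹ * g, fun d hd => commute_of_normal_of_disjoint N D hN ‹_› hdisj _ _ hk hd,
    by group⟩

/-- Normalizers grow in `p`-groups. -/
theorem IsPGroup.exists_mem_normalizer {p : ℕ} [Fact p.Prime] {G : Type*} [Group G] [Finite G]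
    {P D : Subgroup G} (hP : IsPGroup p P) (hDP : D < P) :
    ∃ x ∈ P, x ∉ D ∧ x ∈ normalizer (D : Set G) := by
  have hn := hP.isNilpotent
  have hlt : D.subgroupOf P < ⊤ := lt_top_iff_ne_top.mpr fun h =>
    hDP.not_ge (subgroupOf_eq_top.mp h)
  have := Group.normalizerCondition_of_isNilpotent (G := P) _ hlt
  obtain ⟨x, hx, hxD⟩ := SetLike.exists_of_lt this
  refine ⟨x, x.2, hxD, ?_⟩
  rw [Subgroup.mem_normalizer_iff] at hx ⊢
  intro y
  constructor
  · intro hy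
    exact (hx ⟨y, hDP.le hy⟩).mp hy
  · intro hy
    have hyP : y ∈ P := by
      have := mul_mem (mul_mem (inv_mem x.2) (hDP.le hy)) x.2
      simpa [mul_assoc] using this
    exact (hx ⟨y, hyP⟩).mpr hy

/-- An Alperin-style argument by downward induction on $|P\cap Q|$. With $D=P\cap Q$, the pair is
joined by a chain of Sylow subgroups whose outer links meet in more than $D$. The middle link lies
in the $p$-nilpotent group $N(D)$, where a conjugating element can be chosen to centralize $D$. -/
theorem Sylow.exists_centralizer_smul_eq {p : ℕ} [Fact p.Prime] {G : Type*} [Group G] [Finite G]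
    (h : ∀ X : Subgroup G, IsPGroup p X → X ≠ ⊥ → IsPNilpotent p (normalizer (X : Set G))) :
    ∀ (n : ℕ) (P Q : Sylow p G), Nat.card G - Nat.card ((P : Subgroup G) ⊓ Q : Subgroup G) = n →
      ∃ c : G, (∀ d ∈ (P : Subgroup G) ⊓ Q, c * d = d * c) ∧ c • P = Q := by
  intro n
  induction n using Nat.strong_induction_on with
  | _ n ih =>
  intro P Q hn
  have step : ∀ (P' Q' : Sylow p G), (P : Subgroup G) ⊓ Q < (P' : Subgroup G) ⊓ Q' →
      ∃ c : G, (∀ d ∈ (P : Subgroup G) ⊓ Q, c * d = d * c) ∧ c • P' = Q' := by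
    intro P' Q' hlt
    have h1 : Nat.card ((P : Subgroup G) ⊓ Q : Subgroup G) <
        Nat.card ((P' : Subgroup G) ⊓ Q' : Subgroup G) :=
      Set.Finite.card_lt_card (Set.toFinite _) hlt
    have h2 : Nat.card ((P' : Subgroup G) ⊓ Q' : Subgroup G) ≤ Nat.card G := card_le_card_group _
    obtain ⟨c, hc, hc'⟩ := ih _ (by omega) P' Q' rfl
    exact ⟨c, fun d hd => hc d (hlt.le hd), hc'⟩
  by_cases hPQ : P = Q
  · exact ⟨1, by simp, by simp [hPQ]⟩
  by_cases hD : (P : Subgroup G) ⊓ Q = ⊥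
  · obtain ⟨g, hg⟩ := P.exists_smul_eq Q
    refine ⟨g, ?_, hg⟩
    rw [hD]
    intro d hd
    rw [mem_bot.mp hd]; simp
  have hDP : (P : Subgroup G) ⊓ Q < P := lt_of_le_of_ne inf_le_left fun he =>
    hPQ (Sylow.ext (P.3 Q.2 (inf_eq_left.mp he)).symm)
  have hDQ : (P : Subgroup G) ⊓ Q < Q := lt_of_le_of_ne inf_le_right fun he =>
    hPQ (Sylow.ext (Q.3 P.2 (inf_eq_right.mp he)))
  set D := (P : Subgroup G) ⊓ Q with hDdef
  have hDp : IsPGroup p D := P.2.to_le inf_le_left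
  let M := normalizer (D : Set G)
  have hM : IsPNilpotent p M := h D hDp hD
  have hDM : D ≤ M := le_normalizer
  obtain ⟨S, hS⟩ := (P.2.comap_subtype (K := M)).exists_le_sylow
  obtain ⟨T, hT⟩ := (Q.2.comap_subtype (K := M)).exists_le_sylow
  obtain ⟨m, hm⟩ := S.exists_smul_eq T
  have : (D.subgroupOf M).Normal := normal_in_normalizer
  -- The factor $s\in T$ normalizes $T$, so $k$ alone already carries $S$ to $T$, and $k$
  -- centralizes $D$.
  obtain ⟨s, hs, k, hk, rfl⟩ := hM.exists_eq_mul T (D := D.subgroupOf M)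
    (hDp.comap_subtype) m
  have hkT : k • S = T := by
    rw [mul_smul, smul_eq_iff_eq_inv_smul] at hm
    rw [hm, Sylow.smul_eq_iff_mem_normalizer]
    exact inv_mem (le_normalizer hs)
  have hkD : ∀ d ∈ D, (k : G) * d = d * k := by
    intro d hd
    have := hk ⟨d, hDM hd⟩ hd
    exact congrArg Subtype.val this
  obtain ⟨S', hS'⟩ := (S.2.map M.subtype).exists_le_sylow
  -- Normalizers grow in $P$, so $P\cap N(D)$, which lies in $P\cap S'$, is strictly larger than
  -- $D$. The same reasoning in $Q$ handles the pair $kS'$, $Q$.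
  obtain ⟨c1, hc1, hc1'⟩ := step P S' (by
    obtain ⟨x, hxP, hxD, hxM⟩ := P.2.exists_mem_normalizer hDP
    have hle : (P : Subgroup G) ⊓ M ≤ (P : Subgroup G) ⊓ S' := by
      rintro y ⟨hyP, hyM⟩
      exact ⟨hyP, hS' ⟨⟨y, hyM⟩, hS hyP, rfl⟩⟩
    refine lt_of_le_of_ne ((le_inf hDP.le hDM).trans hle) fun he => hxD ?_
    rw [he]
    exact hle ⟨hxP, hxM⟩)
  obtain ⟨c2, hc2, hc2'⟩ := step ((k : G) • S') Q (by
    obtain ⟨x, hxQ, hxD, hxM⟩ := Q.2.exists_mem_normalizer hDQ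
    have hle : (Q : Subgroup G) ⊓ M ≤ (((k : G) • S' : Sylow p G) : Subgroup G) ⊓ Q := by
      rintro y ⟨hyQ, hyM⟩
      refine ⟨?_, hyQ⟩
      have h1 : (⟨y, hyM⟩ : M) ∈ k • S := by
        rw [hkT]
        exact hT hyQ
      rw [Sylow.mem_smul_iff] at h1
      change y ∈ (k : G) • S'
      rw [Sylow.mem_smul_iff]
      exact hS' ⟨_, h1, rfl⟩
    refine lt_of_le_of_ne ((le_inf hDQ.le hDM).trans hle) fun he => hxD ?_
    rw [he]
    exact hle ⟨hxQ, hxM⟩)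
  refine ⟨c2 * k * c1, fun d hd => ?_, ?_⟩
  · have e1 : Commute c1 d := hc1 d hd
    have e2 : Commute (k : G) d := hkD d hd
    have e3 : Commute c2 d := hc2 d hd
    exact ((e3.mul_left e2).mul_left e1)
  · rw [mul_smul, hc1', mul_smul, hc2']

/-- **Frobenius' criterion** for `p`-nilpotency. -/
theorem isPNilpotent_of_normalizers {p : ℕ} [Fact p.Prime] {G : Type*} [Group G] [Finite G]
    (h : ∀ X : Subgroup G, IsPGroup p X → X ≠ ⊥ → IsPNilpotent p (normalizer (X : Set G))) :
    IsPNilpotent p G := by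
  refine isPNilpotent_of_controls_fusion fun P x hx g hg => ?_
  by_cases hP : (P : Subgroup G) = ⊥
  · have : x = 1 := by
      have : x ∈ (P : Subgroup G) := hx
      rwa [hP, mem_bot] at this
    exact ⟨1, one_mem _, by simp [this]⟩
  -- As $x$ lies in both $P$ and $g^{-1}Pg$, the element $c$ centralizes $x$, while $gc$ normalizes
  -- $P$. Writing $gc=sk$ with $s\in P$ and $k$ centralizing $P$ shows that $s$ conjugates $x$ just
  -- as $g$ does.
  obtain ⟨c, hc, hc'⟩ := Sylow.exists_centralizer_smul_eq h _ P (g⁻¹ • P) rfl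
  have hxg : x ∈ g⁻¹ • P := by
    rw [Sylow.mem_smul_iff]
    simpa using hg
  have hcx : c * x = x * c := hc x ⟨hx, hxg⟩
  have hN : g * c ∈ normalizer ((P : Subgroup G) : Set G) := by
    refine Sylow.smul_eq_iff_mem_normalizer.mp ?_
    rw [mul_smul, hc', smul_inv_smul]
  have : ((P : Subgroup G).subgroupOf (normalizer ((P : Subgroup G) : Set G))).Normal :=
    normal_in_normalizer
  obtain ⟨s, hs, k, hk, hsk⟩ := (h P P.2 hP).exists_eq_mul (P.subtype le_normalizer)
    (D := (P : Subgroup G).subgroupOf (normalizer ((P : Subgroup G) : Set G)))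
    P.2.comap_subtype ⟨g * c, hN⟩
  refine ⟨s, hs, ?_⟩
  have hkx : (k : G) * x = x * k := congrArg Subtype.val (hk ⟨x, le_normalizer hx⟩ hx)
  have hgc : g * c = s * k := congrArg Subtype.val hsk
  have e1 : g * x * g⁻¹ = (g * c) * x * (g * c)⁻¹ := by
    rw [mul_assoc g c x, hcx]; group
  rw [e1, hgc, mul_assoc (s : G) k x, hkx]; group

/-! ### The Thompson subgroup and $\Omega_1(Z(P))$. -/

/-- `B` is an abelian subgroup of `P` of largest possible order. -/
def IsMaxAbelianIn {G : Type*} [Group G] (P A : Subgroup G) : Prop :=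
  A ≤ P ∧ (∀ x ∈ A, ∀ y ∈ A, x * y = y * x) ∧
    ∀ B ≤ P, (∀ x ∈ B, ∀ y ∈ B, x * y = y * x) → Nat.card B ≤ Nat.card A

/-- The Thompson subgroup: generated by the abelian subgroups of maximal order. -/
def thompsonSubgroup {G : Type*} [Group G] (P : Subgroup G) : Subgroup G :=
  sSup {A | IsMaxAbelianIn P A}

/-- The elements of order dividing `p` in the center of `P`. -/
def omegaCenter (p : ℕ) {G : Type*} [Group G] (P : Subgroup G) : Subgroup G where
  carrier := {z | z ∈ P ∧ z ^ p = 1 ∧ ∀ x ∈ P, z * x = x * z}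
  one_mem' := ⟨one_mem _, one_pow _, by simp⟩
  mul_mem' := by
    rintro a b ⟨ha, hap, hac⟩ ⟨hb, hbp, hbc⟩
    refine ⟨mul_mem ha hb, ?_, fun x hx => ?_⟩
    · rw [Commute.mul_pow (hac b hb), hap, hbp, one_mul]
    · exact Commute.mul_left (hac x hx) (hbc x hx)
  inv_mem' := by
    rintro a ⟨ha, hap, hac⟩
    refine ⟨inv_mem ha, by rw [inv_pow, hap, inv_one], fun x hx => ?_⟩
    exact Commute.inv_left (hac x hx)

theorem omegaCenter_le (p : ℕ) {G : Type*} [Group G] (P : Subgroup G) : omegaCenter p P ≤ P :=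
  fun _ h => h.1

theorem thompsonSubgroup_le {G : Type*} [Group G] (P : Subgroup G) : thompsonSubgroup P ≤ P :=
  sSup_le fun _ h => h.1

theorem map_omegaCenter (p : ℕ) {G G' : Type*} [Group G] [Group G'] (f : G →* G')
    (hf : Function.Injective f) (P : Subgroup G) :
    (omegaCenter p P).map f = omegaCenter p (P.map f) := by
  ext y
  constructor
  · rintro ⟨z, ⟨hz, hzp, hzc⟩, rfl⟩
    refine ⟨⟨z, hz, rfl⟩, by rw [← map_pow, hzp, map_one], ?_⟩
    rintro _ ⟨x, hx, rfl⟩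
    rw [← map_mul, hzc x hx, map_mul]
  · rintro ⟨⟨z, hz, rfl⟩, hzp, hzc⟩
    refine ⟨z, ⟨hz, hf (by rw [map_pow, hzp, map_one]), fun x hx => hf ?_⟩, rfl⟩
    rw [map_mul, hzc _ ⟨x, hx, rfl⟩, map_mul]

theorem IsMaxAbelianIn.map {G G' : Type*} [Group G] [Group G'] {f : G →* G'}
    (hf : Function.Injective f) {P A : Subgroup G} (h : IsMaxAbelianIn P A) :
    IsMaxAbelianIn (P.map f) (A.map f) := by
  refine ⟨map_mono h.1, ?_, fun B hB hBc => ?_⟩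
  · rintro _ ⟨x, hx, rfl⟩ _ ⟨y, hy, rfl⟩
    rw [← map_mul, h.2.1 x hx y hy, map_mul]
  · have hBr : (B.comap f).map f = B := map_comap_eq_self (hB.trans (map_le_range f P))
    rw [← hBr, card_map_of_injective hf, card_map_of_injective hf]
    refine h.2.2 _ ?_ fun x hx y hy => hf ?_
    · rw [← comap_map_eq_self_of_injective hf P]
      exact comap_mono hB
    · rw [map_mul, map_mul]
      exact hBc _ hx _ hy

theorem IsMaxAbelianIn.of_map {G G' : Type*} [Group G] [Group G'] {f : G →* G'}
    (hf : Function.Injective f) {P A : Subgroup G} (h : IsMaxAbelianIn (P.map f) (A.map f)) :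
    IsMaxAbelianIn P A := by
  refine ⟨(map_le_map_iff_of_injective hf).mp h.1, fun x hx y hy => hf ?_, fun B hB hBc => ?_⟩
  · rw [map_mul, map_mul]
    exact h.2.1 _ ⟨x, hx, rfl⟩ _ ⟨y, hy, rfl⟩
  · rw [← card_map_of_injective (K := B) hf, ← card_map_of_injective (K := A) hf]
    refine h.2.2 _ (map_mono hB) ?_
    rintro _ ⟨x, hx, rfl⟩ _ ⟨y, hy, rfl⟩
    rw [← map_mul, hBc x hx y hy, map_mul]

theorem map_thompsonSubgroup {G G' : Type*} [Group G] [Group G'] (f : G →* G')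
    (hf : Function.Injective f) (P : Subgroup G) :
    (thompsonSubgroup P).map f = thompsonSubgroup (P.map f) := by
  apply le_antisymm
  · rw [map_le_iff_le_comap]
    refine sSup_le fun A hA => ?_
    rw [← map_le_iff_le_comap]
    exact le_sSup (hA.map hf)
  · refine sSup_le fun A hA => ?_
    have hAr : (A.comap f).map f = A := map_comap_eq_self (hA.1.trans (map_le_range f P))
    rw [← hAr]
    refine map_mono (le_sSup (IsMaxAbelianIn.of_map hf ?_))
    rwa [hAr]

theorem exists_isMaxAbelianIn {G : Type*} [Group G] [Finite G] (P : Subgroup G) :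
    ∃ A, IsMaxAbelianIn P A := by
  obtain ⟨A, hA, hmax⟩ := Set.exists_max_image
    {A : Subgroup G | A ≤ P ∧ ∀ x ∈ A, ∀ y ∈ A, x * y = y * x} (fun A => Nat.card A)
    (Set.toFinite _) ⟨⊥, bot_le, by simp⟩
  exact ⟨A, hA.1, hA.2, fun B hB hBc => hmax B ⟨hB, hBc⟩⟩

theorem thompsonSubgroup_ne_bot {G : Type*} [Group G] [Finite G] {P : Subgroup G} (hP : P ≠ ⊥) :
    thompsonSubgroup P ≠ ⊥ := by
  obtain ⟨A, hA⟩ := exists_isMaxAbelianIn P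
  obtain ⟨x, hx, hx1⟩ := (bot_or_exists_ne_one P).resolve_left hP
  intro h
  have hA' : A = ⊥ := le_bot_iff.mp (h ▸ le_sSup hA)
  have h1 := hA.2.2 (zpowers x) (by simpa using hx) (by
    rintro _ ⟨m, rfl⟩ _ ⟨n, rfl⟩
    exact (Commute.refl x).zpow_zpow m n)
  rw [hA', card_bot] at h1
  have h2 : zpowers x = ⊥ := card_eq_one.mp (le_antisymm h1 Nat.card_pos)
  exact hx1 (zpowers_eq_bot.mp h2)

theorem omegaCenter_ne_bot_of_dvd {p : ℕ} [Fact p.Prime] {G : Type*} [Group G] [Finite G]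
    {P : Subgroup G} (hd : p ∣ Nat.card (center P)) : omegaCenter p P ≠ ⊥ := by
  obtain ⟨z, hz⟩ := exists_prime_orderOf_dvd_card' p hd
  intro h
  have hmem : ((z : P) : G) ∈ omegaCenter p P := by
    refine ⟨z.1.2, ?_, fun x hx => ?_⟩
    · have : z ^ p = 1 := hz ▸ pow_orderOf_eq_one z
      exact congrArg (fun t : center P => ((t : P) : G)) this
    · exact (congrArg Subtype.val (mem_center_iff.mp z.2 ⟨x, hx⟩)).symm
  rw [h, mem_bot] at hmem
  have hz1 : z = 1 := Subtype.ext (Subtype.ext hmem)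
  rw [hz1, orderOf_one] at hz
  exact (Fact.out : p.Prime).one_lt.ne hz

theorem omegaCenter_ne_bot {p : ℕ} [Fact p.Prime] {G : Type*} [Group G] [Finite G]
    {P : Subgroup G} (hPp : IsPGroup p P) (hP : P ≠ ⊥) : omegaCenter p P ≠ ⊥ := by
  have : Nontrivial P := (nontrivial_iff_ne_bot P).mpr hP
  have hc := hPp.center_nontrivial
  exact omegaCenter_ne_bot_of_dvd
    ((hPp.to_subgroup (center P)).card_eq_or_dvd.resolve_left
      (fun h => (Finite.one_lt_card (α := center P)).ne' h))

/-! ### Quadratic action in odd characteristic. -/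

/-- A unit acting quadratically and normalizing a commuting set of elements of finite order
coprime to the odd characteristic commutes with that set. -/
theorem commute_of_quadratic {E : Type*} [Ring E] (p : ℕ) [Fact p.Prime] [CharP E p]
    (hp2 : p ≠ 2) (T : Set E) (hT : ∀ s ∈ T, ∀ t ∈ T, s * t = t * s) (N : ℕ) (hN : N.Coprime p)
    (hTN : ∀ t ∈ T, t ^ N = 1) (n : E) (hn : n * n = 0)
    (h1 : ∀ t ∈ T, (1 + n) * t * (1 - n) ∈ T) (h2 : ∀ t ∈ T, (1 - n) * t * (1 + n) ∈ T) :
    ∀ t ∈ T, n * t = t * n := by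
  have hp : p.Prime := Fact.out
  let R := Subring.closure T
  have hcomm : ∀ r ∈ R, ∀ s ∈ R, r * s = s * r := by
    intro r hr s hs
    exact congrArg Subtype.val
      ((Subring.isMulCommutative_closure hT).is_comm.comm (⟨r, hr⟩ : R) ⟨s, hs⟩)
  -- Such an $m$ makes $t^{p^m}=t$ on $T$. On the commutative ring $R$ of characteristic $p$ the map
  -- $r\mapsto r^{p^m}$ is additive, so it is the identity on all of $R$. Positivity of $m$ makes
  -- the exponent at least $2$, and therefore $R$ is reduced.
  obtain ⟨m, hm, hmN⟩ : ∃ m : ℕ, 0 < m ∧ p ^ m ≡ 1 [MOD N] := by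
    by_cases hN0 : N = 0
    · subst hN0
      rw [Nat.coprime_zero_left] at hN
      exact absurd hN hp.one_lt.ne'
    · exact ⟨N.totient, Nat.totient_pos.mpr (Nat.pos_of_ne_zero hN0),
        Nat.ModEq.pow_totient hN.symm⟩
  have hfrob : ∀ r ∈ R, r ^ p ^ m = r := by
    intro r hr
    induction hr using Subring.closure_induction with
    | mem t ht =>
      have hd : N ∣ p ^ m - 1 := (Nat.modEq_iff_dvd' (Nat.one_le_pow _ _ hp.pos)).mp hmN.symm
      have he : p ^ m = (p ^ m - 1) + 1 := (Nat.sub_add_cancel (Nat.one_le_pow _ _ hp.pos)).symm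
      obtain ⟨c, hc⟩ := hd
      rw [he, hc, pow_succ, pow_mul, hTN t ht, one_pow, one_mul]
    | zero => exact zero_pow (pow_pos hp.pos m).ne'
    | one => exact one_pow _
    | add a b ha hb iha ihb => rw [add_pow_char_pow_of_commute _ _ (hcomm a ha b hb), iha, ihb]
    | neg a ha iha =>
      rw [neg_pow, iha, (Odd.pow (hp.odd_of_ne_two hp2)).neg_one_pow, neg_one_mul]
    | mul a b ha hb iha ihb => rw [Commute.mul_pow (hcomm a ha b hb), iha, ihb]
  have hred : ∀ r ∈ R, r * r = 0 → r = 0 := by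
    intro r hr h0
    rw [← hfrob r hr]
    have h2 : 2 ≤ p ^ m := hp.two_le.trans (Nat.le_self_pow hm.ne' p)
    rw [← Nat.sub_add_cancel h2, pow_add, sq, h0, mul_zero]
  have hi1 : (1 - n) * (1 + n) = 1 := by
    have : (1 - n) * (1 + n) = 1 - n * n := by noncomm_ring
    rw [this, hn, sub_zero]
  have hi2 : (1 + n) * (1 - n) = 1 := by
    have : (1 + n) * (1 - n) = 1 - n * n := by noncomm_ring
    rw [this, hn, sub_zero]
  have hconj : ∀ a b : E, b * a = 1 → (∀ t ∈ T, a * t * b ∈ T) → a * b = 1 →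
      ∀ r ∈ R, a * r * b ∈ R := by
    intro a b hba hab hab1 r hr
    induction hr using Subring.closure_induction with
    | mem t ht => exact Subring.subset_closure (hab t ht)
    | zero => simp
    | one => simp [hab1]
    | add x y hx hy ihx ihy => rw [mul_add, add_mul]; exact add_mem ihx ihy
    | neg x hx ihx => rw [mul_neg, neg_mul]; exact neg_mem ihx
    | mul x y hx hy ihx ihy =>
      have : a * (x * y) * b = (a * x * b) * (a * y * b) := by
        calc a * (x * y) * b = a * x * 1 * y * b := by noncomm_ring
          _ = a * x * (b * a) * y * b := by rw [hba]
          _ = _ := by noncomm_ring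
      rw [this]; exact mul_mem ihx ihy
  have h2ne : ∀ x : E, x + x = 0 → x = 0 := by
    intro x hx
    have h3 : (p : E) = 0 := CharP.cast_eq_zero E p
    obtain ⟨c, hc⟩ := hp.odd_of_ne_two hp2
    have h4 : (p : E) * x = 0 := by rw [h3, zero_mul]
    rw [hc] at h4
    push_cast at h4
    have h5 : (2 * (c : E) + 1) * x = c * (x + x) + x := by noncomm_ring
    rw [h5, hx, mul_zero, zero_add] at h4
    exact h4
  -- Adding the two conjugates of $r$ cancels the terms linear in $n$, so $2nrn\in R$. It squares to
  -- zero because $n^2=0$, hence vanishes, and $2$ cancels as $p$ is odd.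
  have hnrn : ∀ r ∈ R, n * r * n = 0 := by
    intro r hr
    apply h2ne
    have e : n * r * n + n * r * n
        = r + r - (1 + n) * r * (1 - n) - (1 - n) * r * (1 + n) := by noncomm_ring
    apply hred
    · rw [e]
      exact sub_mem (sub_mem (add_mem hr hr) (hconj _ _ hi1 h1 hi2 r hr))
        (hconj _ _ hi2 h2 hi1 r hr)
    · have : (n * r * n + n * r * n) * (n * r * n + n * r * n)
          = (n * r + n * r) * (n * n) * (r * n + r * n) := by noncomm_ring
      rw [this, hn, mul_zero, zero_mul]
  intro t ht
  have htR : t ∈ R := Subring.subset_closure ht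
  rw [← sub_eq_zero]
  apply hred
  · have e : n * t - t * n = (1 + n) * t * (1 - n) - t + n * t * n := by noncomm_ring
    rw [e, hnrn t htR, add_zero]
    exact sub_mem (hconj _ _ hi1 h1 hi2 t htR) htR
  · have e : (n * t - t * n) * (n * t - t * n)
        = (n * t * n) * t - n * (t * t) * n - t * (n * n) * t + t * (n * t * n) := by noncomm_ring
    rw [e, hnrn t htR, hnrn _ (mul_mem htR htR), hn]
    simp

/-! ### Abelian subgroups of maximal order and Thompson replacement. -/

theorem Subgroup.mem_sup_of_le_normalizer {G : Type*} [Group G] {A N : Subgroup G}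
    (h : A ≤ normalizer (N : Set G)) {x : G} :
    x ∈ A ⊔ N ↔ ∃ a ∈ A, ∃ n ∈ N, x = a * n := by
  rw [← SetLike.mem_coe, coe_mul_of_left_le_normalizer_right A N h, Set.mem_mul]
  constructor
  · rintro ⟨a, ha, n, hn, rfl⟩; exact ⟨a, ha, n, hn, rfl⟩
  · rintro ⟨a, ha, n, hn, rfl⟩; exact ⟨a, ha, n, hn, rfl⟩

theorem IsMaxAbelianIn.eq_card {G : Type*} [Group G] {P A B : Subgroup G}
    (hA : IsMaxAbelianIn P A) (hB : B ≤ P) (hBc : ∀ x ∈ B, ∀ y ∈ B, x * y = y * x)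
    (h : Nat.card A ≤ Nat.card B) : IsMaxAbelianIn P B :=
  ⟨hB, hBc, fun D hD hDc => (hA.2.2 D hD hDc).trans h⟩

theorem Subgroup.mem_normalizer_of_conj_mem {G : Type*} [Group G] [Finite G] {A : Subgroup G}
    {v : G} (h : ∀ a ∈ A, v * a * v⁻¹ ∈ A) : v ∈ normalizer (A : Set G) := by
  have h1 : A.map (MulAut.conj v).toMonoidHom ≤ A := by
    rintro _ ⟨a, ha, rfl⟩
    exact h a ha
  have h2 : A.map (MulAut.conj v).toMonoidHom = A :=
    eq_of_le_of_card_ge h1 (card_map_of_injective (MulAut.conj v).injective).ge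
  rw [mem_normalizer_iff]
  refine fun a => ⟨h a, fun ha => ?_⟩
  rw [← h2] at ha
  obtain ⟨b, hb, hba⟩ := ha
  rwa [← (MulAut.conj v).injective hba]

/-- A maximal abelian subgroup contains each element of the ambient subgroup that commutes
with it. -/
theorem IsMaxAbelianIn.mem_of_commute {G : Type*} [Group G] [Finite G] {P A : Subgroup G}
    (hA : IsMaxAbelianIn P A) {z : G} (hz : z ∈ P) (hc : ∀ a ∈ A, z * a = a * z) : z ∈ A := by
  have hle : zpowers z ≤ normalizer (A : Set G) := by
    rw [zpowers_le, mem_normalizer_iff]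
    intro a
    constructor
    · intro ha
      rwa [hc a ha, mul_inv_cancel_right]
    · intro ha
      have h1 := hc _ ha
      have h2 : z * a * z⁻¹ = a := by
        have h3 : z * (z * a * z⁻¹) = z * a := by rw [h1]; group
        exact mul_left_cancel h3
      rwa [h2] at ha
  have hzc : ∀ n : ℤ, ∀ a ∈ A, Commute (z ^ n) a := fun n a ha => Commute.zpow_left (hc a ha) n
  have h1 := hA.2.2 (zpowers z ⊔ A) (sup_le (by simpa using hz) hA.1) (by
    intro x hx y hy
    obtain ⟨_, ⟨m, rfl⟩, a, ha, rfl⟩ := (mem_sup_of_le_normalizer hle).mp hx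
    obtain ⟨_, ⟨n, rfl⟩, b, hb, rfl⟩ := (mem_sup_of_le_normalizer hle).mp hy
    have e1 : Commute a b := hA.2.1 a ha b hb
    exact (((Commute.refl z).zpow_zpow m n).mul_right (hzc m b hb)).mul_left
      (((hzc n a ha).symm).mul_right e1))
  have h2 : A = zpowers z ⊔ A := eq_of_le_of_card_ge le_sup_right h1
  rw [h2]
  exact le_sup_left (a := zpowers z) (mem_zpowers z)

/-- **Thompson's replacement theorem**. -/
theorem IsMaxAbelianIn.exists_replacement {p : ℕ} [Fact p.Prime] {G : Type*} [Group G] [Finite G]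
    {P A V : Subgroup G} (hP : IsPGroup p P) (hA : IsMaxAbelianIn P A) (hVP : V ≤ P)
    (hV : ∀ x ∈ V, ∀ y ∈ V, x * y = y * x) (hAV : A ≤ normalizer (V : Set G))
    (hn : ¬ V ≤ normalizer (A : Set G)) :
    ∃ B, IsMaxAbelianIn P B ∧ B ≤ normalizer (A : Set G) ∧ A ⊓ V < B ⊓ V := by
  have hconjV : ∀ a ∈ A, ∀ x ∈ V, a * x * a⁻¹ ∈ V := fun a ha x hx =>
    ((mem_normalizer_iff.mp (hAV ha)) x).mp hx
  set N : Subgroup G := normalizer (A : Set G) ⊓ V with hNdef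
  have hAN : A ≤ normalizer (N : Set G) := by
    have hA' : A ≤ normalizer (A : Set G) := le_normalizer
    intro a ha
    have key : ∀ b ∈ A, ∀ x ∈ N, b * x * b⁻¹ ∈ N := fun b hb x hx =>
      mem_inf.mpr ⟨mul_mem (mul_mem (hA' hb) (mem_inf.mp hx).1) (inv_mem (hA' hb)),
        hconjV b hb x (mem_inf.mp hx).2⟩
    rw [mem_normalizer_iff]
    refine fun x => ⟨key a ha x, fun hx => ?_⟩
    have := key a⁻¹ (inv_mem ha) _ hx
    have e : a⁻¹ * (a * x * a⁻¹) * a⁻¹⁻¹ = x := by group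
    rwa [e] at this
  have hDV : ∀ d ∈ A ⊔ N, d ∈ V → d ∈ N := by
    intro d hd hdV
    obtain ⟨b, hb, n, hnN, rfl⟩ := (mem_sup_of_le_normalizer hAN).mp hd
    have hbV : b ∈ V := by
      have := mul_mem hdV (inv_mem hnN.2)
      rwa [mul_inv_cancel_right] at this
    exact mul_mem ⟨le_normalizer hb, hbV⟩ hnN
  -- Here $N=N_V(A)$ and $AN<AV$. Normalizers grow in the $p$-group $AV$, and $v$ is the $V$-part of
  -- an element normalizing $AN$ but outside it.
  obtain ⟨v, hvV, hvN, hv⟩ : ∃ v ∈ V, v ∉ N ∧ ∀ a ∈ A, v * a * v⁻¹ * a⁻¹ ∈ N := by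
    have hlt : A ⊔ N < A ⊔ V := by
      refine lt_of_le_of_ne (sup_le_sup_left inf_le_right _) fun he => hn ?_
      intro x hx
      have hx' : x ∈ A ⊔ N := by
        rw [he]; exact (le_sup_right : V ≤ A ⊔ V) hx
      exact (hDV x hx' hx).1
    obtain ⟨y, hy, hyD, hyn⟩ := (hP.to_le (sup_le hA.1 hVP)).exists_mem_normalizer hlt
    obtain ⟨a, ha, v, hv, rfl⟩ := (mem_sup_of_le_normalizer hAV).mp hy
    have haD : a ∈ A ⊔ N := SetLike.le_def.mp (le_sup_left : A ≤ A ⊔ N) ha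
    have hvn : v ∈ normalizer ((A ⊔ N : Subgroup G) : Set G) := by
      have := mul_mem (inv_mem (show a ∈ normalizer ((A ⊔ N : Subgroup G) : Set G) from le_normalizer haD)) hyn
      rwa [inv_mul_cancel_left] at this
    refine ⟨v, hv, fun hvN => hyD (mul_mem haD ((le_sup_right : N ≤ A ⊔ N) hvN)), fun b hb => ?_⟩
    have hbD : b ∈ A ⊔ N := (le_sup_left : A ≤ A ⊔ N) hb
    refine hDV _ (mul_mem ((mem_normalizer_iff.mp hvn b).mp hbD) (inv_mem hbD)) ?_
    have := mul_mem hv (hconjV b hb _ (inv_mem hv))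
    simpa [mul_assoc] using this
  -- With $M=[v,A]$ and $C=C_A(M)$, the replacement for $A$ is $MC$.
  let M : Subgroup G := closure {g | ∃ a ∈ A, g = v * a * v⁻¹ * a⁻¹}
  have hMN : M ≤ N := (closure_le _).mpr (by rintro _ ⟨a, ha, rfl⟩; exact hv a ha)
  have hMgen : ∀ a ∈ A, v * a * v⁻¹ * a⁻¹ ∈ M := fun a ha => subset_closure ⟨a, ha, rfl⟩
  let C : Subgroup G := A ⊓ centralizer (M : Set G)
  have hCM : ∀ c ∈ C, ∀ m ∈ M, m * c = c * m := fun c hc m hm => mem_centralizer_iff.mp hc.2 m hm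
  have hMCn : M ≤ normalizer (C : Set G) := by
    intro m hm
    rw [mem_normalizer_iff]
    have key : ∀ m ∈ M, ∀ c ∈ C, m * c * m⁻¹ = c := fun m hm c hc => by
      rw [hCM c hc m hm, mul_inv_cancel_right]
    refine fun c => ⟨fun hc => by rwa [key m hm c hc], fun hc => ?_⟩
    have := key m⁻¹ (inv_mem hm) _ hc
    have e : m⁻¹ * (m * c * m⁻¹) * m⁻¹⁻¹ = c := by group
    rw [e] at this
    rwa [this]
  let B : Subgroup G := M ⊔ C
  have hBc : ∀ x ∈ B, ∀ y ∈ B, x * y = y * x := by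
    intro x hx y hy
    obtain ⟨m, hm, a, ha, rfl⟩ := (mem_sup_of_le_normalizer hMCn).mp hx
    obtain ⟨n, hn, b, hb, rfl⟩ := (mem_sup_of_le_normalizer hMCn).mp hy
    have e1 : Commute a b := hA.2.1 a ha.1 b hb.1
    have e2 : Commute m n := hV m (hMN hm).2 n (hMN hn).2
    have e3 : Commute m b := hCM b hb m hm
    have e4 : Commute a n := (hCM a ha n hn).symm
    exact (e2.mul_right e3).mul_left (e4.mul_right e1)
  have hBP : B ≤ P := sup_le ((hMN.trans inf_le_right).trans hVP) (inf_le_left.trans hA.1)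
  -- This makes $a\mapsto[v,a]$ induce an injection from $A/C$ into $B/C$, giving $|A|\le|B|$. For
  -- $s={}^bv$ and $t={}^av$ the hypothesis puts $st^{-1}$ in $A$, so each $w\in A$ commutes with
  -- it. Since $V$ is abelian this says $[s,w]=[t,w]$, that is, $a$ and $b$ conjugate every
  -- generator $[v,w]$ of $M$ alike.
  have hker : ∀ a ∈ A, ∀ b ∈ A,
      (v * b * v⁻¹ * b⁻¹)⁻¹ * (v * a * v⁻¹ * a⁻¹) ∈ C → a⁻¹ * b ∈ C := by
    intro a ha b hb hc
    refine mem_inf.mpr ⟨mul_mem (inv_mem ha) hb, ?_⟩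
    have hle : M ≤ centralizer {a⁻¹ * b} := by
      refine (closure_le _).mpr ?_
      rintro _ ⟨w, hw, rfl⟩
      have hpV := hconjV b hb v hvV
      have hqV := hconjV a ha v hvV
      have hp'V := hconjV w hw _ hpV
      have hq'V := hconjV w hw _ hqV
      have e0 : (v * b * v⁻¹ * b⁻¹)⁻¹ * (v * a * v⁻¹ * a⁻¹)
          = (b * v * b⁻¹) * (a * v * a⁻¹)⁻¹ := by group
      rw [e0] at hc
      have hwc := hA.2.1 w hw _ hc.1
      set s := b * v * b⁻¹ with hs
      set t := a * v * a⁻¹ with ht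
      have e1 : (w * s * w⁻¹) * (w * t * w⁻¹)⁻¹ = s * t⁻¹ := by
        calc (w * s * w⁻¹) * (w * t * w⁻¹)⁻¹ = w * (s * t⁻¹) * w⁻¹ := by group
          _ = s * t⁻¹ := by rw [hwc, mul_inv_cancel_right]
      have e2 : s * (w * s * w⁻¹)⁻¹ = t * (w * t * w⁻¹)⁻¹ := by
        have c1 : Commute (w * s * w⁻¹) s := hV _ hp'V _ hpV
        have c2 : Commute (w * t * w⁻¹) t := hV _ hq'V _ hqV
        have c3 : Commute (w * s * w⁻¹) t := hV _ hp'V _ hqV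
        have c4 : Commute s t := hV _ hpV _ hqV
        have h1 : w * s * w⁻¹ = s * t⁻¹ * (w * t * w⁻¹) := by rw [← e1]; group
        have h2 : s * t⁻¹ = t⁻¹ * s := (c4.inv_right).eq
        have h3 : t * (w * s * w⁻¹) = s * (w * t * w⁻¹) := by
          rw [h1, h2]; group
        have h4 : Commute (w * t * w⁻¹) s := hV _ hq'V _ hpV
        have c2' : t * (w * t * w⁻¹)⁻¹ = (w * t * w⁻¹)⁻¹ * t := c2.symm.inv_right.eq
        have h4' : (w * t * w⁻¹)⁻¹ * s = s * (w * t * w⁻¹)⁻¹ := h4.inv_left.eq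
        rw [mul_inv_eq_iff_eq_mul, c2', mul_assoc, h3, ← mul_assoc, h4', inv_mul_cancel_right]
      have hbw : b⁻¹ * w * b = w := by
        rw [mul_assoc, hA.2.1 w hw b hb, inv_mul_cancel_left]
      have haw : a⁻¹ * w * a = w := by
        rw [mul_assoc, hA.2.1 w hw a ha, inv_mul_cancel_left]
      have e3 : ∀ x : G, x⁻¹ * w * x = w → (x * v * x⁻¹) * (w * (x * v * x⁻¹) * w⁻¹)⁻¹
          = x * (v * w * v⁻¹ * w⁻¹) * x⁻¹ := by
        intro x hx
        calc (x * v * x⁻¹) * (w * (x * v * x⁻¹) * w⁻¹)⁻¹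
            = x * v * (x⁻¹ * w * x) * v⁻¹ * (x⁻¹ * w * x)⁻¹ * x⁻¹ := by group
          _ = _ := by rw [hx]; group
      rw [hs, ht, e3 b hbw, e3 a haw] at e2
      refine mem_centralizer_iff.mpr ?_
      rintro _ rfl
      calc a⁻¹ * b * (v * w * v⁻¹ * w⁻¹)
          = a⁻¹ * (b * (v * w * v⁻¹ * w⁻¹) * b⁻¹) * b := by group
        _ = v * w * v⁻¹ * w⁻¹ * (a⁻¹ * b) := by rw [e2]; group
    refine mem_centralizer_iff.mpr ?_
    intro m hm
    exact (mem_centralizer_iff.mp (hle hm) _ rfl).symm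
  have hCB : C ≤ B := le_sup_right
  have hrel : C.relIndex A ≤ C.relIndex B := by
    let f : A ⧸ C.subgroupOf A → B ⧸ C.subgroupOf B := fun x =>
      QuotientGroup.mk ⟨v * (x.out : A) * v⁻¹ * (x.out : A)⁻¹,
        (le_sup_left : M ≤ B) (hMgen _ x.out.2)⟩
    refine Nat.card_le_card_of_injective f fun x y hxy => ?_
    have h1 := QuotientGroup.eq.mp hxy
    have h2 := hker _ y.out.2 _ x.out.2 h1
    rw [← x.out_eq', ← y.out_eq', eq_comm]
    exact QuotientGroup.eq.mpr h2
  have hcard : Nat.card A ≤ Nat.card B := by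
    have h1 := relIndex_mul_relIndex ⊥ C A bot_le inf_le_left
    have h2 := relIndex_mul_relIndex ⊥ C B bot_le hCB
    simp only [relIndex_bot_left] at h1 h2
    rw [← h1, ← h2]
    exact Nat.mul_le_mul_left _ hrel
  refine ⟨B, hA.eq_card hBP hBc hcard,
    sup_le (hMN.trans inf_le_left) (inf_le_left.trans le_normalizer), ?_⟩
  have hle : A ⊓ V ≤ B ⊓ V := by
    rintro x ⟨hxA, hxV⟩
    refine ⟨hCB ⟨hxA, mem_centralizer_iff.mpr fun m hm => hV m (hMN hm).2 x hxV⟩, hxV⟩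
  -- Equality would put $[v,A]\le B\cap V$ inside $A$, so $v$ would normalize $A$, against $v\notin
  -- N$.
  refine lt_of_le_of_ne hle fun he => hvN ⟨?_, hvV⟩
  have hMA : ∀ a ∈ A, v * a * v⁻¹ ∈ A := by
    intro a ha
    have h1 : v * a * v⁻¹ * a⁻¹ ∈ A ⊓ V := by
      rw [he]
      exact ⟨(le_sup_left : M ≤ B) (hMgen a ha), (hMN (hMgen a ha)).2⟩
    have := mul_mem h1.1 ha
    rwa [inv_mul_cancel_right] at this
  exact mem_normalizer_of_conj_mem hMA

/-! ### Quadratic elements acting on elementary abelian normal subgroups. -/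

section

/-- Conjugation on an abelian normal subgroup, as a ring-valued homomorphism. -/
def conjEnd {G : Type*} [Group G] (V : Subgroup G) [V.Normal] [IsMulCommutative V] :
    G →* AddMonoid.End (Additive V) where
  toFun g := (MulAut.conjNormal g : V ≃* V).toMonoidHom.toAdditive
  map_one' := by rw [map_one]; rfl
  map_mul' g h := by rw [map_mul]; rfl

theorem conjEnd_eq_iff {G : Type*} [Group G] {V : Subgroup G} [V.Normal] [IsMulCommutative V]
    {g h : G} : conjEnd V g = conjEnd V h ↔ ∀ v ∈ V, g * v * g⁻¹ = h * v * h⁻¹ := by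
  constructor
  · intro e v hv
    exact congrArg (fun f : AddMonoid.End (Additive V) =>
      ((f (Additive.ofMul ⟨v, hv⟩)).toMul : G)) e
  · intro e
    refine AddMonoidHom.ext fun v => Additive.toMul.injective (Subtype.ext ?_)
    exact e _ v.toMul.2

theorem mem_centralizer_iff_conj {G : Type*} [Group G] {V : Subgroup G} {g : G} :
    g ∈ centralizer (V : Set G) ↔ ∀ v ∈ V, g * v * g⁻¹ = v := by
  rw [mem_centralizer_iff]
  refine forall₂_congr fun v _ => ?_
  rw [mul_inv_eq_iff_eq_mul, eq_comm]

theorem conjEnd_eq_one_iff {G : Type*} [Group G] {V : Subgroup G} [V.Normal] [IsMulCommutative V]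
    {g : G} : conjEnd V g = 1 ↔ g ∈ centralizer (V : Set G) := by
  rw [← map_one (conjEnd V), conjEnd_eq_iff, mem_centralizer_iff_conj]
  simp

/-- Conjugation represents $G$ on $V$ by endomorphisms in characteristic $p$. The image of $K$ is a
commuting set of exponent prime to $p$, and the condition on $a$ is $[V,a,a]=1$, so
`commute_of_quadratic` applies to $n=\psi(a)-1$. -/
theorem commutator_mem_centralizer_of_quadratic {p : ℕ} [Fact p.Prime] (hp2 : p ≠ 2)
    {G : Type*} [Group G] {V K : Subgroup G} [V.Normal] [K.Normal] (hV1 : V ≠ ⊥)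
    (hV : ∀ x ∈ V, ∀ y ∈ V, x * y = y * x) (hVp : ∀ x ∈ V, x ^ p = 1) {N : ℕ} (hN : N.Coprime p)
    (hKN : ∀ k ∈ K, k ^ N ∈ centralizer (V : Set G))
    (hK : ∀ k ∈ K, ∀ l ∈ K, ⁅k, l⁆ ∈ centralizer (V : Set G)) {a : G}
    (ha : ∀ v ∈ V, a * (a * v * a⁻¹ * v⁻¹) = (a * v * a⁻¹ * v⁻¹) * a) :
    ∀ k ∈ K, ⁅a, k⁆ ∈ centralizer (V : Set G) := by
  have : IsMulCommutative V := ⟨⟨fun x y => Subtype.ext (hV _ x.2 _ y.2)⟩⟩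
  have : Nontrivial V := (nontrivial_iff_ne_bot V).mpr hV1
  let E := AddMonoid.End (Additive V)
  obtain ⟨x, hx, hx1⟩ := (bot_or_exists_ne_one V).resolve_left hV1
  have hpE : (p : E) = 0 := by
    refine AddMonoidHom.ext fun v => ?_
    refine (AddMonoid.End.natCast_apply p v).trans ?_
    exact Additive.toMul.injective (Subtype.ext (hVp _ v.toMul.2))
  have hnt : Nontrivial E := by
    refine ⟨⟨1, 0, fun h => hx1 ?_⟩⟩
    have := DFunLike.congr_fun h (Additive.ofMul (⟨x, hx⟩ : V))
    exact congrArg (fun t : Additive V => (t.toMul : G)) this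
  have hchar : CharP E p := (CharP.charP_iff_prime_eq_zero Fact.out).mpr hpE
  let ψ : G →* E := conjEnd V
  let n : E := ψ a - 1
  have e1 : 1 + n = ψ a := by simp [n]
  have hnn : n * n = 0 := by
    refine AddMonoidHom.ext fun v => ?_
    have h1 : ψ a (ψ a v - v) = ψ a v - v := by
      refine Additive.toMul.injective (Subtype.ext ?_)
      change a * ((a * (v.toMul : G) * a⁻¹) / v.toMul : G) * a⁻¹ = (a * (v.toMul : G) * a⁻¹) / v.toMul
      rw [div_eq_mul_inv, ha _ v.toMul.2, mul_inv_cancel_right]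
    change ψ a (ψ a v - v) - (ψ a v - v) = 0
    rw [h1, sub_self]
  have e2 : 1 - n = ψ a⁻¹ := by
    have h1 : ψ a * (1 - n) = 1 := by
      rw [← e1, mul_sub, mul_one, add_mul, one_mul, hnn, add_zero, add_sub_cancel_right]
    have h2 : ψ a⁻¹ * ψ a = 1 := by rw [← map_mul, inv_mul_cancel, map_one]
    calc 1 - n = ψ a⁻¹ * ψ a * (1 - n) := by rw [h2, one_mul]
      _ = ψ a⁻¹ := by rw [mul_assoc, h1, mul_one]
  have hmain := commute_of_quadratic p hp2 (ψ '' (K : Set G)) (by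
      rintro _ ⟨k, hk, rfl⟩ _ ⟨l, hl, rfl⟩
      have h1 : ψ ⁅k, l⁆ = 1 := conjEnd_eq_one_iff.mpr (hK k hk l hl)
      rw [← map_mul, ← map_mul]
      calc ψ (k * l) = ψ (⁅k, l⁆ * (l * k)) := by
            congr 1; rw [commutatorElement_def]; group
        _ = ψ (l * k) := by rw [map_mul, h1, one_mul]) N hN (by
      rintro _ ⟨k, hk, rfl⟩
      rw [← map_pow]
      exact conjEnd_eq_one_iff.mpr (hKN k hk)) n hnn (by
      rintro _ ⟨k, hk, rfl⟩
      rw [e1, e2, ← map_mul, ← map_mul]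
      exact ⟨_, Normal.conj_mem ‹_› k hk a, rfl⟩) (by
      rintro _ ⟨k, hk, rfl⟩
      rw [e1, e2, ← map_mul, ← map_mul]
      exact ⟨_, by simpa using Normal.conj_mem ‹K.Normal› k hk a⁻¹, rfl⟩)
  intro k hk
  have h1 := hmain _ ⟨k, hk, rfl⟩
  have h2 : ψ (a * k) = ψ (k * a) := by
    rw [map_mul, map_mul, ← e1, add_mul, mul_add, h1, one_mul, mul_one]
  rw [← conjEnd_eq_one_iff]
  have h3 : ⁅a, k⁆ = (a * k) * (k * a)⁻¹ := by rw [commutatorElement_def]; group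
  change ψ _ = 1
  rw [h3, map_mul, h2, ← map_mul, mul_inv_cancel, map_one]

/-! ### The final configuration in Thompson's normal $p$-complement theorem. -/

section core

variable {p : ℕ} [Fact p.Prime] {G : Type*} [Group G] [Finite G] {P : Sylow p G}
  {U K : Subgroup G}

/-- `K / D` is abelian when no proper `P`-invariant subgroup lies between `D` and `K`. -/
theorem commutator_mem_of_minimal {D : Subgroup G} [D.Normal] [K.Normal] (hDK : D < K)
    (hcop : (D.relIndex K).Coprime p)
    (hL : ∀ L : Subgroup G, D ≤ L → L ≤ K → (P : Subgroup G) ≤ normalizer (L : Set G) →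
      L = K ∨ L = D) {x y : G} (hx : x ∈ K) (hy : y ∈ K) : ⁅x, y⁆ ∈ D := by
  let π := QuotientGroup.mk' D
  have hπ : Function.Surjective π := QuotientGroup.mk'_surjective D
  have hker : π.ker = D := QuotientGroup.ker_mk' D
  let B : Subgroup (G ⧸ D) := K.map π
  have hBn : B.Normal := Normal.map ‹K.Normal› π hπ
  have hBK : B.comap π = K := by
    rw [comap_map_eq, hker, sup_eq_left.mpr hDK.le]
  have hcard : Nat.card B = D.relIndex K := by
    rw [← relIndex_ker, hker]
  have hsub : ∀ X : Subgroup (G ⧸ D), X ≤ B → (∀ g ∈ P, ∀ x ∈ X, π g * x * (π g)⁻¹ ∈ X) →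
      X = B ∨ X = ⊥ := by
    intro X hX hXP
    have h1 : D ≤ X.comap π := by
      intro d hd
      have : π d = 1 := by rwa [← MonoidHom.mem_ker, hker]
      rw [mem_comap, this]
      exact one_mem X
    have h2 := hL (X.comap π) h1 (by rw [← hBK]; exact comap_mono hX) (by
      intro g hg
      refine mem_normalizer_of_conj_mem fun x hx => ?_
      rw [mem_comap, map_mul, map_mul, map_inv]
      exact hXP g hg _ hx)
    refine h2.imp (fun h => ?_) fun h => ?_
    · rw [← map_comap_eq_self_of_surjective hπ X, h]
    · rw [← map_comap_eq_self_of_surjective hπ X, h, Subgroup.map_eq_bot_iff, hker]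
  have hB1 : B ≠ ⊥ := by
    intro h
    rw [Subgroup.map_eq_bot_iff, hker] at h
    exact hDK.not_ge h
  have hq : Nat.card B ≠ 1 := fun h => hB1 (card_eq_one.mp h)
  obtain ⟨q, hqp, hqd⟩ := Nat.exists_prime_and_dvd hq
  have : Fact q.Prime := ⟨hqp⟩
  let act : (P : Subgroup G) →* MulAut B :=
    ((MulAut.conjNormal : (G ⧸ D) →* MulAut B).comp π).comp (P : Subgroup G).subtype
  let _ : MulAction (P : Subgroup G) (Sylow q B) := MulAction.compHom _ act
  -- The number of Sylow $q$-subgroups of $B=K/D$ divides a $p'$-number, so $P$ fixes one. By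
  -- minimality it is all of $B$. Then $B$ is a $q$-group, and its derived subgroup is proper and
  -- $P$-invariant, hence trivial.
  obtain ⟨S, hS⟩ := P.2.nonempty_fixed_point_of_prime_not_dvd_card (Sylow q B) (by
    intro hd
    have h1 : p ∣ Nat.card B := by
      refine hd.trans ?_
      obtain ⟨S⟩ := (inferInstance : Nonempty (Sylow q B))
      exact S.card_dvd_index.trans (index_dvd_card _)
    rw [hcard] at h1
    exact (Fact.out : p.Prime).one_lt.ne' (Nat.Coprime.eq_one_of_dvd hcop.symm h1))
  have hSB : (S : Subgroup B).map B.subtype = B := by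
    refine (hsub _ (map_subtype_le _) ?_).resolve_right fun h => ?_
    · rintro g hg _ ⟨s, hs, rfl⟩
      have h1 : act ⟨g, hg⟩ • S = S := hS ⟨g, hg⟩
      refine ⟨act ⟨g, hg⟩ s, ?_, rfl⟩
      have h2 : act ⟨g, hg⟩ • s ∈ act ⟨g, hg⟩ • (S : Subgroup B) :=
        smul_mem_pointwise_smul _ _ _ hs
      have h3 : act ⟨g, hg⟩ • (S : Subgroup B) = S := by
        rw [← Sylow.pointwise_smul_def, h1]
      rw [h3] at h2
      exact h2
    · exact S.ne_bot_of_dvd_card hqd ((map_eq_bot_iff_of_injective _ B.subtype_injective).mp h)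
  have hBq : IsPGroup q B := by
    rw [← hSB]
    exact S.2.map _
  have hcomm : ⁅B, B⁆ = ⊥ := by
    refine (hsub ⁅B, B⁆ (commutator_le_left B B) ?_).resolve_left fun h =>
      hB1 (eq_bot_of_le_commutator hBq le_rfl h.ge)
    intro g _ x hx
    exact (inferInstance : (⁅B, B⁆).Normal).conj_mem x hx _
  have h1 : ⁅π x, π y⁆ ∈ ⁅B, B⁆ := commutator_mem_commutator ⟨x, hx, rfl⟩ ⟨y, hy, rfl⟩
  rw [hcomm, mem_bot, ← map_commutatorElement, ← MonoidHom.mem_ker, hker] at h1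
  exact h1

end core

end

section

/-- An element of $P\cap K$ has an image in $G/U$ whose order is both a power of $p$ and prime to
$p$. -/
theorem IsPGroup.inf_le_of_coprime {p : ℕ} {G : Type*} [Group G] {P U K : Subgroup G} [U.Normal]
    (hP : IsPGroup p P) (hcop : (U.relIndex K).Coprime p) : P ⊓ K ≤ U := by
  rintro x ⟨hxP, hxK⟩
  have h1 : (QuotientGroup.mk x : G ⧸ U) ^ U.relIndex K = 1 := by
    rw [← QuotientGroup.mk_pow, QuotientGroup.eq_one_iff]
    exact pow_relIndex_mem U hxK
  obtain ⟨k, hk⟩ := hP ⟨x, hxP⟩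
  have h2 : x ^ p ^ k = 1 := congrArg Subtype.val hk
  have h3 : (QuotientGroup.mk x : G ⧸ U) ^ p ^ k = 1 := by
    rw [← QuotientGroup.mk_pow, h2, QuotientGroup.mk_one]
  rw [← QuotientGroup.eq_one_iff]
  exact eq_one_of_coprime_of_pow_eq_one
    (hcop.coprime_dvd_left (orderOf_dvd_of_pow_eq_one h1)) h3

section core

variable {p : ℕ} [Fact p.Prime] {G : Type*} [Group G] [Finite G] {P : Sylow p G}
  {U K D : Subgroup G}

/-- If `[X, K] ≤ D` for a `P`-invariant subgroup `X` of `P` containing `U = O_p(G)`, and every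
proper `P`-invariant subgroup between `U` and `K` lies in `D`, then `X = U`. -/
theorem le_of_commutator_le [U.Normal] [K.Normal] [D.Normal]
    (hUmax : ∀ X : Subgroup G, X.Normal → IsPGroup p X → X ≤ U) (hUK : U ≤ K)
    (hcop : (U.relIndex K).Coprime p) (hKP : K ⊔ P = ⊤) (hDK : D < K)
    (hL : ∀ L : Subgroup G, U ≤ L → L ≤ K → (P : Subgroup G) ≤ normalizer (L : Set G) →
      L = K ∨ L ≤ D) {X : Subgroup G} (hXP : X ≤ P) (hUX : U ≤ X)
    (hPX : (P : Subgroup G) ≤ normalizer (X : Set G)) (hX : ∀ x ∈ X, ∀ k ∈ K, ⁅x, k⁆ ∈ D) :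
    X ≤ U := by
  have hXD : X ≤ normalizer (D : Set G) := le_normalizer_of_normal
  have hXN : X ≤ X ⊔ D := le_sup_left
  have hDN : D ≤ X ⊔ D := le_sup_right
  have hN : (X ⊔ D).Normal := by
    rw [← normalizer_eq_top_iff, eq_top_iff, ← hKP]
    refine sup_le ?_ ?_
    · intro k hk
      refine mem_normalizer_of_conj_mem fun n hn => ?_
      obtain ⟨x, hx, d, hd, rfl⟩ := (mem_sup_of_le_normalizer hXD).mp hn
      have e : k * (x * d) * k⁻¹ = x * (⁅x⁻¹, k⁆ * (k * d * k⁻¹)) := by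
        rw [commutatorElement_def]; group
      rw [e]
      exact mul_mem (hXN hx) (mul_mem (hDN (hX _ (inv_mem hx) k hk))
        (hDN (Normal.conj_mem ‹_› d hd k)))
    · intro g hg
      refine mem_normalizer_of_conj_mem fun n hn => ?_
      obtain ⟨x, hx, d, hd, rfl⟩ := (mem_sup_of_le_normalizer hXD).mp hn
      have e : g * (x * d) * g⁻¹ = (g * x * g⁻¹) * (g * d * g⁻¹) := by group
      rw [e]
      exact mul_mem (hXN ((mem_normalizer_iff.mp (hPX hg) x).mp hx))
        (hDN (Normal.conj_mem ‹_› d hd g))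
  -- The subgroup $X$ is Sylow in the normal subgroup $XD$, because $P\cap D\le P\cap K\le U\le X$.
  -- The Frattini argument then yields $G=N(X)D$.
  obtain ⟨Q, hQ⟩ := P.exists_eq_subgroupOf (X ⊔ D)
  have hPK : (P : Subgroup G) ⊓ K ≤ U := P.2.inf_le_of_coprime hcop
  have hmap : (Q : Subgroup _).map (X ⊔ D).subtype = X := by
    rw [hQ, subgroupOf_map_subtype]
    apply le_antisymm
    · rintro y ⟨hyP, hyN⟩
      obtain ⟨x, hx, d, hd, rfl⟩ := (mem_sup_of_le_normalizer hXD).mp hyN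
      have hdP : d ∈ (P : Subgroup G) := by
        have := mul_mem (inv_mem (hXP hx)) hyP
        rwa [inv_mul_cancel_left] at this
      exact mul_mem hx (hUX (hPK ⟨hdP, hDK.le hd⟩))
    · exact le_inf hXP hXN
  have hfr : normalizer (X : Set G) ⊔ (X ⊔ D) = ⊤ := by
    have := Q.normalizer_sup_eq_top
    rwa [hmap] at this
  have hfr' : normalizer (X : Set G) ⊔ D = ⊤ := by
    rw [← hfr, ← sup_assoc, sup_eq_left.mpr (le_normalizer : X ≤ normalizer (X : Set G))]
  -- If $N_K(X)\le D$, then $G=N(X)D$ would force $K\le D$. Minimality leaves only $N_K(X)=K$, so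
  -- $X$ is normal in $KP=G$.
  have hNX : normalizer (X : Set G) ⊓ K = K := by
    refine (hL _ ?_ inf_le_right ?_).resolve_right fun hle => hDK.not_ge ?_
    · exact le_inf ((hUX.trans hXP).trans hPX) hUK
    · intro g hg
      refine mem_normalizer_of_conj_mem fun n hn => ?_
      exact mem_inf.mpr ⟨mul_mem (mul_mem (hPX hg) hn.1) (inv_mem (hPX hg)), Normal.conj_mem ‹_› n hn.2 g⟩
    · intro k hk
      have hk' : k ∈ normalizer (X : Set G) ⊔ D := by rw [hfr']; exact mem_top k
      obtain ⟨n, hn, d, hd, rfl⟩ :=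
        (mem_sup_of_le_normalizer (A := normalizer (X : Set G)) (N := D)
          le_normalizer_of_normal).mp hk'
      have hnK : n ∈ K := by
        have := mul_mem hk (inv_mem (hDK.le hd))
        rwa [mul_inv_cancel_right] at this
      exact mul_mem (hle ⟨hn, hnK⟩) hd
  refine hUmax X ?_ (P.2.to_le hXP)
  rw [← normalizer_eq_top_iff, eq_top_iff, ← hKP]
  exact sup_le (inf_eq_right.mp hNX) hPX

theorem normalizer_le_normalizer_of_map {G : Type*} [Group G] {A B : Subgroup G}
    (h : ∀ g ∈ normalizer (A : Set G), ∀ x ∈ B, g * x * g⁻¹ ∈ B) :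
    normalizer (A : Set G) ≤ normalizer (B : Set G) := by
  intro g hg
  rw [mem_normalizer_iff]
  refine fun x => ⟨h g hg x, fun hx => ?_⟩
  have := h g⁻¹ (inv_mem hg) _ hx
  have e : g⁻¹ * (g * x * g⁻¹) * g⁻¹⁻¹ = x := by group
  rwa [e] at this

theorem map_conj_eq_of_mem_normalizer {G : Type*} [Group G] {A : Subgroup G} {g : G}
    (hg : g ∈ normalizer (A : Set G)) : A.map (MulAut.conj g).toMonoidHom = A := by
  exact mem_normalizer_iff_map_conj_eq.mp hg

theorem normalizer_le_normalizer_thompsonSubgroup {G : Type*} [Group G] (P : Subgroup G) :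
    normalizer (P : Set G) ≤ normalizer (thompsonSubgroup P : Set G) :=
  normalizer_le_normalizer_of_map fun g hg x hx => by
    have := map_thompsonSubgroup (MulAut.conj g).toMonoidHom (MulAut.conj g).injective P
    rw [map_conj_eq_of_mem_normalizer hg] at this
    rw [← this]
    exact ⟨x, hx, rfl⟩

theorem normalizer_le_normalizer_omegaCenter {p : ℕ} {G : Type*} [Group G] (P : Subgroup G) :
    normalizer (P : Set G) ≤ normalizer (omegaCenter p P : Set G) :=
  normalizer_le_normalizer_of_map fun g hg x hx => by
    have := map_omegaCenter p (MulAut.conj g).toMonoidHom (MulAut.conj g).injective P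
    rw [map_conj_eq_of_mem_normalizer hg] at this
    rw [← this]
    exact ⟨x, hx, rfl⟩

theorem omegaCenter_normal {p : ℕ} {G : Type*} [Group G] {U : Subgroup G} [U.Normal] : (omegaCenter p U).Normal := by
  rw [← normalizer_eq_top_iff, eq_top_iff]
  refine le_trans ?_ (normalizer_le_normalizer_omegaCenter U)
  rw [normalizer_eq_top_iff.mpr ‹_›]

theorem thompsonSubgroup_normal {G : Type*} [Group G] {U : Subgroup G} [U.Normal] : (thompsonSubgroup U).Normal := by
  rw [← normalizer_eq_top_iff, eq_top_iff]
  refine le_trans ?_ (normalizer_le_normalizer_thompsonSubgroup U)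
  rw [normalizer_eq_top_iff.mpr ‹_›]

/-- The final configuration in Thompson's normal `p`-complement theorem does not occur. -/
theorem not_minimal_configuration (hp2 : p ≠ 2) [U.Normal] [K.Normal] (hUp : IsPGroup p U)
    (hU1 : U ≠ ⊥)
    (hUmax : ∀ X : Subgroup G, X.Normal → IsPGroup p X → X ≤ U) (hUK : U ≤ K)
    (hcop : (U.relIndex K).Coprime p) (hKP : K ⊔ P = ⊤)
    (hK : ¬ K ≤ U ⊔ centralizer (U : Set G))
    (hL : ∀ L : Subgroup G, U ≤ L → L ≤ K → (P : Subgroup G) ≤ normalizer (L : Set G) →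
      L = K ∨ L ≤ U ⊔ centralizer (U : Set G))
    (hJ : ¬ (thompsonSubgroup (P : Subgroup G)).Normal)
    (hZ : ¬ (omegaCenter p (P : Subgroup G)).Normal) : False := by
  have hCn : (centralizer (U : Set G)).Normal := inferInstance
  let D := (U ⊔ centralizer (U : Set G)) ⊓ K
  have hDn : D.Normal := inferInstance
  have hDK : D < K := lt_of_le_of_ne inf_le_right fun h => hK (inf_eq_right.mp h)
  have hUD : U ≤ D := le_inf le_sup_left hUK
  have hL' : ∀ L : Subgroup G, U ≤ L → L ≤ K → (P : Subgroup G) ≤ normalizer (L : Set G) →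
      L = K ∨ L ≤ D := fun L h1 h2 h3 => (hL L h1 h2 h3).imp_right fun h => le_inf h h2
  have claim := fun (X : Subgroup G) => le_of_commutator_le (X := X) hUmax hUK hcop hKP hDK hL'
  have hUP : U ≤ P := hUp.le_sylow_of_normal P
  have hPn : ∀ X : Subgroup G, X.Normal → (P : Subgroup G) ≤
      normalizer ((X ⊓ P : Subgroup G) : Set G) := by
    intro X hX g hg
    exact mem_normalizer_of_conj_mem fun n hn =>
      mem_inf.mpr ⟨hX.conj_mem n hn.1 g, mul_mem (mul_mem hg hn.2) (inv_mem hg)⟩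
  have hcommK : ∀ X : Subgroup G, X.Normal → ∀ x ∈ X, ∀ k ∈ K, ⁅x, k⁆ ∈ X ⊓ K := by
    intro X hX x hx k hk
    have h1 : ⁅x, k⁆ ∈ ⁅X, K⁆ := commutator_mem_commutator hx hk
    exact ⟨commutator_le_left X K h1, commutator_le_right X K h1⟩
  -- The subgroup $X=UC(U)\cap P$ satisfies $[X,K]\le UC(U)\cap K=D$, so `claim` puts it in $U$.
  have hCU : centralizer (U : Set G) ⊓ P ≤ U := by
    refine le_trans (inf_le_inf_right _ le_sup_right)
      (claim ((U ⊔ centralizer (U : Set G)) ⊓ P) inf_le_right (le_inf le_sup_left hUP)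
        (hPn _ inferInstance) fun x hx k hk => ?_)
    exact hcommK _ inferInstance x hx.1 k hk
  let V := omegaCenter p U
  have hVn : V.Normal := omegaCenter_normal
  have hVU : V ≤ U := omegaCenter_le p U
  have hVc : ∀ x ∈ V, ∀ y ∈ V, x * y = y * x := fun x hx y hy => hx.2.2 y (hVU hy)
  have hV1 : V ≠ ⊥ := omegaCenter_ne_bot hUp hU1
  have hZV : omegaCenter p (P : Subgroup G) ≤ V := by
    rintro z ⟨hzP, hzp, hzc⟩
    refine ⟨hCU ⟨mem_centralizer_iff.mpr fun u hu => (hzc u (hUP hu)).symm, hzP⟩, hzp, ?_⟩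
    exact fun u hu => hzc u (hUP hu)
  have hUCV : U ≤ centralizer (V : Set G) := by
    intro u hu
    exact mem_centralizer_iff.mpr fun v hv => hv.2.2 u hu
  have hCVn : (centralizer (V : Set G)).Normal := inferInstance
  -- Since $\Omega_1(Z(P))\le V$, a $K$ centralizing $V$ would normalize $\Omega_1(Z(P))$, as $P$
  -- does, making it normal in $KP=G$.
  have hKV : ¬ K ≤ centralizer (V : Set G) := by
    intro h
    apply hZ
    rw [← normalizer_eq_top_iff, eq_top_iff, ← hKP]
    refine sup_le (fun k hk => ?_) ?_
    · refine mem_normalizer_of_conj_mem fun z hz => ?_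
      rw [mem_centralizer_iff_conj.mp (h hk) z (hZV hz)]
      exact hz
    · exact (le_normalizer.trans (normalizer_le_normalizer_omegaCenter (P : Subgroup G)))
  have hCKV : centralizer (V : Set G) ⊓ K ≤ D := by
    refine (hL' _ (le_inf hUCV hUK) inf_le_right ?_).resolve_left fun h => hKV (inf_eq_right.mp h)
    have : (centralizer (V : Set G) ⊓ K).Normal := inferInstance
    exact le_normalizer_of_normal
  have hDV : D ≤ centralizer (V : Set G) := by
    refine inf_le_left.trans (sup_le hUCV ?_)
    exact centralizer_le hVU
  have hCPV : centralizer (V : Set G) ⊓ P ≤ U := by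
    refine claim _ inf_le_right (le_inf hUCV hUP) (hPn _ inferInstance) fun x hx k hk => ?_
    exact hCKV (hcommK _ inferInstance x hx.1 k hk)
  have hKab : ∀ x ∈ K, ∀ y ∈ K, ⁅x, y⁆ ∈ D := by
    intro x hx y hy
    refine commutator_mem_of_minimal (P := P) hDK ?_ ?_ hx hy
    · exact hcop.coprime_dvd_left (relIndex_dvd_of_le_left K hUD)
    · intro L h1 h2 h3
      exact (hL' L (hUD.trans h1) h2 h3).imp_right fun h => le_antisymm h h1
  -- Modulo $C(V)$ the group $K$ is an abelian $p'$-group, so an $a$ acting quadratically on $V$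
  -- satisfies $[a,K]\le C_K(V)\le D$. Applying `claim` to all $x\in P$ with $[x,K]\le D$ finishes.
  have hmem : ∀ a ∈ P, (∀ v ∈ V, a * (a * v * a⁻¹ * v⁻¹) = (a * v * a⁻¹ * v⁻¹) * a) → a ∈ U := by
    have hq : ∀ a : G, (∀ v ∈ V, a * (a * v * a⁻¹ * v⁻¹) = (a * v * a⁻¹ * v⁻¹) * a) →
        ∀ k ∈ K, ⁅a, k⁆ ∈ D := by
      intro a ha k hk
      refine hCKV ⟨?_, ?_⟩
      · exact commutator_mem_centralizer_of_quadratic hp2 hV1 hVc (fun x hx => hx.2.1) hcop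
          (fun k hk => hUCV (pow_relIndex_mem U hk))
          (fun k hk l hl => hDV (hKab k hk l hl)) ha k hk
      · exact commutator_le_right ⊤ K (commutator_mem_commutator (mem_top a) hk)
    let X : Subgroup G :=
      { carrier := {x | x ∈ P ∧ ∀ k ∈ K, ⁅x, k⁆ ∈ D}
        one_mem' := ⟨one_mem _, fun k _ => by simp⟩
        mul_mem' := by
          rintro x y ⟨hx, hx'⟩ ⟨hy, hy'⟩
          refine ⟨mul_mem hx hy, fun k hk => ?_⟩
          have e : ⁅x * y, k⁆ = x * ⁅y, k⁆ * x⁻¹ * ⁅x, k⁆ := by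
            simp only [commutatorElement_def]; group
          rw [e]
          exact mul_mem (hDn.conj_mem _ (hy' k hk) x) (hx' k hk)
        inv_mem' := by
          rintro x ⟨hx, hx'⟩
          refine ⟨inv_mem hx, fun k hk => ?_⟩
          have e : ⁅x⁻¹, k⁆ = x⁻¹ * ⁅x, k⁆⁻¹ * x⁻¹⁻¹ := by
            simp only [commutatorElement_def]; group
          rw [e]
          exact hDn.conj_mem _ (inv_mem (hx' k hk)) _ }
    have hXU : X ≤ U := by
      refine claim X (fun x hx => hx.1) (fun u hu => ⟨hUP hu, fun k hk => ?_⟩) ?_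
        fun x hx k hk => hx.2 k hk
      · exact hUD (commutator_le_left U K (commutator_mem_commutator hu hk))
      · intro g hg
        refine mem_normalizer_of_conj_mem fun x hx =>
          ⟨mul_mem (mul_mem hg hx.1) (inv_mem hg), fun k hk => ?_⟩
        have e : ⁅g * x * g⁻¹, k⁆ = g * ⁅x, g⁻¹ * k * g⁻¹⁻¹⁆ * g⁻¹ := by
          simp only [commutatorElement_def]; group
        rw [e]
        exact hDn.conj_mem _ (hx.2 _ (Normal.conj_mem ‹K.Normal› k hk _)) g
    exact fun a ha ha' => hXU ⟨ha, hq a ha'⟩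
  -- Otherwise $J(P)=J(U)$, which is normal in $G$.
  obtain ⟨A, hA, hAU⟩ : ∃ A, IsMaxAbelianIn (P : Subgroup G) A ∧ ¬ A ≤ U := by
    by_contra! hcon
    apply hJ
    have hJU : thompsonSubgroup (P : Subgroup G) = thompsonSubgroup U := by
      apply congrArg sSup
      ext A
      constructor
      · intro hA
        exact ⟨hcon A hA, hA.2.1, fun B hB hBc => hA.2.2 B (hB.trans hUP) hBc⟩
      · intro hA
        refine ⟨hA.1.trans hUP, hA.2.1, fun B hB hBc => ?_⟩
        obtain ⟨A', hA'⟩ := exists_isMaxAbelianIn (P : Subgroup G)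
        exact (hA'.2.2 B hB hBc).trans (hA.2.2 A' (hcon A' hA') hA'.2.1)
    rw [hJU]
    exact thompsonSubgroup_normal
  obtain ⟨A, ⟨hA, hAU⟩, hmax⟩ := Set.exists_max_image
    {A : Subgroup G | IsMaxAbelianIn (P : Subgroup G) A ∧ ¬ A ≤ U}
    (fun A => Nat.card (A ⊓ V : Subgroup G)) (Set.toFinite _) ⟨A, hA, hAU⟩
  -- A replacement $B$ meets $V$ in more than $A$ does, so $B\le U$ by the choice of $A$. Then $V$
  -- centralizes $B$, hence $V\le B\le N(A)$. Once $V$ normalizes $A$, $[A,V]\le A$ and every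
  -- element of the abelian group $A$ acts quadratically on $V$.
  have hVA : V ≤ normalizer (A : Set G) := by
    by_contra hn
    obtain ⟨B, hB, hBA, hlt⟩ := hA.exists_replacement P.2 (hVU.trans hUP) hVc
      le_normalizer_of_normal hn
    have hBU : B ≤ U := by
      by_contra hBU
      exact (hmax B ⟨hB, hBU⟩).not_gt (Set.Finite.card_lt_card (Set.toFinite _) hlt)
    refine hn (le_trans (fun v hv => ?_) hBA)
    exact hB.mem_of_commute (hUP (hVU hv)) fun b hb => hv.2.2 b (hBU hb)
  refine hAU fun a ha => hmem a (hA.1 ha) fun v hv => ?_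
  refine hA.2.1 a ha _ ?_
  have e : a * v * a⁻¹ * v⁻¹ = a * (v * a⁻¹ * v⁻¹) := by group
  rw [e]
  exact mul_mem ha ((mem_normalizer_iff.mp (hVA hv) _).mp (inv_mem ha))

end core

end

/-! ### Thompson's normal $p$-complement theorem. -/

section

/-- The two characteristic subgroups of a `p`-group controlling `p`-nilpotency. -/
def localSubgroup (p : ℕ) {G : Type*} [Group G] : Bool → Subgroup G → Subgroup G
  | true, P => thompsonSubgroup P
  | false, P => omegaCenter p P

theorem localSubgroup_le (p : ℕ) {G : Type*} [Group G] (b : Bool) (P : Subgroup G) :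
    localSubgroup p b P ≤ P := by
  cases b
  · exact omegaCenter_le p P
  · exact thompsonSubgroup_le P

theorem map_localSubgroup (p : ℕ) {G G' : Type*} [Group G] [Group G'] (b : Bool) (f : G →* G')
    (hf : Function.Injective f) (P : Subgroup G) :
    (localSubgroup p b P).map f = localSubgroup p b (P.map f) := by
  cases b
  · exact map_omegaCenter p f hf P
  · exact map_thompsonSubgroup f hf P

theorem localSubgroup_ne_bot {p : ℕ} [Fact p.Prime] {G : Type*} [Group G] [Finite G] (b : Bool)
    {P : Subgroup G} (hPp : IsPGroup p P) (hP : P ≠ ⊥) : localSubgroup p b P ≠ ⊥ := by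
  cases b
  · exact omegaCenter_ne_bot hPp hP
  · exact thompsonSubgroup_ne_bot hP

theorem normalizer_le_normalizer_localSubgroup {p : ℕ} {G : Type*} [Group G] (b : Bool)
    (P : Subgroup G) : normalizer (P : Set G) ≤ normalizer (localSubgroup p b P : Set G) := by
  cases b
  · exact normalizer_le_normalizer_omegaCenter P
  · exact normalizer_le_normalizer_thompsonSubgroup P

/-- The normalizer in $G'$ embeds in the normalizer of the image. This transports the hypothesis
both to conjugate Sylow subgroups and to proper subgroups. -/
theorem isPNilpotent_normalizer_of_map {p : ℕ} {G G' : Type*} [Group G] [Group G'] {b : Bool}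
    {f : G' →* G} (hf : Function.Injective f) {S : Subgroup G'}
    (h : IsPNilpotent p (normalizer (localSubgroup p b (S.map f) : Set G))) :
    IsPNilpotent p (normalizer (localSubgroup p b S : Set G')) := by
  have hle : normalizer (localSubgroup p b S : Set G') ≤
      (normalizer (localSubgroup p b (S.map f) : Set G)).comap f := by
    rw [← map_localSubgroup p b f hf]
    intro g hg
    rw [mem_comap, mem_normalizer_iff]
    intro y
    constructor
    · rintro ⟨x, hx, rfl⟩
      exact ⟨g * x * g⁻¹, (mem_normalizer_iff.mp hg x).mp hx, by simp⟩
    · rintro ⟨x, hx, hxy⟩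
      refine ⟨g⁻¹ * x * g, (mem_normalizer_iff''.mp hg x).mp hx, ?_⟩
      rw [map_mul, map_mul, hxy, map_inv]
      group
  refine h.of_injective ((f.subgroupComap _).comp (inclusion hle)) ?_
  intro x y hxy
  exact Subtype.ext (hf (congrArg Subtype.val hxy))

theorem Subgroup.card_lt_card_of_ne_top {G : Type*} [Group G] [Finite G] {M : Subgroup G}
    (h : M ≠ ⊤) : Nat.card M < Nat.card G :=
  lt_of_le_of_ne (card_le_card_group M) fun he => h (eq_top_of_card_eq M he)

/-- Between `U` and `K` only `K` itself is `P`-invariant and not contained in `U C(U)`. -/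
theorem eq_of_not_le_of_isPNilpotent {p : ℕ} [Fact p.Prime] {G : Type*} [Group G] [Finite G]
    {P : Sylow p G} {U K L : Subgroup G} [U.Normal] (hUp : IsPGroup p U)
    (hcop : (U.relIndex K).Coprime p)
    (hA : ∀ M : Subgroup G, M ≠ ⊤ → (P : Subgroup G) ≤ M → IsPNilpotent p M)
    (hUL : U ≤ L) (hLK : L ≤ K) (hPL : (P : Subgroup G) ≤ normalizer (L : Set G))
    (hLU : ¬ L ≤ U ⊔ centralizer (U : Set G)) : L = K := by
  have hmem : ∀ {x : G}, x ∈ (P : Subgroup G) ⊔ L ↔ ∃ a ∈ (P : Subgroup G), ∃ n ∈ L, x = a * n :=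
    mem_sup_of_le_normalizer hPL
  have htop : (P : Subgroup G) ⊔ L = ⊤ := by
    by_contra hne
    obtain ⟨N, hN, h1, h2⟩ := hA _ hne le_sup_left
    apply hLU
    have hUM : U ≤ (P : Subgroup G) ⊔ L := hUL.trans le_sup_right
    have hdisj : Disjoint N (U.subgroupOf ((P : Subgroup G) ⊔ L)) := by
      rw [disjoint_def]
      intro x hx hxU
      refine Subtype.ext (hUp.eq_one_of_coprime (p := p) hxU ?_)
      rw [Subgroup.orderOf_coe]
      exact h1 x hx
    have hNC : ∀ n ∈ N, (n : G) ∈ centralizer (U : Set G) := by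
      intro n hn
      rw [mem_centralizer_iff]
      intro u hu
      exact (congrArg Subtype.val (commute_of_normal_of_disjoint N _ hN inferInstance hdisj n
        ⟨u, hUM hu⟩ hn hu)).symm
    intro l hl
    have hlM : l ∈ (P : Subgroup G) ⊔ L := (le_sup_right : L ≤ (P : Subgroup G) ⊔ L) hl
    obtain ⟨k, hk⟩ := h2 ⟨l, hlM⟩
    have hl1 : l ^ p ^ k ∈ U ⊔ centralizer (U : Set G) :=
      (le_sup_right : centralizer (U : Set G) ≤ _) (hNC _ hk)
    have hl2 : l ^ U.relIndex K ∈ U ⊔ centralizer (U : Set G) :=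
      (le_sup_left : U ≤ _) (pow_relIndex_mem U (hLK hl))
    -- One power of $l$ lies in $C(U)$ and another in $U$, with coprime exponents. Bézout
    -- coefficients then put $l$ itself in $UC(U)$.
    have hg : Nat.gcd (p ^ k) (U.relIndex K) = 1 := (hcop.pow_right k).symm
    have hb := Nat.gcd_eq_gcd_ab (p ^ k) (U.relIndex K)
    rw [hg] at hb
    have e : l = (l ^ p ^ k) ^ (Nat.gcdA (p ^ k) (U.relIndex K)) *
        (l ^ U.relIndex K) ^ (Nat.gcdB (p ^ k) (U.relIndex K)) := by
      rw [← zpow_natCast, ← zpow_natCast, ← zpow_mul, ← zpow_mul, ← zpow_add, ← hb]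
      simp
    rw [e]
    exact mul_mem (zpow_mem hl1 _) (zpow_mem hl2 _)
  apply le_antisymm hLK
  intro k hk
  obtain ⟨a, ha, l, hl, rfl⟩ := hmem.mp (htop ▸ mem_top k : k ∈ (P : Subgroup G) ⊔ L)
  refine mul_mem (hUL (P.2.inf_le_of_coprime hcop ⟨ha, ?_⟩)) hl
  have := mul_mem hk (inv_mem (hLK hl))
  rwa [mul_inv_cancel_right] at this

/-- If a normal subgroup `K` containing `U = O_p(G)` satisfies `K ≤ U C(U)`, `K / U` is a
`p'`-group and `G / K` is a `p`-group, then `G` is `p`-nilpotent. -/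
theorem isPNilpotent_of_le_sup_centralizer {p : ℕ} [Fact p.Prime] {G : Type*} [Group G] [Finite G]
    {U K : Subgroup G} [U.Normal] [K.Normal] (hUp : IsPGroup p U)
    (hcop : (U.relIndex K).Coprime p) (hUK : U ≤ K) (hK : ∀ x : G, ∃ k : ℕ, x ^ p ^ k ∈ K)
    (hle : K ≤ U ⊔ centralizer (U : Set G)) : IsPNilpotent p G := by
  let C : Subgroup G := centralizer (U : Set G) ⊓ K
  have hCn : C.Normal := inferInstance
  -- Sylow $p$-subgroups of $C=C_K(U)$ lie in $U$, hence are central in $C$, and there is no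
  -- nontrivial fusion.
  have hC : IsPNilpotent p C := by
    refine isPNilpotent_of_controls_fusion fun S x hx g hg => ⟨1, one_mem _, ?_⟩
    have hSU : ∀ s ∈ S, (s : G) ∈ U := by
      intro s hs
      refine (S.2.map C.subtype).inf_le_of_coprime hcop ⟨⟨s, hs, rfl⟩, s.2.2⟩
    have hgx : g * x = x * g :=
      Subtype.ext (mem_centralizer_iff.mp g.2.1 x (hSU x hx)).symm
    rw [hgx]; simp
  obtain ⟨N, hN, h1, h2⟩ := hC
  -- Thus $N$ is exactly the set of $p'$-elements of $C$, which is why it is normal in all of $G$.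
  have hchar : ∀ x : C, (orderOf x).Coprime p → x ∈ N := by
    intro x hx
    have hx' : (QuotientGroup.mk x : C ⧸ N) = 1 := by
      obtain ⟨k, hk⟩ := h2 x
      refine eq_one_of_coprime_of_pow_eq_one (p := p) (k := k)
        (hx.coprime_dvd_left (orderOf_map_dvd (QuotientGroup.mk' N) x)) ?_
      rwa [← QuotientGroup.mk_pow, QuotientGroup.eq_one_iff]
    rwa [QuotientGroup.eq_one_iff] at hx'
  refine ⟨N.map C.subtype, ⟨?_⟩, ?_, fun x => ?_⟩
  · rintro _ ⟨n, hn, rfl⟩ g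
    refine ⟨MulAut.conjNormal g n, hchar _ ?_, rfl⟩
    rw [MulEquiv.orderOf_eq]
    exact h1 n hn
  · rintro _ ⟨n, hn, rfl⟩
    rw [coe_subtype, Subgroup.orderOf_coe]
    exact h1 n hn
  · obtain ⟨k, hk⟩ := hK x
    obtain ⟨u, hu, c, hc, huc⟩ := (mem_sup_of_le_normalizer (A := U)
      (N := centralizer (U : Set G)) le_normalizer_of_normal).mp (hle hk)
    have hcK : c ∈ K := by
      have := mul_mem (inv_mem (hUK hu)) hk
      rwa [huc, inv_mul_cancel_left] at this
    obtain ⟨m, hm⟩ := hUp ⟨u, hu⟩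
    have hm' : u ^ p ^ m = 1 := congrArg Subtype.val hm
    obtain ⟨j, hj⟩ := h2 ⟨c, hc, hcK⟩
    have hcomm : Commute u c := mem_centralizer_iff.mp hc u hu
    refine ⟨k + m + j, _, pow_mem hj (p ^ m), ?_⟩
    change (c ^ p ^ j) ^ p ^ m = _
    have e1 : x ^ p ^ (k + m + j) = ((u * c) ^ p ^ m) ^ p ^ j := by
      rw [← huc, ← pow_mul, ← pow_mul, pow_add, pow_add, mul_assoc]
    rw [e1, hcomm.mul_pow, hm', one_mul, ← pow_mul, ← pow_mul, mul_comm]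

universe u

/-- **Thompson's normal `p`-complement theorem** for odd `p`. -/
theorem isPNilpotent_of_thompson {p : ℕ} [Fact p.Prime] (hp2 : p ≠ 2) (n : ℕ) :
    ∀ (G : Type u) [Group G] [Finite G], Nat.card G = n → ∀ P : Sylow p G,
      (∀ b, IsPNilpotent p (normalizer (localSubgroup p b (P : Subgroup G) : Set G))) →
      IsPNilpotent p G := by
  have hp : p.Prime := Fact.out
  induction n using Nat.strong_induction_on with
  | _ n ih =>
  intro G _ _ hn P0 hP0
  by_contra hG
  have hyp : ∀ (P : Sylow p G) b,
      IsPNilpotent p (normalizer (localSubgroup p b (P : Subgroup G) : Set G)) := by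
    intro P b
    obtain ⟨g, hg⟩ := P.exists_smul_eq P0
    refine isPNilpotent_normalizer_of_map (f := (MulAut.conj g).toMonoidHom)
      (MulAut.conj g).injective ?_
    have : (P : Subgroup G).map (MulAut.conj g).toMonoidHom = P0 := by
      rw [← hg]; rfl
    rw [this]
    exact hP0 b
  have hsub : ∀ (P : Sylow p G) (M : Subgroup G), M ≠ ⊤ → (P : Subgroup G) ≤ M →
      IsPNilpotent p M := by
    intro P M hM hPM
    refine ih _ (hn ▸ card_lt_card_of_ne_top hM) M rfl (P.subtype hPM) fun b => ?_
    refine isPNilpotent_normalizer_of_map (f := M.subtype) M.subtype_injective ?_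
    rw [Sylow.coe_subtype, subgroupOf_map_subtype, inf_eq_left.mpr hPM]
    exact hyp P b
  have hnn : ∀ (P : Sylow p G) b, ¬ (localSubgroup p b (P : Subgroup G)).Normal := by
    intro P b h
    exact hG ((hyp P b).of_subgroup_eq_top (normalizer_eq_top_iff.mpr h))
  -- a nontrivial normal `p`-subgroup
  obtain ⟨X, hXn, hXp, hX1⟩ : ∃ X : Subgroup G, X.Normal ∧ IsPGroup p X ∧ X ≠ ⊥ := by
    by_contra! hcon
    -- Among nontrivial $p$-subgroups whose normalizer is not $p$-nilpotent, which exist by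
    -- Frobenius' criterion, $X$ is taken with the largest $p$-part of $|N(X)|$.
    obtain ⟨X, ⟨hXp, hX1, hXN⟩, hmax⟩ := Set.exists_max_image
      {X : Subgroup G | IsPGroup p X ∧ X ≠ ⊥ ∧ ¬ IsPNilpotent p (normalizer (X : Set G))}
      (fun X => (Nat.card (normalizer (X : Set G))).factorization p) (Set.toFinite _) (by
        by_contra! he
        refine hG (isPNilpotent_of_normalizers fun X h1 h2 => ?_)
        by_contra h3
        exact (Set.eq_empty_iff_forall_notMem.mp he X) ⟨h1, h2, h3⟩)
    let M := normalizer (X : Set G)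
    have hMtop : M ≠ ⊤ := fun h => hX1 (hcon X (normalizer_eq_top_iff.mp h) hXp)
    obtain ⟨S⟩ := (inferInstance : Nonempty (Sylow p M))
    obtain ⟨P, hSP⟩ := (S.2.map M.subtype).exists_le_sylow
    have hXS : X ≤ (S : Subgroup M).map M.subtype := by
      have h1 : X.subgroupOf M ≤ S := by
        have : (X.subgroupOf M).Normal := normal_in_normalizer
        exact IsPGroup.le_sylow_of_normal (N := X.subgroupOf M) hXp.comap_subtype S
      have h2 := map_mono (f := M.subtype) h1
      rwa [subgroupOf_map_subtype, inf_eq_left.mpr le_normalizer] at h2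
    have hS1 : (S : Subgroup M).map M.subtype ≠ ⊥ := fun h => hX1 (le_bot_iff.mp (h ▸ hXS))
    have hlt : (S : Subgroup M).map M.subtype < P := by
      refine lt_of_le_of_ne hSP fun he => hXN (hsub P M hMtop ?_)
      rw [← he]
      exact map_subtype_le _
    refine hXN (ih _ (hn ▸ card_lt_card_of_ne_top hMtop) M rfl S fun b => ?_)
    refine isPNilpotent_normalizer_of_map (f := M.subtype) M.subtype_injective ?_
    set T := (S : Subgroup M).map M.subtype with hT
    by_contra hW
    have hTp : IsPGroup p T := S.2.map _
    -- Maximality bounds the $p$-part of the order of this normalizer by $|T|$. Yet the normalizer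
    -- contains $N_P(T)$, a $p$-group strictly larger than $T$.
    have hle := hmax (localSubgroup p b T) ⟨hTp.to_le (localSubgroup_le p b T),
      localSubgroup_ne_bot b hTp hS1, hW⟩
    obtain ⟨x, hxP, hxT, hxn⟩ := P.2.exists_mem_normalizer hlt
    let T' : Subgroup G := (P : Subgroup G) ⊓ normalizer (T : Set G)
    have hTT' : T < T' := by
      refine lt_of_le_of_ne (le_inf hSP le_normalizer) fun he => hxT ?_
      rw [he]
      exact ⟨hxP, hxn⟩
    have hT'p : IsPGroup p T' := P.2.to_le inf_le_left
    have hT'N : T' ≤ normalizer (localSubgroup p b T : Set G) :=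
      inf_le_right.trans (normalizer_le_normalizer_localSubgroup b T)
    obtain ⟨j, hj⟩ := IsPGroup.iff_card.mp hT'p
    have hjd : j ≤ (Nat.card (normalizer (localSubgroup p b T : Set G))).factorization p :=
      (hp.pow_dvd_iff_le_factorization Nat.card_pos.ne').mp (hj ▸ card_dvd_of_le hT'N)
    have hTc : Nat.card T = p ^ (Nat.card M).factorization p := by
      rw [hT, card_map_of_injective M.subtype_injective]
      exact S.card_eq_multiplicity
    have hcl : Nat.card T < Nat.card T' := Set.Finite.card_lt_card (Set.toFinite _) hTT'
    rw [hTc, hj] at hcl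
    have := (Nat.pow_lt_pow_iff_right hp.one_lt).mp hcl
    exact absurd (hjd.trans hle) (not_le.mpr this)
  -- the largest normal `p`-subgroup
  let U : Subgroup G := sSup {X | X.Normal ∧ IsPGroup p X}
  have hUp : IsPGroup p U := Sylow.sSup_of_normal _ (fun H h => h.2) (fun H h => h.1)
  have hUn : U.Normal := Subgroup.sSup_normal _ fun H h => h.1
  have hUmax : ∀ X : Subgroup G, X.Normal → IsPGroup p X → X ≤ U := fun X h1 h2 =>
    le_sSup ⟨h1, h2⟩
  have hU1 : U ≠ ⊥ := fun h => hX1 (le_bot_iff.mp (h ▸ hUmax X hXn hXp))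
  have hUP : U ≤ P0 := hUp.le_sylow_of_normal P0
  have hUP' : ¬ (P0 : Subgroup G) ≤ U := by
    intro h
    have he : (P0 : Subgroup G) = U := le_antisymm h hUP
    refine hnn P0 true ?_
    rw [he]
    exact thompsonSubgroup_normal
  let π := QuotientGroup.mk' U
  have hπ : Function.Surjective π := QuotientGroup.mk'_surjective U
  have hker : π.ker = U := QuotientGroup.ker_mk' U
  let R : Sylow p (G ⧸ U) := P0.mapSurjective hπ
  have hR : (R : Subgroup (G ⧸ U)) = (P0 : Subgroup G).map π := rfl
  have hR1 : (R : Subgroup (G ⧸ U)) ≠ ⊥ := by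
    rw [hR, Ne, Subgroup.map_eq_bot_iff, hker]
    exact hUP'
  have hquot : IsPNilpotent p (G ⧸ U) := by
    have hcard : Nat.card (G ⧸ U) < n := by
      have h1 := card_mul_index U
      have h2 : 1 < Nat.card U := (one_lt_card_iff_ne_bot U).mpr hU1
      have h3 : 0 < U.index := Nat.pos_of_ne_zero index_ne_zero_of_finite
      change U.index < n
      nlinarith
    refine ih _ hcard (G ⧸ U) rfl R fun b => ?_
    -- The normalizer of $Y$ contains $P_0$. It is proper, since a normal $p$-subgroup $Y$ would lie
    -- in $U$ and have trivial image. So it is $p$-nilpotent, and this passes to its image in $G/U$.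
    let Y := (localSubgroup p b (R : Subgroup (G ⧸ U))).comap π
    have hYp : IsPGroup p Y :=
      (R.2.to_le (localSubgroup_le p b _)).comap_of_ker_isPGroup π (by rwa [hker])
    have hYN : normalizer (Y : Set G)
        = (normalizer (localSubgroup p b (R : Subgroup (G ⧸ U)) : Set (G ⧸ U))).comap π :=
      (comap_normalizer_eq_of_surjective _ hπ).symm
    have hPY : (P0 : Subgroup G) ≤ normalizer (Y : Set G) := by
      rw [hYN, ← map_le_iff_le_comap, ← hR]
      exact le_normalizer.trans (normalizer_le_normalizer_localSubgroup b _)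
    have hYtop : normalizer (Y : Set G) ≠ ⊤ := by
      intro h
      have h1 := hUmax Y (normalizer_eq_top_iff.mp h) hYp
      refine localSubgroup_ne_bot b R.2 hR1 ?_
      rw [← map_comap_eq_self_of_surjective hπ (localSubgroup p b (R : Subgroup (G ⧸ U))),
        Subgroup.map_eq_bot_iff, hker]
      exact h1
    have h1 := hsub P0 _ hYtop hPY
    rw [hYN] at h1
    exact h1.of_surjective (π.subgroupComap _) (MonoidHom.subgroupComap_surjective_of_surjective _ _ hπ)
  obtain ⟨N, hNn, hN1, hN2⟩ := hquot
  let K := N.comap π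
  have hKn : K.Normal := hNn.comap π
  have hUK : U ≤ K := by
    rw [← hker]; exact ker_le_comap _ _
  have hcop : (U.relIndex K).Coprime p := by
    rw [Nat.coprime_comm, hp.coprime_iff_not_dvd]
    have h1 : U.relIndex K = Nat.card N := by
      conv_lhs => rw [← hker]
      rw [relIndex_ker, map_comap_eq_self_of_surjective hπ]
    rw [h1]
    intro hd
    obtain ⟨x, hx⟩ := exists_prime_orderOf_dvd_card' p hd
    have h2 := hN1 x x.2
    rw [Subgroup.orderOf_coe, hx, Nat.coprime_self] at h2
    exact hp.one_lt.ne' h2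
  have hKpow : ∀ x : G, ∃ k : ℕ, x ^ p ^ k ∈ K := by
    intro x
    obtain ⟨k, hk⟩ := hN2 (π x)
    exact ⟨k, by rwa [mem_comap, map_pow]⟩
  have hKP : K ⊔ P0 = ⊤ := by
    have hquot : IsPGroup p (G ⧸ K) := by
      intro x
      obtain ⟨x, rfl⟩ := QuotientGroup.mk_surjective x
      obtain ⟨k, hk⟩ := hKpow x
      exact ⟨k, by rwa [← QuotientGroup.mk_pow, QuotientGroup.eq_one_iff]⟩
    have hsurj := QuotientGroup.mk'_surjective K
    have htop : (P0 : Subgroup G).map (QuotientGroup.mk' K) = ⊤ := by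
      have := (P0.mapSurjective hsurj).3 (Q := ⊤) (hquot.to_subgroup ⊤) le_top
      rw [Sylow.coe_mapSurjective] at this
      exact this.symm
    have := congrArg (comap (QuotientGroup.mk' K)) htop
    rwa [comap_map_eq, QuotientGroup.ker_mk', comap_top, sup_comm] at this
  by_cases hle : K ≤ U ⊔ centralizer (U : Set G)
  · exact hG (isPNilpotent_of_le_sup_centralizer hUp hcop hUK hKpow hle)
  · refine not_minimal_configuration (P := P0) hp2 hUp hU1 hUmax hUK hcop hKP hle ?_
      (hnn P0 true) (hnn P0 false)
    intro L h1 h2 h3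
    by_cases hLU : L ≤ U ⊔ centralizer (U : Set G)
    · exact Or.inr hLU
    · exact Or.inl (eq_of_not_le_of_isPNilpotent hUp hcop (hsub P0) h1 h2 h3 hLU)

end

/-! ### Fixed-point-free automorphisms of prime order. -/

section

theorem Subgroup.mem_of_coprime_of_pow_mem {G : Type*} [Group G] {N : Subgroup G} [N.Normal]
    {x : G} {p k : ℕ} (hx : (orderOf x).Coprime p) (hk : x ^ p ^ k ∈ N) : x ∈ N := by
  rw [← QuotientGroup.eq_one_iff]
  refine eq_one_of_coprime_of_pow_eq_one (p := p) (k := k)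
    (hx.coprime_dvd_left (orderOf_map_dvd (QuotientGroup.mk' N) x)) ?_
  rwa [← QuotientGroup.mk_pow, QuotientGroup.eq_one_iff]

theorem eq_zero_of_coprime_nsmul {A : Type*} [AddCommGroup A] {m n : ℕ} (h : m.Coprime n) {v : A}
    (hm : m • v = 0) (hn : n • v = 0) : v = 0 := by
  have h1 : addOrderOf v ∣ m := addOrderOf_dvd_of_nsmul_eq_zero hm
  have h2 : addOrderOf v ∣ n := addOrderOf_dvd_of_nsmul_eq_zero hn
  exact AddMonoid.addOrderOf_eq_one_iff.mp (Nat.eq_one_of_dvd_coprimes h h1 h2)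

/-- A Frobenius group `T⟨α⟩` acting on an abelian group `A` of exponent coprime to `|T|` such that
`α` has no nonzero fixed vectors: the kernel `T` acts trivially. -/
theorem smul_eq_of_fixedPointFree {T A : Type*} [Group T] [Finite T] [AddCommGroup A]
    [DistribMulAction T A] (α : T →* T) (β : A →+ A) {r s : ℕ} (hr : r.Prime)
    (hα : ∀ t, α^[r] t = t) (hβ : ∀ v, β^[r] v = v) (hαβ : ∀ (t : T) v, β (t • v) = α t • β v)
    (hαf : ∀ t, α t = t → t = 1) (hβf : ∀ v, β v = v → v = 0) (hs : ∀ v : A, s • v = 0)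
    (hcop : (Nat.card T).Coprime s) (t : T) (v : A) : t • v = v := by
  classical
  have : Fintype T := Fintype.ofFinite T
  have hit : ∀ (i : ℕ) (t : T) v, β^[i] (t • v) = α^[i] t • β^[i] v := by
    intro i
    induction i with
    | zero => intro t v; rfl
    | succ i ih => intro t v; simp only [Function.iterate_succ_apply, hαβ, ih]
  have hsum : ∀ w : A, ∑ i ∈ Finset.range r, β^[i] w = 0 := by
    intro w
    apply hβf
    rw [map_sum]
    have h1 : ∀ i ∈ Finset.range r, β (β^[i] w) = β^[i + 1] w := fun i _ =>
      (Function.iterate_succ_apply' β i w).symm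
    rw [Finset.sum_congr rfl h1]
    have h2 := Finset.sum_range_succ (fun i => β^[i] w) r
    have h3 := Finset.sum_range_succ' (fun i => β^[i] w) r
    rw [h2, hβ] at h3
    exact (add_right_cancel h3).symm
  let S : A → A := fun w => ∑ t : T, t • w
  have hSt : ∀ (t : T) w, t • S w = S w := by
    intro t w
    simp only [S, Finset.smul_sum, smul_smul]
    exact Fintype.sum_bijective (t * ·) (Group.mulLeft_bijective t) _ _ fun _ => rfl
  have hSadd : ∀ (w : ℕ → A) (I : Finset ℕ), S (∑ i ∈ I, w i) = ∑ i ∈ I, S (w i) := by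
    intro w I
    simp only [S, Finset.smul_sum]
    exact Finset.sum_comm
  -- For fixed $t$ the inner sum is $t\sum_i\beta^i(t^{-1}w)$, and a full $\beta$-orbit sum is
  -- $\beta$-fixed, hence zero.
  have hmain : ∀ w : A, ∑ i ∈ Finset.range r, ∑ t : T, (t * (α^[i] t)⁻¹) • β^[i] w = 0 := by
    intro w
    rw [Finset.sum_comm]
    refine Finset.sum_eq_zero fun t _ => ?_
    have h1 : ∀ i ∈ Finset.range r, (t * (α^[i] t)⁻¹) • β^[i] w = t • β^[i] (t⁻¹ • w) := by
      intro i _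
      rw [hit, smul_smul, iterate_map_inv]
    rw [Finset.sum_congr rfl h1, ← Finset.smul_sum, hsum, smul_zero]
  -- As $r$ is prime, $\alpha^i$ is again fixed-point-free, so $t\mapsto t\,\alpha^i(t)^{-1}$
  -- permutes $T$.
  have hfree : ∀ i, 0 < i → i < r → ∀ w : A, ∑ t : T, (t * (α^[i] t)⁻¹) • w = S w := by
    intro i hi hir w
    refine Fintype.sum_bijective (fun t => t * (α^[i] t)⁻¹) ?_ _ _ fun _ => rfl
    refine Finite.injective_iff_bijective.mp fun x y hxy => ?_
    have h1 : α^[i] (y⁻¹ * x) = y⁻¹ * x := by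
      rw [iterate_map_mul, iterate_map_inv]
      have h2 : x * (α^[i] x)⁻¹ = y * (α^[i] y)⁻¹ := hxy
      rw [mul_inv_eq_iff_eq_mul, mul_assoc] at h2
      exact eq_inv_mul_of_mul_eq h2.symm
    have h2 : Function.IsPeriodicPt α (i.gcd r) (y⁻¹ * x) :=
      Function.IsPeriodicPt.gcd h1 (hα _)
    rw [(((Nat.Prime.coprime_iff_not_dvd hr).mpr (Nat.not_dvd_of_pos_of_lt hi hir)).symm : i.gcd r = 1)] at h2
    exact (inv_mul_eq_one.mp (hαf _ h2)).symm
  -- In `hmain` the term $i=0$ is $|T|v$, and the remaining ones sum to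
  -- $S(\sum_{i>0}\beta^iv)=S(-v)$. So $|T|v$ is $T$-fixed.
  have hcard : Nat.card T • v = S v := by
    have h1 := hmain v
    obtain ⟨r', rfl⟩ : ∃ r', r = r' + 1 := ⟨r - 1, (Nat.succ_pred_eq_of_pos hr.pos).symm⟩
    rw [Finset.sum_range_succ'] at h1
    have h2 : ∀ i ∈ Finset.range r', ∑ t : T, (t * (α^[i + 1] t)⁻¹) • β^[i + 1] v
        = S (β^[i + 1] v) := fun i hi =>
      hfree _ (Nat.succ_pos i) (by have := Finset.mem_range.mp hi; omega) _
    rw [Finset.sum_congr rfl h2, ← hSadd] at h1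
    have h3 := hsum v
    rw [Finset.sum_range_succ'] at h3
    rw [eq_neg_of_add_eq_zero_left h3] at h1
    simp only [Function.iterate_zero, id, mul_inv_cancel, one_smul, Finset.sum_const,
      Finset.card_univ] at h1
    have h4 : S (-v) = - S v := by simp [S]
    rw [h4] at h1
    rw [Nat.card_eq_fintype_card]
    exact (neg_add_eq_zero.mp h1).symm
  rw [← sub_eq_zero]
  refine eq_zero_of_coprime_nsmul hcop ?_ (hs _)
  rw [smul_sub, smul_comm, hcard, hSt, sub_self]

open MonoidHom

variable {G : Type*} [Group G] [Finite G]

/-- On the finite invariant subgroup $N$ every element has the form $m\,\alpha(m)^{-1}$, so a fixed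
coset $gN$ contains a fixed element $gm$. -/
theorem MonoidHom.FixedPointFree.quotient_map {α : G →* G} (hα : FixedPointFree α) {N : Subgroup G}
    [N.Normal] (hN : N ≤ N.comap α) : FixedPointFree (QuotientGroup.map N N α hN) := by
  intro x hx
  obtain ⟨g, rfl⟩ := QuotientGroup.mk_surjective x
  have h1 : g⁻¹ * α g ∈ N := QuotientGroup.eq.mp hx.symm
  let f : N →* N := (α.comp N.subtype).codRestrict N fun n => hN n.2
  have hf : FixedPointFree f := fun n hn => Subtype.ext (hα n (congrArg Subtype.val hn))
  obtain ⟨m, hm⟩ := hf.commutatorMap_surjective ⟨_, h1⟩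
  have hm' : (m : G) / α m = g⁻¹ * α g := congrArg Subtype.val hm
  have h2 : α (g * m) = g * m := by
    rw [map_mul, ← inv_mul_eq_iff_eq_mul, ← mul_assoc, ← hm', div_mul_cancel]
  have h3 := hα _ h2
  rw [QuotientGroup.eq_one_iff, eq_inv_of_mul_eq_one_left h3]
  exact inv_mem m.2

/-- If $\alpha(P)\le gPg^{-1}$, writing $g^{-1}=m\,\alpha(m)^{-1}$ makes the conjugate $m^{-1}Pm$
invariant. -/
theorem MonoidHom.FixedPointFree.exists_sylow {α : G →* G} (hα : FixedPointFree α) (p : ℕ) [Fact p.Prime] :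
    ∃ P : Sylow p G, ∀ x ∈ P, α x ∈ P := by
  obtain ⟨P⟩ := (inferInstance : Nonempty (Sylow p G))
  obtain ⟨P', hP'⟩ := (P.2.map α).exists_le_sylow
  obtain ⟨g, rfl⟩ := P.exists_smul_eq P'
  obtain ⟨m, hm⟩ := hα.commutatorMap_surjective g⁻¹
  have hm' : m / α m = g⁻¹ := hm
  refine ⟨m⁻¹ • P, fun x hx => ?_⟩
  rw [Sylow.mem_smul_iff] at hx ⊢
  have h1 : α (m⁻¹⁻¹ * x * m⁻¹) ∈ g • P := hP' ⟨_, hx, rfl⟩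
  rw [Sylow.mem_smul_iff, ← hm'] at h1
  have e : m / α m * α (m⁻¹⁻¹ * x * m⁻¹) * g = m⁻¹⁻¹ * α x * m⁻¹ := by
    have hg : g = α m * m⁻¹ := by rw [← inv_inv g, ← hm', inv_div, div_eq_mul_inv]
    rw [hg, div_eq_mul_inv]
    simp only [map_mul, map_inv]
    group
  rwa [e] at h1

theorem IsPNilpotent.pi {ι : Type*} [Finite ι] {G : ι → Type*} [∀ i, Group (G i)] {p : ℕ}
    (h : ∀ i, IsPNilpotent p (G i)) : IsPNilpotent p (∀ i, G i) := by
  classical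
  have : Fintype ι := Fintype.ofFinite ι
  choose N hN h1 h2 using h
  refine ⟨Subgroup.pi Set.univ N, ⟨fun n hn g i _ => (hN i).conj_mem _ (hn i trivial) _⟩, ?_, ?_⟩
  · intro x hx
    have hd : orderOf x ∣ ∏ i, orderOf (x i) := by
      refine orderOf_dvd_of_pow_eq_one (funext fun i => ?_)
      obtain ⟨m, hm⟩ := Finset.dvd_prod_of_mem (fun i => orderOf (x i)) (Finset.mem_univ i)
      rw [hm, Pi.pow_apply, pow_mul, pow_orderOf_eq_one, one_pow, Pi.one_apply]
    exact (Nat.Coprime.prod_left fun i _ => h1 i _ (hx i trivial)).coprime_dvd_left hd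
  · intro x
    choose k hk using fun i => h2 i (x i)
    refine ⟨∑ i, k i, fun i _ => ?_⟩
    rw [← Finset.add_sum_erase _ k (Finset.mem_univ i), pow_add, Pi.pow_apply, pow_mul]
    exact pow_mem (hk i) _

theorem IsPNilpotent.of_isPGroup {G : Type*} [Group G] {p r : ℕ} [Fact p.Prime] [Fact r.Prime]
    (hG : IsPGroup r G) : IsPNilpotent p G := by
  by_cases h : r = p
  · subst h
    exact ⟨⊥, inferInstance, fun x hx => by simp [mem_bot.mp hx], hG⟩
  · refine ⟨⊤, inferInstance, fun x _ => ?_, fun x => ⟨0, mem_top _⟩⟩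
    obtain ⟨k, hk⟩ := hG x
    exact (((Nat.coprime_primes Fact.out Fact.out).mpr h).pow_left k).coprime_dvd_left
      (orderOf_dvd_of_pow_eq_one hk)

theorem IsPNilpotent.of_isNilpotent {G : Type*} [Group G] [Finite G] (hG : Group.IsNilpotent G)
    (p : ℕ) [Fact p.Prime] : IsPNilpotent p G := by
  obtain ⟨e⟩ := (Group.isNilpotent_of_finite_tfae.out 0 4 rfl rfl).mp hG
  refine IsPNilpotent.of_injective ?_ e.symm.toMonoidHom e.symm.injective
  refine IsPNilpotent.pi fun r => IsPNilpotent.pi fun P => ?_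
  have : Fact (r : ℕ).Prime := ⟨Nat.prime_of_mem_primeFactors r.2⟩
  exact IsPNilpotent.of_isPGroup P.2

theorem Subgroup.map_eq_of_conj {G : Type*} [Group G] [Finite G] {α : G →* G}
    (hα : Function.Injective α) {P : Subgroup G} (h : ∀ x ∈ P, α x ∈ P) : P.map α = P :=
  eq_of_le_of_card_ge (by rintro _ ⟨x, hx, rfl⟩; exact h x hx) (card_map_of_injective hα).ge

theorem Subgroup.normalizer_invariant {G : Type*} [Group G] [Finite G] {α : G →* G}
    {P : Subgroup G} (h : P.map α = P) {g : G} (hg : g ∈ normalizer (P : Set G)) :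
    α g ∈ normalizer (P : Set G) := by
  refine mem_normalizer_of_conj_mem fun x hx => ?_
  rw [← h] at hx
  obtain ⟨y, hy, rfl⟩ := hx
  rw [← map_mul, ← map_inv, ← map_mul, ← h]
  exact ⟨_, (mem_normalizer_iff.mp hg y).mp hy, rfl⟩

universe u

/-- **Thompson's theorem**: a finite group with a fixed-point-free automorphism of prime order is
nilpotent. -/
theorem isNilpotent_of_fixedPointFree {r : ℕ} (hr : r.Prime) (n : ℕ) :
    ∀ (G : Type u) [Group G] [Finite G], Nat.card G = n → ∀ α : G →* G, (∀ g, α^[r] g = g) →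
      FixedPointFree α → Group.IsNilpotent G := by
  induction n using Nat.strong_induction_on with
  | _ n ih =>
  intro G _ _ hn α hαr hαf
  have hinj : Function.Injective α := by
    rw [injective_iff_map_eq_one]
    intro g hg
    have h1 := hαr g
    rw [← Nat.succ_pred_eq_of_pos hr.pos, Function.iterate_succ_apply, hg, iterate_map_one] at h1
    exact h1.symm
  have hsub : ∀ M : Subgroup G, (∀ x ∈ M, α x ∈ M) → M ≠ ⊤ → Group.IsNilpotent M := by
    intro M hM hMt
    let f : M →* M := (α.comp M.subtype).codRestrict M fun x => hM x x.2
    refine ih _ (hn ▸ card_lt_card_of_ne_top hMt) M rfl f (fun g => Subtype.ext ?_)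
      fun g hg => Subtype.ext (hαf g (congrArg Subtype.val hg))
    have hs : Function.Semiconj (Subtype.val : M → G) f α := fun x => rfl
    rw [(hs.iterate_right r).eq, hαr]
  have hquo : ∀ (N : Subgroup G) [N.Normal], (∀ x ∈ N, α x ∈ N) → N ≠ ⊥ →
      Group.IsNilpotent (G ⧸ N) := by
    intro N hNn hN hN1
    have hcard : Nat.card (G ⧸ N) < n := by
      have h1 := card_mul_index N
      have h2 : 1 < Nat.card N := (one_lt_card_iff_ne_bot N).mpr hN1
      have h3 : 0 < N.index := Nat.pos_of_ne_zero index_ne_zero_of_finite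
      change N.index < n
      nlinarith
    have hN' : N ≤ N.comap α := hN
    refine ih _ hcard (G ⧸ N) rfl (QuotientGroup.map N N α hN') (fun x => ?_)
      (hαf.quotient_map hN')
    obtain ⟨g, rfl⟩ := QuotientGroup.mk_surjective x
    have hs : Function.Semiconj (QuotientGroup.mk : G → G ⧸ N) α (QuotientGroup.map N N α hN') :=
      fun x => rfl
    rw [← (hs.iterate_right r).eq, hαr]
  -- reduction to the case of a proper nontrivial invariant normal subgroup
  suffices h : Group.IsNilpotent G ∨
      ∃ N : Subgroup G, N.Normal ∧ (∀ x ∈ N, α x ∈ N) ∧ N ≠ ⊥ ∧ Group.IsNilpotent N by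
    rcases h with h | ⟨N, hNn, hN, hN1, hNnil⟩
    · exact h
    have : Nontrivial N := (nontrivial_iff_ne_bot N).mpr hN1
    have hc : center N ≠ ⊥ := Group.IsNilpotent.center_ne_bot N
    obtain ⟨s, hs, hsd⟩ := Nat.exists_prime_and_dvd (n := Nat.card (center N)) fun h =>
      hc (card_eq_one.mp h)
    have : Fact s.Prime := ⟨hs⟩
    -- An invariant elementary abelian normal $s$-subgroup. Induction makes $G/V$ nilpotent, so it
    -- remains to descend normality of Sylow subgroups from $G/V$ to $G$.
    let V := omegaCenter s N
    have hVn : V.Normal := omegaCenter_normal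
    have hV1 : V ≠ ⊥ := omegaCenter_ne_bot_of_dvd hsd
    have hVα : ∀ x ∈ V, α x ∈ V := by
      have h1 := map_omegaCenter s α hinj N
      rw [map_eq_of_conj hinj hN] at h1
      intro x hx
      change α x ∈ omegaCenter s N
      rw [← h1]
      exact ⟨x, hx, rfl⟩
    have hVc : ∀ x ∈ V, ∀ y ∈ V, x * y = y * x := fun x hx y hy => hx.2.2 y hy.1
    have hVs : ∀ x ∈ V, x ^ s = 1 := fun x hx => hx.2.1
    have hnil := hquo V hVα hV1
    refine (Group.isNilpotent_of_finite_tfae.out 0 3 rfl rfl).mpr fun q hq P => ?_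
    obtain ⟨T, hT⟩ := hαf.exists_sylow q
    have hTn : (T : Subgroup G).Normal := by
      have hπ := QuotientGroup.mk'_surjective V
      have hTV : ∀ g, ∀ t ∈ T, ∃ t' ∈ T, ∃ v ∈ V, g * t * g⁻¹ = t' * v := by
        intro g t ht
        have h1 : ((T.mapSurjective hπ : Sylow q (G ⧸ V)) : Subgroup (G ⧸ V)).Normal :=
          (Group.isNilpotent_of_finite_tfae.out 0 3 rfl rfl).mp hnil q hq _
        rw [Sylow.coe_mapSurjective] at h1
        obtain ⟨t', ht', h2⟩ := h1.conj_mem (QuotientGroup.mk' V t) ⟨t, ht, rfl⟩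
          (QuotientGroup.mk' V g)
        rw [← map_mul, ← map_inv, ← map_mul] at h2
        exact ⟨t', ht', t'⁻¹ * (g * t * g⁻¹), QuotientGroup.eq.mp h2, by group⟩
      refine ⟨fun t ht g => ?_⟩
      obtain ⟨t', ht', v, hv, hgt⟩ := hTV g t ht
      rw [hgt]
      by_cases hqs : q = s
      · subst hqs
        have hVq : IsPGroup q V := fun x => ⟨1, Subtype.ext (by simpa using hVs x x.2)⟩
        exact mul_mem ht' (hVq.le_sylow_of_normal T hv)
      -- For $q\ne s$ the Frobenius-type lemma makes $T$ centralize $V$. Then $t'$ and $v$ commute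
      -- and have coprime orders, while $t'v$ is a $q$-element, so $v=1$.
      · have hcent : ∀ t ∈ T, ∀ v ∈ V, t * v * t⁻¹ = v := by
          have : IsMulCommutative V := ⟨⟨fun x y => Subtype.ext (hVc _ x.2 _ y.2)⟩⟩
          let _ : DistribMulAction (T : Subgroup G) (Additive V) :=
            DistribMulAction.compHom (Additive V) ((conjEnd V).comp (T : Subgroup G).subtype)
          let f : (T : Subgroup G) →* (T : Subgroup G) :=
            (α.comp (T : Subgroup G).subtype).codRestrict T fun x => hT x x.2
          let h : V →* V := (α.comp V.subtype).codRestrict V fun x => hVα x x.2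
          have hs1 : Function.Semiconj (Subtype.val : ↥(T : Subgroup G) → G) f α := fun x => rfl
          have hs2 : Function.Semiconj (Subtype.val : V → G) h α := fun x => rfl
          intro t ht v hv
          have hT1 : (Nat.card (T : Subgroup G)).Coprime s := by
            obtain ⟨k, hk⟩ := IsPGroup.iff_card.mp T.2
            rw [hk]
            exact ((Nat.coprime_primes hq.out hs).mpr hqs).pow_left k
          have := smul_eq_of_fixedPointFree f h.toAdditive hr
            (fun t => Subtype.ext (by rw [(hs1.iterate_right r).eq, hαr]))
            (fun v => Additive.toMul.injective (Subtype.ext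
              (((hs2.iterate_right r).eq v.toMul).trans (hαr _))))
            (fun t v => Additive.toMul.injective (Subtype.ext (by
              change α ((t : G) * v.toMul * (t : G)⁻¹) = α t * α v.toMul * (α t)⁻¹
              simp)))
            (fun t ht => Subtype.ext (hαf _ (congrArg Subtype.val ht)))
            (fun v hv => Additive.toMul.injective (Subtype.ext
              (hαf _ (congrArg (fun w : Additive V => (w.toMul : G)) hv))))
            (s := s) (fun v => Additive.toMul.injective (Subtype.ext (hVs _ v.toMul.2)))
            hT1 ⟨t, ht⟩ (Additive.ofMul ⟨v, hv⟩)
          exact congrArg (fun w : Additive V => (w.toMul : G)) this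
        have hv1 : v = 1 := by
          have hcomm : Commute t' v := by
            have := hcent t' ht' v hv
            rwa [mul_inv_eq_iff_eq_mul] at this
          obtain ⟨k, hk⟩ := T.2 ⟨t, ht⟩
          obtain ⟨k', hk'⟩ := T.2 ⟨t', ht'⟩
          have hk1 : t ^ q ^ k = 1 := congrArg Subtype.val hk
          have hk2 : t' ^ q ^ k' = 1 := congrArg Subtype.val hk'
          have h1 : (t' * v) ^ q ^ (k + k') = 1 := by
            rw [← hgt, conj_pow, pow_add, pow_mul, hk1]
            simp
          rw [hcomm.mul_pow, pow_add, mul_comm (q ^ k), pow_mul t', hk2, one_pow, one_mul,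
            ← pow_add] at h1
          refine eq_one_of_coprime_of_pow_eq_one (p := q) ?_ h1
          exact (((Nat.coprime_primes hq.out hs).mpr hqs).symm).coprime_dvd_left
            (orderOf_dvd_of_pow_eq_one (hVs v hv))
        rw [hv1, mul_one]
        exact ht'
    obtain ⟨g, rfl⟩ := T.exists_smul_eq P
    rwa [Sylow.smul_eq_of_normal]
  by_cases hodd : ∃ p : ℕ, p.Prime ∧ p ≠ 2 ∧ p ∣ Nat.card G
  · obtain ⟨p, hp, hp2, hpd⟩ := hodd
    have : Fact p.Prime := ⟨hp⟩
    obtain ⟨P, hP⟩ := hαf.exists_sylow p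
    have hP1 : (P : Subgroup G) ≠ ⊥ := P.ne_bot_of_dvd_card hpd
    have hPm : (P : Subgroup G).map α = P := map_eq_of_conj hinj hP
    have hloc : ∀ b, (localSubgroup p b (P : Subgroup G)).map α = localSubgroup p b P := by
      intro b
      rw [map_localSubgroup p b α hinj, hPm]
    -- If both normalizers are proper they are nilpotent by induction, and Thompson's theorem gives
    -- a $p$-complement. This is invariant and, being proper, nilpotent. Otherwise one of the two
    -- characteristic subgroups of $P$ is itself the invariant normal subgroup sought.
    by_cases hall : ∀ b, normalizer (localSubgroup p b (P : Subgroup G) : Set G) ≠ ⊤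
    · have hpn : IsPNilpotent p G := by
        refine isPNilpotent_of_thompson hp2 _ G rfl P fun b => ?_
        exact IsPNilpotent.of_isNilpotent
          (hsub _ (fun g hg => normalizer_invariant (hloc b) hg) (hall b)) p
      obtain ⟨N, hNn, h1, h2⟩ := hpn
      by_cases hN1 : N = ⊥
      · refine Or.inl (IsPGroup.isNilpotent (p := p) fun x => ?_)
        obtain ⟨k, hk⟩ := h2 x
        rw [hN1, mem_bot] at hk
        exact ⟨k, hk⟩
      · have hchar : ∀ x, (orderOf x).Coprime p → x ∈ N := fun x hx =>
          mem_of_coprime_of_pow_mem hx (h2 x).choose_spec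
        have hNα : ∀ x ∈ N, α x ∈ N := fun x hx =>
          hchar _ ((h1 x hx).coprime_dvd_left (orderOf_map_dvd α x))
        refine Or.inr ⟨N, hNn, hNα, hN1, hsub N hNα fun htop => hP1 ?_⟩
        rw [eq_bot_iff]
        intro x hx
        exact mem_bot.mpr (P.2.eq_one_of_coprime hx (h1 x (htop ▸ mem_top x)))
    · push Not at hall
      obtain ⟨b, hb⟩ := hall
      have hlp : IsPGroup p (localSubgroup p b (P : Subgroup G)) :=
        P.2.to_le (localSubgroup_le p b _)
      refine Or.inr ⟨localSubgroup p b P, normalizer_eq_top_iff.mp hb, fun x hx => ?_,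
        localSubgroup_ne_bot b P.2 hP1, hlp.isNilpotent⟩
      rw [← hloc b]
      exact ⟨x, hx, rfl⟩
  · left
    push Not at hodd
    have h2 : IsPGroup 2 G := by
      have h1 := Nat.eq_prime_pow_of_unique_prime_dvd (n := Nat.card G) (p := 2)
        Nat.card_pos.ne' fun {d} hd hdd => by
          by_contra h
          exact hodd d hd h hdd
      exact IsPGroup.of_card h1
    exact h2.isNilpotent

end

/-! ### Coprime action on $q$-groups. -/

/-- A nilpotent group acting coprimely on a finite `q`-group fixes an element of every invariant
coset of an invariant subgroup. -/
theorem exists_fixed_of_coprime {T Q : Type*} [Group T] [Finite T] [Group Q] [Finite Q]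
    [MulDistribMulAction T Q] (hT : Group.IsNilpotent T) {q : ℕ} [Fact q.Prime]
    (hQ : IsPGroup q Q) (hcop : (Nat.card T).Coprime q) (N : Subgroup Q)
    (hN : ∀ t : T, ∀ x ∈ N, t • x ∈ N) (y : Q) (hy : ∀ t : T, y⁻¹ * (t • y) ∈ N) :
    ∃ x, y⁻¹ * x ∈ N ∧ ∀ t : T, t • x = x := by
  have hnormal : ∀ p, p.Prime → ∀ P : Sylow p T, (P : Subgroup T).Normal := fun p hp P =>
    (Group.isNilpotent_of_finite_tfae.out 0 3 rfl rfl).mp hT p ⟨hp⟩ P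
  -- The primes dividing $|T|$ are treated one at a time. Normality of the Sylow subgroups keeps the
  -- set of points already fixed by the earlier ones stable under $T$.
  have key : ∀ S : Finset ℕ, ∃ x, y⁻¹ * x ∈ N ∧
      ∀ p ∈ S, p.Prime → ∀ P : Sylow p T, ∀ g ∈ P, g • x = x := by
    intro S
    induction S using Finset.induction_on with
    | empty => exact ⟨y, by simp [one_mem], by simp⟩
    | insert p S _ ih =>
      obtain ⟨x₀, hx₀, hfix⟩ := ih
      by_cases hp : p.Prime
      swap
      · refine ⟨x₀, hx₀, fun r hr hrp => ?_⟩
        rcases Finset.mem_insert.mp hr with rfl | hr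
        · exact absurd hrp hp
        · exact hfix r hr hrp
      have : Fact p.Prime := ⟨hp⟩
      obtain ⟨P⟩ := (inferInstance : Nonempty (Sylow p T))
      have hPn := hnormal p hp P
      let X : SubMulAction (P : Subgroup T) Q :=
        { carrier := {x | y⁻¹ * x ∈ N ∧
            ∀ r ∈ S, r.Prime → ∀ R : Sylow r T, ∀ g ∈ R, g • x = x}
          smul_mem' := by
            rintro ⟨t, ht⟩ x ⟨hx, hx'⟩
            refine ⟨?_, fun r hr hrp R g hg => ?_⟩
            · change y⁻¹ * (t • x) ∈ N
              have h1 := mul_mem (hy t) (hN t _ hx)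
              rwa [smul_mul', smul_inv', mul_assoc, mul_inv_cancel_left] at h1
            · change g • t • x = t • x
              have h1 := (hnormal r hrp R).conj_mem g hg t⁻¹
              have h2 := hx' r hr hrp R _ h1
              rw [inv_inv, mul_smul, mul_smul, inv_smul_eq_iff] at h2
              exact h2 }
      let C : Subgroup Q :=
        { carrier := {x | x ∈ N ∧ ∀ r ∈ S, r.Prime → ∀ R : Sylow r T, ∀ g ∈ R, g • x = x}
          one_mem' := ⟨one_mem _, by simp⟩
          mul_mem' := fun {a b} ha hb => ⟨mul_mem ha.1 hb.1, fun r hr hrp R g hg => by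
            rw [smul_mul', ha.2 r hr hrp R g hg, hb.2 r hr hrp R g hg]⟩
          inv_mem' := fun {a} ha => ⟨inv_mem ha.1, fun r hr hrp R g hg => by
            rw [smul_inv', ha.2 r hr hrp R g hg]⟩ }
      -- A translate of the $q$-group $C$, so $X$ has $q$-power size, and a $p$-group with $p\ne q$
      -- fixes a point of it.
      have hCX : Nat.card X = Nat.card C := by
        refine Nat.card_congr
          { toFun := fun x => ⟨x₀⁻¹ * x, ?_, ?_⟩
            invFun := fun c => ⟨x₀ * c, ?_, ?_⟩
            left_inv := fun x => Subtype.ext (mul_inv_cancel_left _ _)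
            right_inv := fun c => Subtype.ext (inv_mul_cancel_left _ _) }
        · have h1 := mul_mem (inv_mem hx₀) x.2.1
          rwa [mul_inv_rev, inv_inv, mul_assoc, mul_inv_cancel_left] at h1
        · intro r hr hrp R g hg
          rw [smul_mul', smul_inv', hfix r hr hrp R g hg, x.2.2 r hr hrp R g hg]
        · rw [← mul_assoc]
          exact mul_mem hx₀ c.2.1
        · intro r hr hrp R g hg
          rw [smul_mul', hfix r hr hrp R g hg, c.2.2 r hr hrp R g hg]
      by_cases hpq : p = q
      · subst hpq
        have hP : ∀ g ∈ P, g = 1 := fun g hg => P.2.eq_one_of_coprime hg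
          (hcop.coprime_dvd_left (orderOf_dvd_natCard g))
        refine ⟨x₀, hx₀, fun r hr hrp R g hg => ?_⟩
        rcases Finset.mem_insert.mp hr with rfl | hr
        · have : g = 1 := R.2.eq_one_of_coprime hg
            (hcop.coprime_dvd_left (orderOf_dvd_natCard g))
          rw [this, one_smul]
        · exact hfix r hr hrp R g hg
      · have hpX : ¬ p ∣ Nat.card X := by
          rw [hCX]
          obtain ⟨k, hk⟩ := IsPGroup.iff_card.mp (hQ.to_subgroup C)
          rw [hk]
          intro h
          exact hpq ((Nat.prime_dvd_prime_iff_eq hp Fact.out).mp (hp.dvd_of_dvd_pow h))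
        obtain ⟨x, hx⟩ := P.2.nonempty_fixed_point_of_prime_not_dvd_card X hpX
        refine ⟨x, x.2.1, fun r hr hrp R g hg => ?_⟩
        rcases Finset.mem_insert.mp hr with rfl | hr
        · obtain ⟨s, rfl⟩ := P.exists_smul_eq R
          rw [Sylow.smul_eq_of_normal] at hg
          exact congrArg Subtype.val (hx ⟨g, hg⟩)
        · exact x.2.2 r hr hrp R g hg
  obtain ⟨x, hx, hfix⟩ := key (Nat.card T).primeFactors
  refine ⟨x, hx, fun t => ?_⟩
  have htop : MulAction.stabilizer T x = ⊤ := by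
    rw [← index_eq_one]
    by_contra h
    obtain ⟨p, hp, hpd⟩ := Nat.exists_prime_and_dvd h
    have : Fact p.Prime := ⟨hp⟩
    obtain ⟨P⟩ := (inferInstance : Nonempty (Sylow p T))
    have hpT : p ∈ (Nat.card T).primeFactors :=
      Nat.mem_primeFactors.mpr ⟨hp, hpd.trans (index_dvd_card _), Nat.card_pos.ne'⟩
    have hle : (P : Subgroup T) ≤ MulAction.stabilizer T x := fun g hg => hfix p hpT hp P g hg
    exact P.not_dvd_index (hpd.trans (index_dvd_of_le hle))
  exact (htop ▸ mem_top t : t ∈ MulAction.stabilizer T x)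

/-- A Sylow $q$-subgroup $S$ of $F$ acts on the $q$-group $C_Q(T)$. If that were nontrivial, $S$
would fix a nontrivial element of it, which would then be fixed by $TS=F$. -/
theorem smul_eq_one_of_isPGroup_quotient {F Q : Type*} [Group F] [Finite F] [Group Q] [Finite Q]
    [MulDistribMulAction F Q] {q : ℕ} [Fact q.Prime] (hQ : IsPGroup q Q) (T : Subgroup F)
    [T.Normal] (hFT : ∀ x : F, ∃ k, x ^ q ^ k ∈ T) (hF : ∀ x : Q, (∀ f : F, f • x = x) → x = 1)
    (x : Q) (hx : ∀ t ∈ T, t • x = x) : x = 1 := by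
  let C : Subgroup Q := FixedPoints.subgroup T Q
  obtain ⟨S⟩ := (inferInstance : Nonempty (Sylow q F))
  let X : SubMulAction (S : Subgroup F) Q :=
    { carrier := C
      smul_mem' := by
        rintro ⟨s, hs⟩ y hy ⟨t, ht⟩
        have h1 := hy ⟨s⁻¹ * t * s, by simpa using ‹T.Normal›.conj_mem t ht s⁻¹⟩
        change (s⁻¹ * t * s) • y = y at h1
        change t • s • y = s • y
        rwa [mul_smul, mul_smul, inv_smul_eq_iff] at h1 }
  by_contra hx1
  have hC : Nontrivial C := ⟨⟨⟨x, fun t => hx t t.2⟩, 1, fun h => hx1 (congrArg Subtype.val h)⟩⟩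
  have hqC : q ∣ Nat.card X :=
    (hQ.to_subgroup C).card_eq_or_dvd.resolve_left (Finite.one_lt_card (α := C)).ne'
  obtain ⟨b, hb, hb1⟩ := S.2.exists_fixed_point_of_prime_dvd_card_of_fixed_point X hqC
    (a := ⟨1, one_mem C⟩) fun s => Subtype.ext (smul_one (s : F))
  refine hb1 (Subtype.ext (hF b fun f => ?_).symm)
  have hTS : ∀ f ∈ T ⊔ (S : Subgroup F), f • (b : Q) = b := by
    have : T ⊔ (S : Subgroup F) ≤ MulAction.stabilizer F (b : Q) :=
      sup_le (fun t ht => b.2 ⟨t, ht⟩) fun s hs => congrArg Subtype.val (hb ⟨s, hs⟩)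
    exact this
  refine hTS f ?_
  have htop : T ⊔ (S : Subgroup F) = ⊤ := by
    rw [← index_eq_one]
    by_contra h
    obtain ⟨p, hp, hpd⟩ := Nat.exists_prime_and_dvd h
    have h1 : p ∣ (S : Subgroup F).index := hpd.trans (index_dvd_of_le le_sup_right)
    have h2 : p ∣ T.index := hpd.trans (index_dvd_of_le le_sup_left)
    have h3 : IsPGroup q (F ⧸ T) := by
      intro y
      obtain ⟨g, rfl⟩ := QuotientGroup.mk_surjective y
      obtain ⟨k, hk⟩ := hFT g
      exact ⟨k, by rwa [← QuotientGroup.mk_pow, QuotientGroup.eq_one_iff]⟩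
    obtain ⟨k, hk⟩ := IsPGroup.iff_card.mp h3
    have h4 : p ∣ q ^ k := hk ▸ h2
    have h5 := (Nat.prime_dvd_prime_iff_eq hp Fact.out).mp (hp.dvd_of_dvd_pow h4)
    exact S.not_dvd_index (h5 ▸ h1)
  rw [htop]
  exact mem_top f

/-! ### Class sums and homogeneous components. -/

section ClassSum

variable {K Q V : Type*} [Field K] [Group Q] [Fintype Q] [AddCommGroup V] [Module K V]

/-- The sum of the operators of the conjugates of `x`. -/
def classSum (ρ : Q →* Module.End K V) (x : Q) : Module.End K V := ∑ g : Q, ρ (g * x * g⁻¹)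

theorem commute_classSum (ρ : Q →* Module.End K V) {φ : Module.End K V}
    (hφ : ∀ g, Commute φ (ρ g)) (x : Q) : Commute φ (classSum ρ x) :=
  Commute.sum_right _ _ _ fun _ _ => hφ _

theorem classSum_commute (ρ : Q →* Module.End K V) (g x : Q) : Commute (classSum ρ x) (ρ g) := by
  change classSum ρ x * ρ g = ρ g * classSum ρ x
  simp only [classSum, Finset.sum_mul, Finset.mul_sum, ← map_mul]
  refine Fintype.sum_bijective (g⁻¹ * ·) (Group.mulLeft_bijective g⁻¹) _ _ fun y => ?_
  congr 1
  group

/-- Maschke averaging turns a projection onto $\ker n$ into a $Q$-equivariant $\pi$ equal to $|Q|$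
on $\ker n$. It commutes with $n$, so $|Q|\,nv=\pi(nv)=n(\pi v)=0$. -/
theorem apply_eq_zero_of_apply_apply_eq_zero (hQ : (Nat.card Q : K) ≠ 0)
    (ρ : Q →* Module.End K V) {n : Module.End K V} (h1 : ∀ g, Commute n (ρ g))
    (h2 : ∀ φ : Module.End K V, (∀ g, Commute φ (ρ g)) → Commute φ n) {v : V}
    (hv : n (n v) = 0) : n v = 0 := by
  let U := LinearMap.ker n
  obtain ⟨p, hp⟩ := U.subtype.exists_leftInverse_of_injective U.ker_subtype
  let π₀ : Module.End K V := U.subtype ∘ₗ p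
  have hπ₀ : ∀ u ∈ U, π₀ u = u := fun u hu =>
    congrArg Subtype.val (LinearMap.congr_fun hp ⟨u, hu⟩)
  have hU : ∀ g, ∀ u ∈ U, ρ g u ∈ U := fun g u hu => by
    change n (ρ g u) = 0
    rw [← Module.End.mul_apply, (h1 g).eq, Module.End.mul_apply, LinearMap.mem_ker.mp hu, map_zero]
  let π : Module.End K V := ∑ g : Q, ρ g * π₀ * ρ g⁻¹
  have hπ : ∀ u ∈ U, π u = (Nat.card Q : K) • u := by
    intro u hu
    simp only [π, LinearMap.sum_apply, Module.End.mul_apply]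
    have h3 : ∀ g ∈ (Finset.univ : Finset Q), ρ g (π₀ (ρ g⁻¹ u)) = u := fun g _ => by
      rw [hπ₀ _ (hU _ u hu), ← Module.End.mul_apply, ← map_mul, mul_inv_cancel, map_one,
        Module.End.one_apply]
    rw [Finset.sum_congr rfl h3, Finset.sum_const, Finset.card_univ, Nat.card_eq_fintype_card,
      Nat.cast_smul_eq_nsmul]
  have hπU : ∀ w, π w ∈ U := fun w => by
    simp only [π, LinearMap.sum_apply, Module.End.mul_apply]
    exact sum_mem fun g _ => hU _ _ (p (ρ g⁻¹ w)).2
  have hπc : ∀ g, Commute π (ρ g) := by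
    intro g
    change π * ρ g = ρ g * π
    simp only [π, Finset.sum_mul, Finset.mul_sum]
    refine Fintype.sum_bijective (g⁻¹ * ·) (Group.mulLeft_bijective g⁻¹) _ _ fun y => ?_
    rw [mul_assoc, ← map_mul, ← mul_assoc, ← mul_assoc, ← map_mul, mul_inv_cancel_left,
      mul_inv_rev, inv_inv]
  have hc := h2 π hπc
  have h4 : π (n v) = 0 := by
    rw [← Module.End.mul_apply, hc.eq, Module.End.mul_apply]
    exact hπU v
  rw [hπ _ hv] at h4
  exact (smul_eq_zero.mp h4).resolve_left hQ

/-- Class sums commute with $Q$ and with every $Q$-endomorphism, so the preceding cancellation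
applies to their translates by scalars. Hence joint eigenspaces can replace characters in what
follows. -/
theorem maxGenEigenspace_classSum (hQ : (Nat.card Q : K) ≠ 0) (ρ : Q →* Module.End K V) (x : Q)
    (c : K) : (classSum ρ x).maxGenEigenspace c = (classSum ρ x).eigenspace c := by
  refine le_antisymm (fun v hv => ?_) (Module.End.genEigenspace_le_maximal _ _ _)
  obtain ⟨k, hk⟩ := (Module.End.mem_maxGenEigenspace _ _ _).mp hv
  have hstep : ∀ v, (classSum ρ x - c • 1) ((classSum ρ x - c • 1) v) = 0 →
      (classSum ρ x - c • 1) v = 0 := fun v =>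
    apply_eq_zero_of_apply_apply_eq_zero hQ ρ
      (fun g => (classSum_commute ρ g x).sub_left ((Commute.one_left _).smul_left c))
      fun φ hφ => (commute_classSum ρ hφ x).sub_right ((Commute.one_right _).smul_right c)
  rw [Module.End.mem_eigenspace_iff, ← sub_eq_zero]
  change (classSum ρ x - c • 1) v = 0
  clear hv
  induction k with
  | zero => rw [show v = 0 from hk, map_zero]
  | succ k ih =>
    by_cases hk0 : k = 0
    · subst hk0; simpa using hk
    · obtain ⟨m, rfl⟩ := Nat.exists_eq_succ_of_ne_zero hk0
      apply ih
      rw [pow_succ', Module.End.mul_apply]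
      apply hstep
      rwa [pow_succ', pow_succ', Module.End.mul_apply, Module.End.mul_apply] at hk

/-- The homogeneous component of a representation on which the class sums act as the scalars
`χ`. -/
def component (ρ : Q →* Module.End K V) (χ : Q → K) : Submodule K V :=
  ⨅ x, (classSum ρ x).eigenspace (χ x)

theorem mem_component {ρ : Q →* Module.End K V} {χ : Q → K} {v : V} :
    v ∈ component ρ χ ↔ ∀ x, classSum ρ x v = χ x • v := by
  simp [component]

theorem iSupIndep_component (hQ : (Nat.card Q : K) ≠ 0) (ρ : Q →* Module.End K V) :
    iSupIndep (component ρ) := by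
  have h := Module.End.independent_iInf_maxGenEigenspace_of_forall_mapsTo (classSum ρ)
    fun x y φ => Module.End.mapsTo_maxGenEigenspace_of_comm
      (commute_classSum ρ (fun g => classSum_commute ρ g y) x) φ
  simp only [maxGenEigenspace_classSum hQ] at h
  exact h

theorem iSup_component [IsAlgClosed K] [FiniteDimensional K V] (hQ : (Nat.card Q : K) ≠ 0)
    (ρ : Q →* Module.End K V) : ⨆ χ, component ρ χ = ⊤ := by
  have h := Module.End.iSup_iInf_maxGenEigenspace_eq_top_of_iSup_maxGenEigenspace_eq_top_of_commute
    (classSum ρ)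
    (fun x y _ => commute_classSum ρ (fun g => classSum_commute ρ g x) y)
    fun x => Module.End.iSup_maxGenEigenspace_eq_top _
  simp only [maxGenEigenspace_classSum hQ] at h
  exact h

theorem apply_mem_component {ρ : Q →* Module.End K V} {χ : Q → K} {v : V}
    (hv : v ∈ component ρ χ) (g : Q) : ρ g v ∈ component ρ χ := by
  rw [mem_component] at hv ⊢
  intro x
  rw [← Module.End.mul_apply, (classSum_commute ρ g x).eq, Module.End.mul_apply, hv, map_smul]

/-- All conjugates of $z$ act alike on the component, so there the class sum, a scalar, is $|Q|$
times the action of $z$. -/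
theorem exists_scalar_of_conj (hQ : (Nat.card Q : K) ≠ 0) {ρ : Q →* Module.End K V} {χ : Q → K}
    {z : Q} (hz : ∀ g, ∀ v ∈ component ρ χ, ρ (g * z * g⁻¹) v = ρ z v) :
    ∃ c : K, ∀ v ∈ component ρ χ, ρ z v = c • v := by
  refine ⟨(Nat.card Q : K)⁻¹ * χ z, fun v hv => ?_⟩
  have h1 := mem_component.mp hv z
  rw [classSum, LinearMap.sum_apply, Finset.sum_congr rfl fun g _ => hz g v hv, Finset.sum_const,
    Finset.card_univ, ← Nat.card_eq_fintype_card, ← Nat.cast_smul_eq_nsmul K] at h1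
  rw [mul_smul, ← h1, inv_smul_smul₀ hQ]

attribute [local instance] arrowAction

/-- Under `arrowAction`, $(a\cdot\chi)(x)=\chi(a^{-1}\cdot x)$, which matches how $\tau_a$
intertwines the class sums of $a^{-1}\cdot x$ and $x$. -/
theorem map_component_mem {A : Type*} [Group A] [MulDistribMulAction A Q]
    {ρ : Q →* Module.End K V} {τ : A →* Module.End K V}
    (h : ∀ a x v, τ a (ρ x v) = ρ (a • x) (τ a v)) {χ : Q → K} {v : V}
    (hv : v ∈ component ρ χ) (a : A) : τ a v ∈ component ρ (a • χ) := by
  rw [mem_component] at hv ⊢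
  intro x
  have h1 : classSum ρ x (τ a v) = τ a (classSum ρ (a⁻¹ • x) v) := by
    simp only [classSum, LinearMap.sum_apply, map_sum, h]
    refine (Fintype.sum_bijective (a • · : Q → Q) (MulAction.bijective a) _ _ fun y => ?_).symm
    simp only [smul_mul', smul_inv', smul_inv_smul]
  rw [h1, hv, map_smul]
  rfl

end ClassSum

/-! ### Counting fixed points in Frobenius actions. -/

section Orbits
open MulAction

/-- In an action of a finite group where every nontrivial element has exactly one fixed point, at
most one point has a nontrivial stabilizer. -/
theorem eq_of_smul_eq_of_unique_fixed {G X : Type*} [Group G] [Finite G] [Finite X]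
    [MulAction G X] (h1 : ∀ g : G, g ≠ 1 → ∃ x : X, g • x = x)
    (h2 : ∀ g : G, g ≠ 1 → ∀ x y : X, g • x = x → g • y = y → x = y)
    {g : G} (hg : g ≠ 1) {x y : X} (hx : g • x = x) {h : G} (hh : h ≠ 1) (hy : h • y = y) :
    x = y := by
  classical
  have : Fintype G := Fintype.ofFinite G
  have : Fintype X := Fintype.ofFinite X
  have : Fintype (Quotient (orbitRel G X)) := Fintype.ofFinite _
  let f : Quotient (orbitRel G X) → ℕ := fun ω => Fintype.card (orbitRel.Quotient.orbit ω)
  have hf : ∀ z : X, f (Quotient.mk'' z) = Fintype.card (orbit G z) := fun z =>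
    Fintype.card_congr (Equiv.setCongr (orbitRel.Quotient.orbit_mk z))
  have hfc : ∀ z : X, f (Quotient.mk'' z) * Fintype.card (stabilizer G z) = Fintype.card G :=
    fun z => by rw [hf, card_orbit_mul_card_stabilizer_eq_card_group]
  have hsum : Fintype.card X = ∑ ω, f ω := by
    rw [Fintype.card_congr (selfEquivSigmaOrbits' G X), Fintype.card_sigma]
  have hburn := sum_card_fixedBy_eq_card_orbits_mul_card_group G X
  have h3 : ∑ g : G, Fintype.card (fixedBy X g) = Fintype.card X + (Fintype.card G - 1) := by
    rw [← Finset.add_sum_erase _ _ (Finset.mem_univ (1 : G))]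
    congr 1
    · exact Fintype.card_congr ((Equiv.setCongr (fixedBy_one_eq_univ X G)).trans
        (Equiv.Set.univ X))
    · rw [Finset.sum_congr rfl (g := fun _ => 1), Finset.sum_const, smul_eq_mul, mul_one,
        Finset.card_erase_of_mem (Finset.mem_univ _), Finset.card_univ]
      intro g hg
      have hg1 := Finset.ne_of_mem_erase hg
      obtain ⟨z, hz⟩ := h1 g hg1
      exact Fintype.card_eq_one_iff.mpr ⟨⟨z, hz⟩, fun w => Subtype.ext (h2 g hg1 _ _ w.2 hz)⟩
  have hle : ∀ ω, f ω ≤ Fintype.card G := by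
    intro ω
    induction ω using Quotient.inductionOn' with
    | _ z =>
      rw [← hfc z]
      exact Nat.le_mul_of_pos_right _ Fintype.card_pos
  -- Burnside's count, with one fixed point per nontrivial element. A nonregular orbit contributes
  -- at least $|G|/2$, so two of them would exceed the total, and a single one must have defect
  -- $|G|-1$, that is, be a single point.
  have hdef : ∑ ω, (Fintype.card G - f ω) = Fintype.card G - 1 := by
    have h4 : ∑ ω, (Fintype.card G - f ω) + ∑ ω, f ω
        = Fintype.card (Quotient (orbitRel G X)) * Fintype.card G := by
      rw [← Finset.sum_add_distrib, Finset.sum_congr rfl fun ω _ => Nat.sub_add_cancel (hle ω)]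
      simp
    rw [h3, hsum] at hburn
    omega
  have hpos : 0 < Fintype.card G := Fintype.card_pos
  have hbig : ∀ ω, f ω ≠ Fintype.card G → Fintype.card G ≤ 2 * (Fintype.card G - f ω) := by
    intro ω
    induction ω using Quotient.inductionOn' with
    | _ z =>
      intro hne
      have h5 := hfc z
      have h6 : 2 ≤ Fintype.card (stabilizer G z) := by
        have : 0 < Fintype.card (stabilizer G z) := Fintype.card_pos
        by_contra h
        have : Fintype.card (stabilizer G z) = 1 := by omega
        rw [this, mul_one] at h5
        exact hne h5
      have h7 := Nat.mul_le_mul_left (f (Quotient.mk'' z)) h6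
      omega
  have hne : ∀ (z : X) (k : G), k ≠ 1 → k • z = z → f (Quotient.mk'' z) ≠ Fintype.card G := by
    intro z k hk hkz he
    have h5 := hfc z
    rw [he] at h5
    have h6 : Fintype.card (stabilizer G z) = 1 := Nat.eq_of_mul_eq_mul_left hpos (by omega)
    obtain ⟨a, ha⟩ := Fintype.card_eq_one_iff.mp h6
    have h7 := congrArg Subtype.val ((ha ⟨k, hkz⟩).trans (ha 1).symm)
    exact hk h7
  have honly : ∀ ω, ω ≠ Quotient.mk'' x → f ω = Fintype.card G := by
    intro ω hω
    by_contra hc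
    have h5 := hbig ω hc
    have h6 := hbig _ (hne x g hg hx)
    have h7 : (Fintype.card G - f ω) + (Fintype.card G - f (Quotient.mk'' x))
        ≤ ∑ ω, (Fintype.card G - f ω) := by
      rw [← Finset.sum_pair (f := fun ω => Fintype.card G - f ω) hω]
      exact Finset.sum_le_sum_of_subset (Finset.subset_univ _)
    omega
  have hxy : (Quotient.mk'' y : Quotient (orbitRel G X)) = Quotient.mk'' x := by
    by_contra hc
    exact hne y h hh hy (honly _ hc)
  have hsingle : f (Quotient.mk'' x) = 1 := by
    have h5 := Fintype.sum_eq_single (f := fun ω => Fintype.card G - f ω) (Quotient.mk'' x)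
      fun ω hω => by rw [honly ω hω, Nat.sub_self]
    rw [hdef] at h5
    have h6 := hle (Quotient.mk'' x)
    have h7 : 0 < f (Quotient.mk'' x) := by
      rw [hf]
      exact Fintype.card_pos_iff.mpr ⟨⟨x, mem_orbit_self x⟩⟩
    have h5' : Fintype.card G - 1 = Fintype.card G - f (Quotient.mk'' x) := h5
    omega
  rw [hf] at hsingle
  obtain ⟨a, ha⟩ := Fintype.card_eq_one_iff.mp hsingle
  have hy' : y ∈ orbit G x := Quotient.exact hxy
  exact congrArg Subtype.val ((ha ⟨x, mem_orbit_self x⟩).trans (ha ⟨y, hy'⟩).symm)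

/-- A finite Frobenius group `TH` acting on a set: in each `T`-orbit at most one point is fixed by
a nontrivial element of `H`. -/
theorem eq_of_smul_eq_of_mem_orbit {A Ω : Type*} [Group A] [Finite A] [MulAction A Ω]
    {T H : Subgroup A} [T.Normal]
    (hfree : ∀ h ∈ H, h ≠ 1 → ∀ t ∈ T, t ≠ 1 → h * t * h⁻¹ ≠ t) {θ μ ν : Ω}
    (hμ : μ ∈ orbit T θ) (hν : ν ∈ orbit T θ) {g h : A} (hg : g ∈ H) (hg1 : g ≠ 1)
    (hgμ : g • μ = μ) (hh : h ∈ H) (hh1 : h ≠ 1) (hhν : h • ν = ν) : μ = ν := by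
  have hinj : ∀ h ∈ H, h ≠ 1 → ∀ s ∈ T, ∀ t ∈ T,
      s⁻¹ * (h * s * h⁻¹) = t⁻¹ * (h * t * h⁻¹) → s = t := by
    intro h hh hh1 s hs t ht hst
    by_contra hne
    refine hfree h hh hh1 (t * s⁻¹) (mul_mem ht (inv_mem hs)) (fun hc => hne ?_) ?_
    · exact (mul_inv_eq_one.mp hc).symm
    · have h1 : h * t * h⁻¹ = t * (s⁻¹ * (h * s * h⁻¹)) := by rw [hst, mul_inv_cancel_left]
      calc h * (t * s⁻¹) * h⁻¹ = (h * t * h⁻¹) * (h * s * h⁻¹)⁻¹ := by group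
        _ = t * s⁻¹ := by rw [h1]; group
  have hsurj : ∀ h ∈ H, h ≠ 1 → ∀ U : Subgroup A, U ≤ T → (∀ u ∈ U, h * u * h⁻¹ ∈ U) →
      ∀ u ∈ U, ∃ s ∈ U, s⁻¹ * (h * s * h⁻¹) = u := by
    intro h hh hh1 U hUT hU u hu
    let φ : U → U := fun s => ⟨(s : A)⁻¹ * (h * s * h⁻¹), mul_mem (inv_mem s.2) (hU _ s.2)⟩
    have hφ : Function.Injective φ := fun s t hst =>
      Subtype.ext (hinj h hh hh1 _ (hUT s.2) _ (hUT t.2) (congrArg Subtype.val hst))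
    obtain ⟨s, hs⟩ := Finite.surjective_of_injective hφ ⟨u, hu⟩
    exact ⟨s, s.2, congrArg Subtype.val hs⟩
  have huniq : ∀ h ∈ H, h ≠ 1 → ∀ a : Ω, h • a = a → ∀ t ∈ T, h • t • a = t • a →
      t • a = a := by
    intro h hh hh1 a ha t ht hta
    let U := stabilizer A a ⊓ T
    have h1 : t⁻¹ * (h * t * h⁻¹) ∈ U := by
      refine mem_inf.mpr ⟨?_, mul_mem (inv_mem ht) (‹T.Normal›.conj_mem t ht h)⟩
      rw [mem_stabilizer_iff, mul_smul, mul_smul, mul_smul, inv_smul_eq_iff.mpr ha.symm, hta,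
        inv_smul_smul]
    have h2 : ∀ u ∈ U, h * u * h⁻¹ ∈ U := by
      intro u hu
      refine mem_inf.mpr ⟨?_, ‹T.Normal›.conj_mem u hu.2 h⟩
      rw [mem_stabilizer_iff, mul_smul, mul_smul, inv_smul_eq_iff.mpr ha.symm,
        mem_stabilizer_iff.mp hu.1, ha]
    obtain ⟨s, hs, hst⟩ := hsurj h hh hh1 U inf_le_right h2 _ h1
    rw [hinj h hh hh1 t ht s hs.2 hst.symm]
    exact hs.1
  have hex : ∀ h ∈ H, h ≠ 1 → ∀ a : Ω, ∀ t ∈ T, h • a = t • a →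
      ∃ s ∈ T, h • s • a = s • a := by
    intro h hh hh1 a t ht hta
    obtain ⟨s, hs, hst⟩ := hsurj h hh hh1 T le_rfl (fun u hu => ‹T.Normal›.conj_mem u hu h) t⁻¹
      (inv_mem ht)
    refine ⟨s, hs, ?_⟩
    rw [← mul_smul, show h * s = (h * s * h⁻¹) * h by group, mul_smul, hta, ← mul_smul,
      eq_mul_of_inv_mul_eq hst, inv_mul_cancel_right]
  let X : Set Ω := orbit T θ
  -- Only the part of $H$ preserving the $T$-orbit acts on it. An element fixing one point of the
  -- orbit preserves the orbit, since $T$ is normal.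
  let G : Subgroup (stabilizer A X) := H.subgroupOf (stabilizer A X)
  have hXfin : X.Finite := Set.finite_range _
  have : Finite X := hXfin
  have hmem : ∀ a ∈ X, ∀ t ∈ T, t • a ∈ X := fun a ha t ht =>
    mem_orbit_of_mem_orbit (⟨t, ht⟩ : T) ha
  have hmem' : ∀ a ∈ X, ∀ b ∈ X, ∃ t ∈ T, t • a = b := by
    intro a ha b hb
    have h1 : b ∈ orbit T a := by rwa [orbit_eq_iff.mpr ha]
    obtain ⟨t, ht⟩ := h1
    exact ⟨t, t.2, ht⟩
  have hstab : ∀ h : A, ∀ a ∈ X, h • a = a → h ∈ stabilizer A X := by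
    intro h a ha hha
    rw [mem_stabilizer_set' hXfin]
    intro b hb
    obtain ⟨t, ht, rfl⟩ := hmem' a ha b hb
    rw [← mul_smul, show h * t = (h * t * h⁻¹) * h by group, mul_smul, hha]
    exact hmem a ha _ (‹T.Normal›.conj_mem t ht h)
  have hne : ∀ k : G, k ≠ 1 → ((k : stabilizer A X) : A) ≠ 1 := fun k hk h1 =>
    hk (Subtype.ext (Subtype.ext h1))
  have h1 : ∀ k : G, k ≠ 1 → ∃ x : X, k • x = x := by
    intro k hk
    obtain ⟨t, ht, hta⟩ := hmem' θ (mem_orbit_self θ) (((k : stabilizer A X) : A) • θ)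
      ((mem_stabilizer_set.mp (k : stabilizer A X).2 θ).mpr (mem_orbit_self θ))
    obtain ⟨s, hs, hsa⟩ := hex _ k.2 (hne k hk) θ t ht hta.symm
    exact ⟨⟨s • θ, hmem θ (mem_orbit_self θ) s hs⟩, Subtype.ext hsa⟩
  have h2 : ∀ k : G, k ≠ 1 → ∀ x y : X, k • x = x → k • y = y → x = y := by
    intro k hk x y hx hy
    obtain ⟨t, ht, hta⟩ := hmem' x x.2 y y.2
    have hx' : ((k : stabilizer A X) : A) • (x : Ω) = x := congrArg Subtype.val hx
    have hy' : ((k : stabilizer A X) : A) • (y : Ω) = y := congrArg Subtype.val hy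
    rw [← hta] at hy'
    exact Subtype.ext ((huniq _ k.2 (hne k hk) _ hx' t ht hy').symm.trans hta)
  have h3 := eq_of_smul_eq_of_unique_fixed h1 h2
    (g := ⟨⟨g, hstab g μ hμ hgμ⟩, hg⟩) (fun hc => hg1 (congrArg (fun k : G => (k.1 : A)) hc))
    (x := ⟨μ, hμ⟩) (Subtype.ext hgμ)
    (h := ⟨⟨h, hstab h ν hν hhν⟩, hh⟩) (fun hc => hh1 (congrArg (fun k : G => (k.1 : A)) hc))
    (y := ⟨ν, hν⟩) (Subtype.ext hhν)
  exact congrArg Subtype.val h3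

end Orbits

/-! ### Triviality of $x$ on each component. -/

/-- Take $z$ in $\gamma_m(Q)\cap K$ outside $N$ at the last stage of the lower central series where
this intersection is not inside $N$. Commutators with $z$ fall into the next stage. -/
theorem IsPGroup.exists_central_mod {q : ℕ} [Fact q.Prime] {Q : Type*} [Group Q] [Finite Q]
    (hQ : IsPGroup q Q) {K N : Subgroup Q} [K.Normal] (h : ¬ K ≤ N) :
    ∃ z ∈ K, z ∉ N ∧ ∀ g, ⁅z, g⁆ ∈ N := by
  classical
  have hn := (hQ.to_subgroup ⊤).isNilpotent
  obtain ⟨n, hn⟩ := (Subgroup.isNilpotent_iff_lowerCentralSeries (S := (⊤ : Subgroup Q))).mp hn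
  have hex : ∃ n, (⊤ : Subgroup Q).lowerCentralSeries n ⊓ K ≤ N := ⟨n, by simp [hn]⟩
  obtain ⟨m, hm⟩ : ∃ m, Nat.find hex = m + 1 := Nat.exists_eq_succ_of_ne_zero fun h0 =>
    h (by simpa [h0] using Nat.find_spec hex)
  have hspec := Nat.find_spec hex
  rw [hm] at hspec
  obtain ⟨z, hz, hzN⟩ := SetLike.not_le_iff_exists.mp
    (Nat.find_min hex (m := m) (by omega))
  refine ⟨z, hz.2, hzN, fun g => hspec (mem_inf.mpr ⟨?_, ?_⟩)⟩
  · rw [Subgroup.lowerCentralSeries_succ]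
    exact commutator_mem_commutator hz.1 (mem_top g)
  · rw [commutatorElement_def, mul_assoc, mul_assoc, ← mul_assoc g]
    exact mul_mem hz.2 (‹K.Normal›.conj_mem _ (inv_mem hz.2) g)

theorem conj_apply_eq_of_forall {K Q V A : Type*} [Field K] [Group Q] [AddCommGroup V] [Module K V]
    [Group A] [MulDistribMulAction A Q] {ρ : Q →* Module.End K V} {τ : A →* Module.End K V}
    (hτ : ∀ a x v, τ a (ρ x v) = ρ (a • x) (τ a v)) (a : A) (x : Q) (v : V) :
    ρ (a • x) v = τ a (ρ x (τ a⁻¹ v)) := by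
  rw [hτ, ← Module.End.mul_apply (τ a), ← map_mul, mul_inv_cancel, map_one, Module.End.one_apply]

section
open MulAction
attribute [local instance] arrowAction

variable {K Q V : Type*} [Field K] [Group Q] [Fintype Q] [AddCommGroup V] [Module K V]

/-- The elements acting trivially on the homogeneous components belonging to a set `S`. -/
def componentKernel (ρ : Q →* Module.End K V) (S : Set (Q → K)) : Subgroup Q where
  carrier := {y | ∀ μ ∈ S, ∀ v ∈ component ρ μ, ρ y v = v}
  one_mem' := fun _ _ _ _ => by simp
  mul_mem' := fun {x y} hx hy μ hμ v hv => by
    rw [map_mul, Module.End.mul_apply, hy μ hμ v hv, hx μ hμ v hv]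
  inv_mem' := fun {x} hx μ hμ v hv => by
    conv_lhs => rw [← hx μ hμ v hv]
    rw [← Module.End.mul_apply, ← map_mul, inv_mul_cancel, map_one, Module.End.one_apply]

theorem componentKernel_normal (ρ : Q →* Module.End K V) (S : Set (Q → K)) :
    (componentKernel ρ S).Normal where
  conj_mem y hy g μ hμ v hv := by
    rw [map_mul, map_mul, Module.End.mul_apply, Module.End.mul_apply,
      hy μ hμ _ (apply_mem_component hv g⁻¹), ← Module.End.mul_apply, ← map_mul, mul_inv_cancel,
      map_one, Module.End.one_apply]

theorem apply_eq_of_mul_inv_mem {ρ : Q →* Module.End K V} {S : Set (Q → K)} {a b : Q}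
    (h : a * b⁻¹ ∈ componentKernel ρ S) {μ : Q → K} (hμ : μ ∈ S) {v : V}
    (hv : v ∈ component ρ μ) : ρ a v = ρ b v := by
  have h1 := h μ hμ (ρ b v) (apply_mem_component hv b)
  rwa [← Module.End.mul_apply, ← map_mul, inv_mul_cancel_right] at h1

theorem eq_one_of_pow_eq_one_of_coprime {M : Type*} [Monoid M] {c : M} {m n : ℕ}
    (h : m.Coprime n) (hm : c ^ m = 1) (hn : c ^ n = 1) : c = 1 :=
  orderOf_eq_one_iff.mp
    (Nat.eq_one_of_dvd_coprimes h (orderOf_dvd_of_pow_eq_one hm) (orderOf_dvd_of_pow_eq_one hn))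

variable {A : Type*} [Group A] [MulDistribMulAction A Q] {ρ : Q →* Module.End K V}
  {τ : A →* Module.End K V}

/-- The vectors $\tau_hv$ lie in distinct, hence independent, components, each preserved by $x$. A
sum fixed by $x$ has each summand fixed, in particular the one for $h=1$. -/
theorem apply_eq_of_trivial_stabilizer (hQ1 : (Nat.card Q : K) ≠ 0)
    (hτ : ∀ a x v, τ a (ρ x v) = ρ (a • x) (τ a v)) {H : Subgroup A} [Fintype H] {x : Q}
    (hx : ∀ v, ρ x (∑ h : H, τ h v) = ∑ h : H, τ h v) {θ : Q → K}
    (hθ : ∀ h ∈ H, h • θ = θ → h = 1) {v : V} (hv : v ∈ component ρ θ) : ρ x v = v := by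
  have hinj : Function.Injective fun h : H => (h : A) • θ := by
    intro g h hgh
    have h1 : ((h : A)⁻¹ * g) • θ = θ := by
      rw [mul_smul, inv_smul_eq_iff]
      exact hgh
    exact Subtype.ext (inv_mul_eq_one.mp (hθ _ (mul_mem (inv_mem h.2) g.2) h1)).symm
  have hind := (iSupIndep_component hQ1 ρ).comp hinj
  rw [iSupIndep_iff_finsetSum_eq_zero_imp_eq_zero] at hind
  have h1 := hind Finset.univ (fun h : H => ρ x (τ h v) - τ h v)
    (fun h _ => sub_mem (apply_mem_component (map_component_mem hτ hv (h : A)) x)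
      (map_component_mem hτ hv (h : A)))
    (by rw [Finset.sum_sub_distrib, ← map_sum, hx, sub_self]) 1 (Finset.mem_univ _)
  simpa [sub_eq_zero] using h1

/-- If `x` fixes all components in the `T`-orbit of `θ` other than `θ` itself, and every element
of `Q` fixed by `T` modulo an invariant normal subgroup `N` lies in `N`, then `x` also fixes the
component of `θ`. -/
theorem apply_eq_of_orbit (hQ1 : (Nat.card Q : K) ≠ 0) {q : ℕ} [Fact q.Prime] (hQ : IsPGroup q Q)
    (hτ : ∀ a x v, τ a (ρ x v) = ρ (a • x) (τ a v)) (T : Subgroup A) [Fintype T]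
    (hcop : (Nat.card T).Coprime q)
    (hT : ∀ N : Subgroup Q, N.Normal → (∀ t ∈ T, ∀ x ∈ N, t • x ∈ N) →
      ∀ y, (∀ t ∈ T, y⁻¹ * (t • y) ∈ N) → y ∈ N) (θ : Q → K) {x : Q}
    (hx : x ∈ componentKernel ρ (orbit T θ \ {θ})) : x ∈ componentKernel ρ (orbit T θ) := by
  classical
  set O : Set (Q → K) := orbit T θ
  set N := componentKernel ρ O
  have hNn : N.Normal := componentKernel_normal ρ _
  have hOT : ∀ t ∈ T, ∀ μ ∈ O, t • μ ∈ O := fun t ht μ hμ =>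
    mem_orbit_of_mem_orbit (⟨t, ht⟩ : T) hμ
  have hKn : (componentKernel ρ (O \ {θ})).Normal := componentKernel_normal ρ _
  by_contra hxN
  obtain ⟨z, hzK, hzN, hz⟩ := hQ.exists_central_mod (K := componentKernel ρ (O \ {θ})) (N := N)
    fun h => hxN (h hx)
  have hθO : θ ∈ O := mem_orbit_self θ
  obtain ⟨c, hc⟩ : ∃ c : K, ∀ v ∈ component ρ θ, ρ z v = c • v := by
    refine exists_scalar_of_conj hQ1 fun g v hv => apply_eq_of_mul_inv_mem (S := O) ?_ hθO hv
    have h1 := inv_mem (hz g)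
    rwa [commutatorElement_inv, commutatorElement_def] at h1
  -- The scalar by which $w=\prod_t t\cdot z$ acts on the component $\mu$ of the orbit. It is
  -- constant along $T$-orbits, so $w$ is $T$-fixed modulo $N$ and `hT` puts it in $N$.
  let s : (Q → K) → K := fun μ => ∏ t : T, if (t : A) • θ = μ then c else 1
  have hs : ∀ a ∈ T, ∀ μ, s (a • μ) = s μ := by
    intro a ha μ
    refine (Fintype.prod_bijective ((⟨a, ha⟩ : T) * ·) (Group.mulLeft_bijective _) _ _
      fun t => ?_).symm
    simp only [coe_mul, mul_smul, smul_left_cancel_iff]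
  have hzt : ∀ t ∈ T, ∀ μ ∈ O, ∀ v ∈ component ρ μ,
      ρ (t • z) v = (if t • θ = μ then c else 1) • v := by
    intro t ht μ hμ v hv
    have h1 := map_component_mem hτ hv t⁻¹
    rw [conj_apply_eq_of_forall hτ]
    have h2 : τ t (τ t⁻¹ v) = v := by
      rw [← Module.End.mul_apply, ← map_mul, mul_inv_cancel, map_one, Module.End.one_apply]
    split_ifs with h
    · rw [← h, inv_smul_smul] at h1
      rw [hc _ h1, map_smul, h2]
    · rw [hzK (t⁻¹ • μ) ⟨hOT _ (inv_mem ht) _ hμ, fun hc' => h (inv_smul_eq_iff.mp hc').symm⟩ _ h1,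
        h2, one_smul]
  let w : Q := ((Finset.univ : Finset T).toList.map fun t : T => (t : A) • z).prod
  have hw : ∀ μ ∈ O, ∀ v ∈ component ρ μ, ρ w v = s μ • v := by
    intro μ hμ v hv
    have h1 : ∀ l : List T, ρ (l.map fun t : T => (t : A) • z).prod v
        = (l.map fun t : T => if (t : A) • θ = μ then c else 1).prod • v := by
      intro l
      induction l with
      | nil => simp
      | cons t l ih =>
        rw [List.map_cons, List.prod_cons, List.map_cons, List.prod_cons, map_mul,
          Module.End.mul_apply, ih, map_smul, hzt t t.2 μ hμ v hv, smul_smul, mul_comm]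
    rw [h1]
    congr 1
    exact Finset.prod_map_toList _ _
  have hwN : w ∈ N := by
    refine hT N hNn (fun t ht y hy μ hμ v hv => ?_) w fun t ht => ?_
    · rw [conj_apply_eq_of_forall hτ, hy _ (hOT _ (inv_mem ht) _ hμ) _ (map_component_mem hτ hv t⁻¹),
        ← Module.End.mul_apply, ← map_mul, mul_inv_cancel, map_one, Module.End.one_apply]
    · intro μ hμ v hv
      rw [map_mul, Module.End.mul_apply, conj_apply_eq_of_forall hτ,
        hw _ (hOT _ (inv_mem ht) _ hμ) _ (map_component_mem hτ hv t⁻¹), hs _ (inv_mem ht), map_smul,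
        ← Module.End.mul_apply, ← map_mul, mul_inv_cancel, map_one, Module.End.one_apply,
        ← hw μ hμ v hv, ← Module.End.mul_apply, ← map_mul, inv_mul_cancel, map_one,
        Module.End.one_apply]
  refine hzN fun μ hμ v hv => ?_
  by_cases hμθ : μ = θ
  swap
  · exact hzK μ ⟨hμ, hμθ⟩ v hv
  subst hμθ
  by_cases hv0 : v = 0
  · rw [hv0, map_zero]
  have hone : ∀ d : K, d • v = v → d = 1 := fun d hd =>
    smul_left_injective K hv0 (hd.trans (one_smul K v).symm)
  have h1 : s μ = 1 := hone _ ((hw μ hμ v hv).symm.trans (hwN μ hμ v hv))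
  -- Exactly the $t$ stabilizing $\mu$ contribute a factor $c$. Their number is prime to $q$, while
  -- $c$ has $q$-power order because $z$ does.
  have h2 : s μ = c ^ Nat.card (stabilizer T μ) := by
    simp only [s, Finset.prod_ite, Finset.prod_const_one, mul_one, Finset.prod_const]
    congr 1
    rw [Nat.card_eq_fintype_card, ← Fintype.card_subtype]
    rfl
  obtain ⟨k, hk⟩ := hQ z
  have h3 : c ^ q ^ k = 1 := by
    apply hone
    have h4 : ∀ n : ℕ, ρ (z ^ n) v = c ^ n • v := by
      intro n
      induction n with
      | zero => simp
      | succ n ih => rw [pow_succ', map_mul, Module.End.mul_apply, ih, map_smul, hc v hv, smul_smul,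
          pow_succ]
    rw [← h4, hk, map_one, Module.End.one_apply]
  have h5 : c = 1 := eq_one_of_pow_eq_one_of_coprime
    ((hcop.coprime_dvd_left (card_subgroup_dvd_card (stabilizer T μ))).pow_right k)
    (h2 ▸ h1) h3
  rw [hc v hv, h5, one_smul]

/-- If a component has nontrivial stabilizer in $H$, every other component of its $T$-orbit has
trivial stabilizer, so $x$ fixes those pointwise and `apply_eq_of_orbit` supplies the remaining one.
-/
theorem eq_one_of_apply_sum [IsAlgClosed K] [FiniteDimensional K V] [Finite A]
    (hQ1 : (Nat.card Q : K) ≠ 0) {q : ℕ} [Fact q.Prime] (hQ : IsPGroup q Q)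
    (hτ : ∀ a x v, τ a (ρ x v) = ρ (a • x) (τ a v)) (T H : Subgroup A) [T.Normal] [Fintype H]
    (hcop : (Nat.card T).Coprime q)
    (hT : ∀ N : Subgroup Q, N.Normal → (∀ t ∈ T, ∀ x ∈ N, t • x ∈ N) →
      ∀ y, (∀ t ∈ T, y⁻¹ * (t • y) ∈ N) → y ∈ N)
    (hfree : ∀ h ∈ H, h ≠ 1 → ∀ t ∈ T, t ≠ 1 → h * t * h⁻¹ ≠ t) {x : Q}
    (hx : ∀ v, ρ x (∑ h : H, τ h v) = ∑ h : H, τ h v) : ρ x = 1 := by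
  have : Fintype T := Fintype.ofFinite T
  have hcomp : ∀ θ, component ρ θ ≤ LinearMap.eqLocus (ρ x) 1 := by
    intro θ v hv
    by_cases hθ : ∀ h ∈ H, h • θ = θ → h = 1
    · exact apply_eq_of_trivial_stabilizer hQ1 hτ hx hθ hv
    push Not at hθ
    obtain ⟨g, hg, hgθ, hg1⟩ := hθ
    refine apply_eq_of_orbit hQ1 hQ hτ T hcop hT θ (x := x) ?_ θ (mem_orbit_self θ) v hv
    rintro μ ⟨hμ, hμθ⟩ u hu
    refine apply_eq_of_trivial_stabilizer hQ1 hτ hx (fun h hh hhμ => ?_) hu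
    by_contra hh1
    exact hμθ (eq_of_smul_eq_of_mem_orbit hfree hμ (mem_orbit_self θ) hh hh1 hhμ hg hg1 hgθ)
  have htop := iSup_le hcomp
  rw [iSup_component hQ1] at htop
  exact LinearMap.ext fun v => htop (Submodule.mem_top (x := v))

end

/-! ### Frobenius kernels and the conclusion. -/

/-- The kernel of a finite Frobenius group is nilpotent. -/
theorem IsFrobeniusGroup.isNilpotent {A : Type*} [Group A] {F H : Subgroup A}
    (hFH : IsFrobeniusGroup F H) : Group.IsNilpotent F := by
  have := hFH.finite
  have := hFH.normal
  have hH : Nat.card H ≠ 1 := fun h => hFH.complement_ne_bot (card_eq_one.mp h)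
  obtain ⟨r, hr, hrd⟩ := Nat.exists_prime_and_dvd hH
  have : Fact r.Prime := ⟨hr⟩
  obtain ⟨h, hh⟩ := exists_prime_orderOf_dvd_card' r hrd
  have hh1 : (h : A) ≠ 1 := fun h1 => by
    rw [show h = 1 from Subtype.ext h1, orderOf_one] at hh
    exact hr.one_lt.ne hh
  have hit : ∀ (n : ℕ) (f : F),
      (((MulAut.conjNormal (h : A)).toMonoidHom : F → F)^[n] f : A)
        = (h : A) ^ n * f * ((h : A) ^ n)⁻¹ := by
    intro n f
    induction n with
    | zero => simp
    | succ n ih =>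
      rw [Function.iterate_succ_apply']
      change (MulAut.conjNormal (h : A) _ : A) = _
      rw [MulAut.conjNormal_apply, ih, pow_succ']
      group
  -- Conjugation by an element of prime order $r$ of the complement is fixed-point-free on $F$.
  refine isNilpotent_of_fixedPointFree hr _ F rfl (MulAut.conjNormal (h : A)).toMonoidHom
    (fun f => Subtype.ext ?_) fun f hf => ?_
  · have h1 : (h : A) ^ r = 1 := by
      rw [← coe_pow, ← hh, pow_orderOf_eq_one, coe_one]
    rw [hit, h1]
    simp
  · by_contra hf1
    refine hFH.fixedPointFree h h.2 hh1 f f.2 (fun hc => hf1 (Subtype.ext hc)) ?_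
    have := congrArg (Subtype.val : F → A) hf
    rwa [MulEquiv.toMonoidHom_eq_coe, MonoidHom.coe_coe, MulAut.conjNormal_apply] at this

/-- If the Frobenius kernel `F` acts on the `q`-group `Q` without nontrivial fixed points, then so
does its `q'`-part `T`, even modulo invariant normal subgroups. -/
theorem IsFrobeniusGroup.exists_coprime_kernel {A Q : Type*} [Group A] [Group Q] [Finite Q]
    [MulDistribMulAction A Q] {F H : Subgroup A} (hFH : IsFrobeniusGroup F H) {q : ℕ}
    [Fact q.Prime] (hQ : IsPGroup q Q) (hF : FixedPoints.subgroup F Q = ⊥) :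
    ∃ T : Subgroup A, T.Normal ∧ T ≤ F ∧ (Nat.card T).Coprime q ∧
      ∀ N : Subgroup Q, N.Normal → (∀ t ∈ T, ∀ x ∈ N, t • x ∈ N) →
        ∀ y, (∀ t ∈ T, y⁻¹ * (t • y) ∈ N) → y ∈ N := by
  have := hFH.finite
  have hnil := hFH.isNilpotent
  obtain ⟨T₀, hT₀, hcop, hpow⟩ := IsPNilpotent.of_isNilpotent hnil q
  have hcard : (Nat.card T₀).Coprime q := by
    rw [Nat.coprime_comm, (Fact.out : q.Prime).coprime_iff_not_dvd]
    intro hd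
    obtain ⟨t, ht⟩ := exists_prime_orderOf_dvd_card' q hd
    have h1 := hcop t t.2
    rw [orderOf_coe, ht, Nat.coprime_self] at h1
    exact (Fact.out : q.Prime).one_lt.ne' h1
  refine ⟨T₀.map F.subtype, ⟨?_⟩, map_subtype_le _, ?_, ?_⟩
  · rintro _ ⟨t, ht, rfl⟩ a
    obtain ⟨k, hk⟩ := hpow ⟨a * t * a⁻¹, hFH.normal.conj_mem t t.2 a⟩
    refine ⟨_, mem_of_coprime_of_pow_mem ?_ hk, rfl⟩
    have h1 : orderOf (a * t * a⁻¹ : A) = orderOf t := by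
      rw [← orderOf_coe t]
      exact orderOf_injective (MulAut.conj a).toMonoidHom (MulAut.conj a).injective (t : A)
    rw [← orderOf_coe]
    change (orderOf (a * t * a⁻¹ : A)).Coprime q
    rw [h1]
    exact hcop t ht
  · rwa [card_map_of_injective F.subtype_injective]
  · intro N _ hN y hy
    -- A coset fixed modulo $N$ contains a $T_0$-fixed element. That element is trivial because
    -- $C_Q(T_0)=1$, so the coset is $N$ itself.
    obtain ⟨x, hx, hfix⟩ := exists_fixed_of_coprime (T := T₀)
      inferInstance hQ hcard N
      (fun t x hx => hN t ⟨t, t.2, rfl⟩ x hx) y (fun t => hy t ⟨t, t.2, rfl⟩)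
    have hx1 : x = 1 := by
      refine smul_eq_one_of_isPGroup_quotient hQ T₀ hpow (fun z hz => ?_) x
        fun t ht => hfix ⟨t, ht⟩
      rw [← mem_bot, ← hF]
      exact hz
    rw [hx1, mul_one] at hx
    exact inv_mem_iff.mp hx

theorem inr_mul_inl {Q A : Type*} [Group Q] [Group A] [MulDistribMulAction A Q] (a : A) (x : Q) :
    (SemidirectProduct.inr a * SemidirectProduct.inl x : ActionProduct Q A)
      = SemidirectProduct.inl (a • x) * SemidirectProduct.inr a := by
  ext <;> simp

section
variable {k Q A V : Type*} [Field k] [Group Q] [Finite Q] [Group A] [MulDistribMulAction A Q]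
  [AddCommGroup V] [Module k V] {F H : Subgroup A} {q : ℕ} [Fact q.Prime]

-- The hypothesis is an identity between operators, so it passes to the algebraic closure, and
-- faithfulness of base change on endomorphisms brings the conclusion back.
open SemidirectProduct in
theorem map_inl_eq_one_of_mul_sum [FiniteDimensional k V] (hFH : IsFrobeniusGroup F H) [Fintype H]
    (hQ : IsPGroup q Q) (ρ : ActionProduct Q A →* Module.End k V) (hchar : ¬ ringChar k ∣ Nat.card Q)
    (hF : FixedPoints.subgroup F Q = ⊥) {x : Q}
    (hx : ρ (inl x) * ∑ h : H, ρ (inr (h : A)) = ∑ h : H, ρ (inr (h : A))) : ρ (inl x) = 1 := by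
  have := hFH.finite
  have : Fintype Q := Fintype.ofFinite Q
  let K := AlgebraicClosure k
  let β : Module.End k V →ₐ[k] Module.End K (TensorProduct k K V) := Module.End.baseChangeHom k K V
  have hβ : Function.Injective β := LinearMap.baseChangeHom_injective k V K
  let σ : ActionProduct Q A →* Module.End K (TensorProduct k K V) := (β : _ →* _).comp ρ
  have hQ1 : (Nat.card Q : K) ≠ 0 := by
    rw [← map_natCast (algebraMap k K), (map_ne_zero (algebraMap k K))]
    rwa [Ne, ringChar.spec]
  obtain ⟨T, hTn, hTF, hcop, hT⟩ := hFH.exists_coprime_kernel hQ hF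
  have h1 := eq_one_of_apply_sum (ρ := σ.comp inl) (τ := σ.comp inr) hQ1 hQ
    (fun a x v => by
      simp only [MonoidHom.comp_apply]
      rw [← Module.End.mul_apply, ← map_mul, inr_mul_inl, map_mul, Module.End.mul_apply])
    T H hcop hT (fun h hh hh1 t ht ht1 => hFH.fixedPointFree h hh hh1 t (hTF ht) ht1) (x := x)
    (fun v => by
      have h2 := LinearMap.congr_fun (congrArg β hx) v
      rw [map_mul, map_sum, Module.End.mul_apply, LinearMap.sum_apply] at h2
      exact h2)
  exact hβ (h1.trans (map_one β).symm)

/-- Restriction of a representation to an invariant subspace. -/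
def restrictHom {G : Type*} [Group G] (ρ : G →* Module.End k V) (W : Submodule k V)
    (hW : ∀ g, ∀ w ∈ W, ρ g w ∈ W) : G →* Module.End k W where
  toFun g := (ρ g).restrict (hW g)
  map_one' := by ext; simp
  map_mul' g h := by ext; simp

end

theorem corollary2p2 {A Q k V : Type*} [Group A] [Group Q] [Finite Q] [MulDistribMulAction A Q]
    [Field k] [AddCommGroup V] [Module k V]
    (F H : Subgroup A) (hFH : IsFrobeniusGroup F H)
    (q : ℕ) (hq : q.Prime) (hQ : IsPGroup q Q)
    (ρ : Representation k (ActionProduct Q A) V)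
    (hchar : ¬ ringChar k ∣ Nat.card Q * Nat.card H)
    (hF : FixedPoints.subgroup F Q = ⊥) :
    kernelOn ρ (FixedPoints.subgroup H Q) (moduleCentralizer ρ H) =
      kernelOn ρ (FixedPoints.subgroup H Q) ⊤ := by
  have := hFH.finite
  have : Fact q.Prime := ⟨hq⟩
  have : Fintype H := Fintype.ofFinite H
  have : Finite (ActionProduct Q A) := Finite.of_equiv _ SemidirectProduct.equivProd.symm
  refine le_antisymm (fun x hx => ⟨hx.1, fun v _ => ?_⟩) fun x hx => ⟨hx.1, fun w _ => hx.2 w trivial⟩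
  -- The submodule generated by $v$ is finite-dimensional because $QFH$ is finite. On it $x$ fixes
  -- every $H$-orbit sum, as such sums lie in $C_V(H)$.
  let W : Submodule k V := Submodule.span k (Set.range fun g => ρ g v)
  have hW : ∀ g, ∀ w ∈ W, ρ g w ∈ W := by
    intro g
    change W ≤ W.comap (ρ g)
    refine Submodule.span_le.mpr ?_
    rintro _ ⟨g', rfl⟩
    refine Submodule.subset_span ⟨g * g', ?_⟩
    change ρ (g * g') v = ρ g (ρ g' v)
    rw [map_mul, Module.End.mul_apply]
  have : FiniteDimensional k W := FiniteDimensional.span_of_finite k (Set.finite_range _)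
  have hvW : v ∈ W := Submodule.subset_span ⟨1, by simp⟩
  have h1 := map_inl_eq_one_of_mul_sum hFH hQ (restrictHom ρ W hW)
    (fun h => hchar (h.mul_right _)) hF (x := x) (by
      refine LinearMap.ext fun w => Subtype.ext ?_
      simp only [Module.End.mul_apply, LinearMap.sum_apply]
      have h2 := hx.2 (∑ h : H, ρ (SemidirectProduct.inr (h : A)) w) (fun h hh => by
        rw [map_sum]
        refine Fintype.sum_bijective ((⟨h, hh⟩ : H) * ·) (Group.mulLeft_bijective _) _ _ fun g => ?_
        rw [← Module.End.mul_apply, ← map_mul, ← map_mul]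
        rfl)
      have h3 : ((∑ h : H, restrictHom ρ W hW (SemidirectProduct.inr (h : A)) w : W) : V)
          = ∑ h : H, ρ (SemidirectProduct.inr (h : A)) w := by
        rw [Submodule.coe_sum]
        rfl
      rw [h3, ← h2, ← h3]
      rfl)
  exact congrArg Subtype.val (LinearMap.congr_fun h1 ⟨v, hvW⟩)
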